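/- \textbf{Setting.} Let $n\ge 2$ agents have local losses $f_i:\mathbb R^d\to\mathbb R$, let $r\in\mathbb R^n$ satisfy $r_i>0$, $\sum_i r_i=1$, and put $f=\sum_i r_if_i$, $x^\star=\arg\min f$. For an $n\times d$ matrix $A$ with rows $A_i$ let $\|A\|_r^2=\sum_i r_i\|A_i\|^2$. Let $\alpha(t)=\alpha_0t^{-\nu}$, $\beta(t)=\beta_0t^{-\mu}$ with $\mu,\nu\in(0,1)$, $\alpha_0>0$, $0<\beta_0\le 1$. The DIMIX iteration is $x_i(1)=0$ and, for $t\ge1$, $$x_i(t+1)=(1-\beta(t))x_i(t)+\beta(t)\Big(\sum_{j}W_{ij}(t)x_j(t)+e_i(t)\Big)-\alpha(t)\beta(t)\nabla f_i(x_i(t)),$$ and $X(t)$ is the matrix with rows $x_i(t)$, $\mathcal F_t=\sigma(X(1),\dots,X(t))$, $\bar x(t)=\sum_i r_ix_i(t)$, $Q(t)=\mathbb E\|\bar x(t)-x^\star\|^2$. Assume, for all $t\ge1$ and all $i,j$: (1) the random vectors $e_i(t)$ are square integrable, $\mathbb E[e_i(t)\mid\mathcal F_t]=0$ and $\mathbb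 E[\|e_i(t)\|^2\mid\mathcal F_t]\le\gamma$ with $\gamma>0$; (2) $W(t)$ is a (deterministic) nonnegative matrix with $W(t)\mathbf 1=\mathbf 1$ and $r^TW(t)=r^T$; $W_{ij}(t)>0$ implies $W_{ij}(t)\ge\eta$, where $\eta>0$; and for a fixed integer $B\ge1$ the directed graph with the edges $(j,i)$ for which $W_{ij}(k)>0$ for some $k\in\{t+1,\dots,t+B\}$ is strongly connected; (3) $f_i$ is differentiable, $\|\nabla f_i(x)-\nabla f_i(y)\|\le L\|x-y\|$ and $\langle\nabla f_i(x)-\nabla f_i(y),x-y\rangle\ge m\|x-y\|^2$ for all $x,y$, with $m,L>0$, and $\|\nabla f_i(x_i(t))\|^2\le K$ almost surely, for a constant $K>0$. \textbf{Constants.} Let $r_{\min}=\min_ir_i$, $c_2=\frac{mL}{m+L}$, $a=c_2\alpha_0\beta_0$, $\sigma_0=\min(2\mu,3\nu+\mu)$, $$\lambda=\frac{\eta\, r_{\min}}{2Bn^2}\min\{1,\,32(1-2^{-\mu}\beta_0)\},\qquad \kappa=\frac1{1-B\lambda\beta_0}.$$ For $\delta<1$ let $A(b,\sigma,\delta)=2^\sigma\max\{1+\frac2b,\,1+D\}$,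 where $D=\frac1{\sigma-1}\big(\frac{2(\sigma-\delta)}b\big)^{\frac{\sigma-\delta}{1-\delta}}$ if $\sigma>1$, $D=\frac2b\ln\frac{2(1-\delta)}b$ if $\sigma=1$, $D=\frac{2(\sigma-\delta)}{b(1-\sigma)}$ if $\sigma<1$; and let $A(b,\sigma,1)=2^\sigma\big(1+\frac1{|b-\sigma+1|}\big)$. Let $$T_1=\Big\lceil\Big(\tfrac{2\mu}{\lambda\beta_0}\Big)^{\frac1{1-\mu}}\Big\rceil,\quad T_2=\Big\lceil\Big(\tfrac{8\nu}{\lambda\beta_0}\Big)^{\frac1{1-\mu}}\Big\rceil,\quad T_3=\Big\lceil\Big(\tfrac{\alpha_0\beta_0(m+L)}2\Big)^{\frac1{\mu+\nu}}\Big\rceil,\quad T_0=\max(T_1,T_2,T_3),$$ and, if $\mu+\nu<1$, $T_4=\Big\lceil\Big(\tfrac{2\max(0,\min(\mu-\nu,2\nu))}{a}\Big)^{\frac1{1-\mu-\nu}}\Big\rceil$. Finally let $$\xi_1=4\gamma\kappa\beta_0^2A(\lambda\beta_0,2\mu,\mu)+\tfrac{8K\kappa\alpha_0^2\beta_0}{\lambda}A(\tfrac{\lambda\beta_0}2,2\nu+\mu,\mu),\qquad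 \xi_3=\tfrac{a}{1-\mu-\nu},\qquad \xi_2=2e^{\xi_3T_0^{1-\mu-\nu}}Q(T_0),$$ $$\xi_4=\Big(\tfrac{\alpha_0\beta_0L(mL+m+L)\xi_1}{m}+2\gamma\beta_0^2\Big)A(a,\sigma_0,\mu+\nu),\qquad \xi_5=2T_0^{a}Q(T_0)+\xi_4,$$ except that in $\xi_5$, if $\mu+\nu=1$ and $a=\min(2\mu-1,2\nu)$ (so that $A(a,\sigma_0,1)$ is infinite), $\xi_4$ is replaced by $\big(\frac{\alpha_0\beta_0L(mL+2(m+L))\xi_1}{m}+2\gamma\beta_0^2\big)A(\frac32a,\sigma_0,1)$. \textbf{Theorem.} $\mathbb E\|X(t)-\mathbf 1x^\star\|_r^2<\infty$ for all $t\ge1$, and: (i) If $\mu+\nu<1$, then for every integer $T\ge\max(T_1,T_2,T_3,T_4)$ $$\mathbb E\|X(T)-\mathbf 1x^\star\|_r^2\le\xi_1T^{-\min(\mu,2\nu)}+\xi_2\exp(-\xi_3T^{1-\mu-\nu})+\xi_4T^{-\min(\mu-\nu,2\nu)}.$$ (ii) If $\mu+\nu=1$ and $\alpha_0\beta_0\ge\frac{m+L}{mL}\min(2\mu-1,2\nu)$,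 then for every integer $T\ge\max(T_1,T_2,T_3)$ $$\mathbb E\|X(T)-\mathbf 1x^\star\|_r^2\le\xi_1T^{-\min(\mu,2\nu)}+\xi_5T^{-\min(\mu-\nu,2\nu)}.$$ (iii) In particular, if $\mu=\frac34$, $\nu=\frac14$ and $\alpha_0\beta_0\ge\frac{m+L}{2mL}$, then $\mathbb E\|X(T)-\mathbf 1x^\star\|_r^2\le(\xi_1+\xi_5)T^{-1/2}$ for every integer $T\ge\max(T_1,T_2,T_3)$. -/

import Mathlib

open MeasureTheory

noncomputable section

/-- The numerical data of the problem with `n` agents: the weight vector `r`, the connectivity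
window `B`, the lower bound `η` of the nonzero mixing weights, the step-size parameters
`α₀, β₀, μ, ν`, the noise level `γ`, the gradient bound `K`, the strong convexity modulus `m` and
the smoothness constant `L`. -/
structure Params (n : ℕ) where
  r : Fin n → ℝ
  B : ℕ
  η : ℝ
  α₀ : ℝ
  β₀ : ℝ
  μ : ℝ
  ν : ℝ
  γ : ℝ
  K : ℝ
  m : ℝ
  L : ℝ

/-- The ranges of the parameters; `r` is a strictly positive stochastic vector. The condition
`β₀ ≤ 1` says that the mixing step is a convex combination at all times. -/
structure Params.Valid {n : ℕ} (p : Params n) : Prop where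
  r_pos : ∀ i, 0 < p.r i
  r_sum : ∑ i, p.r i = 1
  B_pos : 1 ≤ p.B
  η_pos : 0 < p.η
  α₀_pos : 0 < p.α₀
  β₀_pos : 0 < p.β₀
  β₀_le : p.β₀ ≤ 1
  μ_pos : 0 < p.μ
  μ_lt : p.μ < 1
  ν_pos : 0 < p.ν
  ν_lt : p.ν < 1
  γ_pos : 0 < p.γ
  K_pos : 0 < p.K
  m_pos : 0 < p.m
  L_pos : 0 < p.L

/-- A configuration of `n` agents in `ℝ^d`: an `n × d` matrix, given by its rows. -/
abbrev Config (n d : ℕ) : Type := Fin n → EuclideanSpace ℝ (Fin d)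

/-- The squared `r`-norm of an `n × d` matrix. -/
def rNormSq {n d : ℕ} (r : Fin n → ℝ) (A : Config n d) : ℝ := ∑ i, r i * ‖A i‖ ^ 2

/-- The weighted average of the rows. -/
def rMean {n d : ℕ} (r : Fin n → ℝ) (A : Config n d) : EuclideanSpace ℝ (Fin d) :=
  ∑ i, r i • A i

/-! ### The algorithm and the assumptions -/

/-- Step size `α(t) = α₀ / t^ν`. -/
def Params.alpha {n : ℕ} (p : Params n) (t : ℕ) : ℝ := p.α₀ / (t : ℝ) ^ p.ν

/-- Step size `β(t) = β₀ / t^μ`. -/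
def Params.beta {n : ℕ} (p : Params n) (t : ℕ) : ℝ := p.β₀ / (t : ℝ) ^ p.μ

/-- `X` is the state process of DIMIX, driven by the weights `W` and the noise `e`, for the local
losses `f`; times start at `1`. -/
structure IsDimix {n d : ℕ} {Ω : Type*} (p : Params n)
    (f : Fin n → EuclideanSpace ℝ (Fin d) → ℝ) (W : ℕ → Matrix (Fin n) (Fin n) ℝ)
    (e X : ℕ → Ω → Config n d) : Prop where
  init : ∀ ω, X 1 ω = 0
  step : ∀ t, 1 ≤ t → ∀ ω i,
    X (t + 1) ω i = (1 - p.beta t) • X t ω i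
      + p.beta t • ((∑ j, W t i j • X t ω j) + e t ω i)
      - (p.alpha t * p.beta t) • gradient (f i) (X t ω i)

/-- The natural filtration of `X`: the σ-algebra generated by `X 1, …, X t`. -/
@[reducible] def pastSigma {n d : ℕ} {Ω : Type*} (X : ℕ → Ω → Config n d) (t : ℕ) : MeasurableSpace Ω :=
  ⨆ s ∈ Set.Icc 1 t, MeasurableSpace.comap (X s) inferInstance

/-- The noise is square integrable, conditionally centred given the past of the states, with
conditional second moments at most `γ`. -/
structure NoiseAssumption {n d : ℕ} {Ω : Type*} [MeasurableSpace Ω] (P : Measure Ω)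
    (γ : ℝ) (e X : ℕ → Ω → Config n d) : Prop where
  meas : ∀ t, 1 ≤ t → Measurable (e t)
  sq_int : ∀ t, 1 ≤ t → ∀ i, Integrable (fun ω => ‖e t ω i‖ ^ 2) P
  condMean : ∀ t, 1 ≤ t → ∀ i, P[fun ω => e t ω i | pastSigma X t] =ᵐ[P] 0
  condVar : ∀ t, 1 ≤ t → ∀ i,
    P[fun ω => ‖e t ω i‖ ^ 2 | pastSigma X t] ≤ᵐ[P] fun _ => γ

/-- The assumptions on the weight matrices. The graph at time `k` has an edge from `j` to `i`
exactly when `W_{ij}(k) > 0`. -/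
structure ConnectivityAssumption {n : ℕ} (p : Params n)
    (W : ℕ → Matrix (Fin n) (Fin n) ℝ) : Prop where
  nonneg : ∀ t, 1 ≤ t → ∀ i j, 0 ≤ W t i j
  row_sum : ∀ t, 1 ≤ t → ∀ i, ∑ j, W t i j = 1
  stationary : ∀ t, 1 ≤ t → ∀ j, ∑ i, p.r i * W t i j = p.r j
  lower : ∀ t, 1 ≤ t → ∀ i j, 0 < W t i j → p.η ≤ W t i j
  connected : ∀ t, 1 ≤ t → ∀ a b : Fin n,
    Relation.ReflTransGen (fun j i => ∃ k ∈ Finset.Icc (t + 1) (t + p.B), 0 < W k i j) a b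

/-- The assumptions on the local losses: differentiable, `L`-smooth, `m`-strongly convex, with
gradients bounded along the trajectory (almost surely, by one deterministic constant). -/
structure FunctionAssumption {n d : ℕ} {Ω : Type*} [MeasurableSpace Ω] (P : Measure Ω)
    (p : Params n) (f : Fin n → EuclideanSpace ℝ (Fin d) → ℝ) (X : ℕ → Ω → Config n d) :
    Prop where
  diff : ∀ i, Differentiable ℝ (f i)
  smooth : ∀ i x y, ‖gradient (f i) x - gradient (f i) y‖ ≤ p.L * ‖x - y‖
  strong : ∀ i x y,
    p.m * ‖x - y‖ ^ 2 ≤ inner ℝ (gradient (f i) x - gradient (f i) y) (x - y)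
  bounded : ∀ t, 1 ≤ t → ∀ i, ∀ᵐ ω ∂P, ‖gradient (f i) (X t ω i)‖ ^ 2 ≤ p.K

/-! ### The explicit constants -/

/-- The constant `A(a, σ, δ)`. -/
def Aconst (a σ δ : ℝ) : ℝ :=
  if δ = 1 then 2 ^ σ * (1 + 1 / |a - σ + 1|)
  else if 1 < σ then
    2 ^ σ * max (1 + 2 / a)
      (1 + 1 / (σ - 1) * (2 * (σ - δ) / a) ^ ((σ - δ) / (1 - δ)))
  else if σ = 1 then
    2 ^ σ * max (1 + 2 / a) (1 + 2 / a * Real.log (2 * (1 - δ) / a))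
  else
    2 ^ σ * max (1 + 2 / a) (1 + 2 * (σ - δ) / (a * (1 - σ)))

namespace Params

variable {n : ℕ} (p : Params n)

/-- The mixing rate `λ`. The second factor is `1` as soon as `β₀ 2^{-μ} ≤ 31/32`. -/
def lam : ℝ :=
  p.η * (⨅ i, p.r i) / (2 * p.B * (n : ℝ) ^ 2) * min 1 (32 * (1 - p.β₀ * 2 ^ (-p.μ)))

/-- `κ = (1 - B λ β₀)⁻¹`. -/
def kappa : ℝ := (1 - p.B * p.lam * p.β₀)⁻¹

/-- `c₂ = m L / (m + L)`. -/
def c₂ : ℝ := p.m * p.L / (p.m + p.L)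

def T₁ : ℕ := ⌈(2 * p.μ / (p.lam * p.β₀)) ^ (1 / (1 - p.μ))⌉₊

def T₂ : ℕ := ⌈(8 * p.ν / (p.lam * p.β₀)) ^ (1 / (1 - p.μ))⌉₊

def T₃ : ℕ := ⌈(p.α₀ * p.β₀ * (p.m + p.L) / 2) ^ (1 / (p.μ + p.ν))⌉₊

/-- Used for `μ + ν < 1`; the base of the power is replaced by `0` when it is negative. -/
def T₄ : ℕ :=
  ⌈(max 0 (2 * min (p.μ - p.ν) (2 * p.ν) / (p.c₂ * p.α₀ * p.β₀)))
    ^ (1 / (1 - p.μ - p.ν))⌉₊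

/-- `T₀ = max (T₁, T₂, T₃)`. -/
def T₀ : ℕ := max p.T₁ (max p.T₂ p.T₃)

/-- The exponent `min (2μ, 3ν + μ)`. -/
def σ₀ : ℝ := min (2 * p.μ) (3 * p.ν + p.μ)

def ξ₁ : ℝ :=
  4 * p.γ * p.kappa * p.β₀ ^ 2 * Aconst (p.lam * p.β₀) (2 * p.μ) p.μ
    + 8 * p.K * p.kappa * p.α₀ ^ 2 * p.β₀ / p.lam
        * Aconst (p.lam * p.β₀ / 2) (2 * p.ν + p.μ) p.μ

def ξ₃ : ℝ := p.α₀ * p.β₀ * p.m * p.L / ((1 - p.μ - p.ν) * (p.m + p.L))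

/-- `Q₀` stands for the mean squared distance of the averaged state from the optimum at
time `T₀`. -/
def ξ₂ (Q₀ : ℝ) : ℝ := 2 * Real.exp (p.ξ₃ * (p.T₀ : ℝ) ^ (1 - p.μ - p.ν)) * Q₀

def ξ₄ : ℝ :=
  (p.α₀ * p.β₀ * p.L * (p.m * p.L + p.m + p.L) * p.ξ₁ / p.m + 2 * p.γ * p.β₀ ^ 2)
    * Aconst (p.α₀ * p.β₀ * p.m * p.L / (p.m + p.L)) p.σ₀ (p.μ + p.ν)

/-- The substitute for `ξ₄` in the critical case `μ + ν = 1`, `c₂ α₀ β₀ = σ₀ - 1`, in which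
`A(c₂ α₀ β₀, σ₀, 1)` is infinite. -/
def ξ₄crit : ℝ :=
  (p.α₀ * p.β₀ * p.L * (p.m * p.L + 2 * (p.m + p.L)) * p.ξ₁ / p.m + 2 * p.γ * p.β₀ ^ 2)
    * Aconst (3 / 2 * (p.α₀ * p.β₀ * p.m * p.L / (p.m + p.L))) p.σ₀ 1

open Classical in
def ξ₅ (Q₀ : ℝ) : ℝ :=
  2 * (p.T₀ : ℝ) ^ (p.α₀ * p.β₀ * p.m * p.L / (p.m + p.L)) * Q₀
    + if p.α₀ * p.β₀ = (p.m + p.L) / (p.m * p.L) * min (2 * p.μ - 1) (2 * p.ν)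
      then p.ξ₄crit else p.ξ₄

end Params

/-- The squared `r`-distance `‖X(t) - 1 x⋆‖_r²` as a random variable. -/
def sqDist {n d : ℕ} {Ω : Type*} (p : Params n) (X : ℕ → Ω → Config n d)
    (xs : EuclideanSpace ℝ (Fin d)) (t : ℕ) (ω : Ω) : ℝ :=
  rNormSq p.r (fun i => X t ω i - xs)

/-- `Q(t) = E ‖x̄(t) - x⋆‖²` with the averaged state `x̄(t) = ∑ᵢ rᵢ xᵢ(t)`. -/
def meanGap {n d : ℕ} {Ω : Type*} [MeasurableSpace Ω] (P : Measure Ω) (p : Params n)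
    (X : ℕ → Ω → Config n d) (xs : EuclideanSpace ℝ (Fin d)) (t : ℕ) : ℝ :=
  ∫ ω, ‖rMean p.r (X t ω) - xs‖ ^ 2 ∂P

end

/-! By the parallel axis theorem (`rNormSq_sub_const`), ‖X - 1x⋆‖_r² is the dispersion of the rows
about their weighted mean plus the squared distance of that mean from x⋆. The two parts are
estimated separately, and the dispersion bound is fed into the second estimate.

Dispersion. One step applies the matrix (1 - β)I + βW, which preserves the r-mean, and then adds
noise and a gradient. Averaging lowers the r-variance by at least a weighted sum of squared
differences across edges (`wVar_step`). Within a connected window at most n - 1 edges already span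
the range of the values (`exists_spanning_edges`), so every window contracts by a definite factor
(`wVar_window`); `le_prod_of_block_contraction` converts this into ∏ (1 - λβ(k)) at the single cost
κ. By linearity the state splits into a noise part and a gradient part. Noise injected at different
times is orthogonal in expectation, so its dispersions add. Gradient terms are merely bounded, so
they are combined by the triangle inequality for √disp, followed by Cauchy–Schwarz. The resulting
rates are T^{-μ} and T^{-2ν}.

Mean. Since averaging preserves it, the mean performs gradient descent on f with step αβ, centred
noise, and a gradient error whose square is at most L² times the dispersion. Coercivity of the
gradient makes the exact step contract by 1 - 2c₂αβ (`gradient_step_contracts`). Keeping ρ of the 2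
units of contraction and spending the rest on the error gives Q(t+1) ≤ (1 - ρa t^{-(μ+ν)}) Q(t) + C
t^{-σ₀} (`meanGap_succ_le`).

All rates then come from one estimate of ∑ s^{-σ} ∏ (1 - b k^{-δ}) by T^{-(σ-δ)}. The products are
compared with exp(-bψ), where ψ' = u^{-δ}, and the sum with an integral. For δ < 1 the integrand is
eventually at most 2/b times the derivative of u^{-(σ-δ)}e^{bψ}; the thresholds T₁, T₂, T₄ express
that T lies in this range. For δ = 1 everything is a power of u. The borderline a = σ₀ - 1 would
then produce a logarithm, which is avoided by taking ρ = 3/2 instead of ρ = 1. -/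

noncomputable section

/-! ### Weighted sums with polynomially decaying step sizes -/

open Set in
/-- A sum of a function that first decreases and then increases is at most its last value plus
its integral. -/
lemma sum_le_add_integral_of_antitoneOn_monotoneOn {g : ℝ → ℝ} {p : ℝ} {N : ℕ} (hN : 1 ≤ N)
    (hc : ContinuousOn g (Ici 1)) (hg : ∀ u, 1 ≤ u → 0 ≤ g u)
    (hanti : AntitoneOn g (Icc 1 p)) (hmono : MonotoneOn g (Icc p N)) :
    ∑ u ∈ Finset.Ico 1 N, g ((u : ℝ) + 1) ≤ g N + ∫ u in (1 : ℝ)..N, g u := by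
  have hint : ∀ {a b : ℝ}, 1 ≤ a → a ≤ b → IntervalIntegrable g volume a b := fun ha hab =>
    (hc.mono (by rw [uIcc_of_le hab]; exact fun x hx => ha.trans hx.1)).intervalIntegrable
  -- While g decreases, each new term is at most the integral over the interval to its left. The
  -- step that passes `p` places its term in the extra summand g T. From then on the old extra
  -- summand is absorbed by the next integral and replaced by the new last term.
  have key : ∀ T : ℕ, 1 ≤ T → T ≤ N → ∑ u ∈ Finset.Ico 1 T, g ((u : ℝ) + 1) ≤
      (if (T : ℝ) ≤ p then 0 else g T) + ∫ u in (1 : ℝ)..T, g u := by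
    intro T hT
    induction T, hT using Nat.le_induction with
    | base =>
      intro _
      simp only [Finset.Ico_self, Finset.sum_empty, Nat.cast_one, intervalIntegral.integral_same,
        add_zero]
      split_ifs
      · exact le_rfl
      · exact hg 1 le_rfl
    | succ T hT ih =>
      intro hTN
      have hT1 : (1 : ℝ) ≤ T := by exact_mod_cast hT
      have hTN' : ((T : ℝ) + 1) ≤ N := by exact_mod_cast hTN
      have ih := ih (by omega)
      rw [Finset.sum_Ico_succ_top hT, Nat.cast_add, Nat.cast_one,
        ← intervalIntegral.integral_add_adjacent_intervals (hint le_rfl hT1)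
          (hint hT1 (by linarith : (T : ℝ) ≤ T + 1))]
      have hconst : ∀ c : ℝ, (∀ x ∈ Icc (T : ℝ) (T + 1), c ≤ g x) →
          c ≤ ∫ u in (T : ℝ)..(T + 1), g u := by
        intro c h
        have := intervalIntegral.integral_mono_on (by linarith : (T : ℝ) ≤ T + 1)
          (intervalIntegrable_const (c := c)) (hint hT1 (by linarith)) h
        simpa using this
      by_cases h1 : (T : ℝ) + 1 ≤ p
      · rw [if_pos (by linarith)] at ih
        rw [if_pos h1]
        have := hconst (g (T + 1)) fun x hx => hanti ⟨hT1.trans hx.1, hx.2.trans h1⟩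
          ⟨by linarith, h1⟩ hx.2
        linarith
      · rw [if_neg h1]
        by_cases h2 : (T : ℝ) ≤ p
        · rw [if_pos h2] at ih
          have := hconst 0 fun x hx => hg x (hT1.trans hx.1)
          linarith
        · rw [if_neg h2] at ih
          push Not at h2
          have := hconst (g T) fun x hx => hmono ⟨h2.le, by linarith⟩
            ⟨h2.le.trans hx.1, hx.2.trans hTN'⟩ hx.1
          linarith
  have h := key N hN le_rfl
  have hN1 : (1 : ℝ) ≤ N := by exact_mod_cast hN
  split_ifs at h
  · linarith [hg N hN1]
  · exact h

section Weights

variable {b σ δ : ℝ} {ψ : ℝ → ℝ}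

/-- Increments of an antiderivative of `u ^ (-δ)`. -/
lemma potential_increment_le (hδ : 0 ≤ δ) (hψ : ∀ u : ℝ, 0 < u → HasDerivAt ψ (u ^ (-δ)) u)
    {k : ℕ} (hk : 1 ≤ k) : ψ ((k : ℝ) + 1) - ψ k ≤ 1 / (k : ℝ) ^ δ := by
  have hk0 : (0 : ℝ) < k := by exact_mod_cast hk
  obtain ⟨c, hc, h⟩ := exists_hasDerivAt_eq_slope ψ (fun u => u ^ (-δ))
    (by linarith : (k : ℝ) < k + 1)
    (fun x hx => (hψ x (hk0.trans_le hx.1)).continuousAt.continuousWithinAt)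
    (fun x hx => hψ x (hk0.trans hx.1))
  have h' : ψ ((k : ℝ) + 1) - ψ k = c ^ (-δ) := by rw [h]; simp
  rw [h', one_div, ← Real.rpow_neg hk0.le]
  exact Real.rpow_le_rpow_of_nonpos hk0 hc.1.le (by linarith)

/-- Follows from 1 - x ≤ e^{-x} and k^{-δ} ≥ ψ(k+1) - ψ(k). Keeping ψ abstract treats the power (δ <
1) and the logarithm (δ = 1) together. -/
lemma prod_one_sub_le_exp (hb : 0 ≤ b) (hδ : 0 ≤ δ)
    (hψ : ∀ u : ℝ, 0 < u → HasDerivAt ψ (u ^ (-δ)) u) {s T : ℕ} (hs : 1 ≤ s) (hsT : s ≤ T)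
    (hnn : ∀ k, s ≤ k → 0 ≤ 1 - b / (k : ℝ) ^ δ) :
    ∏ k ∈ Finset.Ico s T, (1 - b / (k : ℝ) ^ δ) ≤ Real.exp (b * (ψ s - ψ T)) := by
  induction T, hsT using Nat.le_induction with
  | base => simp
  | succ T hT ih =>
    rw [Finset.prod_Ico_succ_top hT]
    have h1 : 1 - b / (T : ℝ) ^ δ ≤ Real.exp (b * (ψ T - ψ (T + 1))) := by
      have h := potential_increment_le hδ hψ (hs.trans hT)
      have h2 := Real.add_one_le_exp (b * (ψ T - ψ (T + 1)))
      have h3 : b * (ψ (T + 1) - ψ T) ≤ b * (1 / (T : ℝ) ^ δ) := mul_le_mul_of_nonneg_left h hb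
      have h4 : b / (T : ℝ) ^ δ = b * (1 / (T : ℝ) ^ δ) := by ring
      rw [h4]; linarith
    calc _ ≤ Real.exp (b * (ψ s - ψ T)) * Real.exp (b * (ψ T - ψ (T + 1))) :=
          mul_le_mul ih h1 (hnn T hT) (Real.exp_pos _).le
      _ = _ := by rw [← Real.exp_add]; push_cast; ring_nf

/-- The weighted sum `∑ s^{-σ} ∏ (1 - b k^{-δ})`. -/
def weightedSum (b σ δ : ℝ) (s₀ T : ℕ) : ℝ :=
  ∑ s ∈ Finset.Ico s₀ T, 1 / (s : ℝ) ^ σ * ∏ k ∈ Finset.Ico (s + 1) T, (1 - b / (k : ℝ) ^ δ)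

/-- The product begins at s + 1, so the exponential is evaluated there. Since s + 1 ≤ 2s, the factor
2^σ moves s^{-σ} to the same point, and each summand becomes a value of a single function. Extending
the sum down to 1 removes the dependence on `s₀`. -/
lemma weightedSum_le_sum_exp (hb : 0 ≤ b) (hσ : 0 ≤ σ) (hδ : 0 ≤ δ)
    (hψ : ∀ u : ℝ, 0 < u → HasDerivAt ψ (u ^ (-δ)) u) {s₀ T : ℕ} (hs : 1 ≤ s₀)
    (hnn : ∀ k, s₀ ≤ k → 0 ≤ 1 - b / (k : ℝ) ^ δ) :
    weightedSum b σ δ s₀ T ≤ 2 ^ σ * Real.exp (-(b * ψ T)) *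
      ∑ u ∈ Finset.Ico 1 T, ((u : ℝ) + 1) ^ (-σ) * Real.exp (b * ψ ((u : ℝ) + 1)) := by
  have h1 : weightedSum b σ δ s₀ T ≤ ∑ s ∈ Finset.Ico s₀ T, 2 ^ σ * Real.exp (-(b * ψ T)) *
      (((s : ℝ) + 1) ^ (-σ) * Real.exp (b * ψ ((s : ℝ) + 1))) := by
    refine Finset.sum_le_sum fun s hsm => ?_
    rw [Finset.mem_Ico] at hsm
    have hs1 : (1 : ℝ) ≤ s := by exact_mod_cast hs.trans hsm.1
    have hp := prod_one_sub_le_exp hb hδ hψ (s := s + 1) (T := T) (by omega) (by omega)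
      (fun k hk => hnn k (by omega))
    have hq : 1 / (s : ℝ) ^ σ ≤ 2 ^ σ * ((s : ℝ) + 1) ^ (-σ) := by
      rw [Real.rpow_neg (by linarith), ← div_eq_mul_inv, div_le_div_iff₀ (by positivity)
        (by positivity), one_mul, ← Real.mul_rpow (by norm_num) (by linarith)]
      exact Real.rpow_le_rpow (by linarith) (by linarith) hσ
    calc _ ≤ (2 ^ σ * ((s : ℝ) + 1) ^ (-σ)) * Real.exp (b * (ψ ((s + 1 : ℕ) : ℝ) - ψ T)) :=
          mul_le_mul hq hp (Finset.prod_nonneg fun k hk => hnn k (by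
            rw [Finset.mem_Ico] at hk; omega)) (by positivity)
      _ = _ := by
          have : b * (ψ ((s + 1 : ℕ) : ℝ) - ψ T) = -(b * ψ T) + b * ψ ((s : ℝ) + 1) := by
            push_cast; ring
          rw [this, Real.exp_add]; ring
  refine h1.trans ?_
  rw [← Finset.mul_sum]
  refine mul_le_mul_of_nonneg_left ?_ (by positivity)
  refine Finset.sum_le_sum_of_subset_of_nonneg (Finset.Ico_subset_Ico_left hs) fun u _ _ => ?_
  positivity

lemma hasDerivAt_rpow_mul_exp (hψ : ∀ u : ℝ, 0 < u → HasDerivAt ψ (u ^ (-δ)) u) (τ : ℝ)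
    {u : ℝ} (hu : 0 < u) :
    HasDerivAt (fun u => u ^ (-τ) * Real.exp (b * ψ u))
      ((b * u ^ (-δ) - τ / u) * (u ^ (-τ) * Real.exp (b * ψ u))) u := by
  have h1 := (Real.hasDerivAt_rpow_const (p := -τ) (Or.inl hu.ne')).mul
    (((hψ u hu).const_mul b).exp)
  refine h1.congr_deriv ?_
  rw [Real.rpow_sub_one hu.ne']
  ring

-- The logarithmic derivative of u^{-σ}e^{bψ(u)} is (b u^{1-δ} - σ)/u, so the sign conditions on
-- either side of `p` say that the function first falls and then rises.
open Set in
lemma weightedSum_le_integral (hb : 0 ≤ b) (hσ : 0 ≤ σ) (hδ : 0 ≤ δ)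
    (hψ : ∀ u : ℝ, 0 < u → HasDerivAt ψ (u ^ (-δ)) u) {s₀ T : ℕ} (hs : 1 ≤ s₀) (hT : 1 ≤ T)
    (hnn : ∀ k, s₀ ≤ k → 0 ≤ 1 - b / (k : ℝ) ^ δ)
    {p : ℝ} (hp : 1 ≤ p) (h1 : ∀ u, 1 < u → u < p → b * u ^ (1 - δ) ≤ σ)
    (h2 : ∀ u, p < u → u < T → σ ≤ b * u ^ (1 - δ)) :
    weightedSum b σ δ s₀ T ≤ 2 ^ σ * Real.exp (-(b * ψ T)) *
      ((T : ℝ) ^ (-σ) * Real.exp (b * ψ T)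
        + ∫ u in (1 : ℝ)..T, u ^ (-σ) * Real.exp (b * ψ u)) := by
  refine (weightedSum_le_sum_exp hb hσ hδ hψ hs hnn).trans
    (mul_le_mul_of_nonneg_left ?_ (by positivity))
  have hderiv : ∀ u : ℝ, 0 < u → HasDerivAt (fun u => u ^ (-σ) * Real.exp (b * ψ u))
      ((b * u ^ (1 - δ) - σ) * (u ^ (-σ) * Real.exp (b * ψ u) / u)) u := fun u hu => by
    refine (hasDerivAt_rpow_mul_exp hψ σ hu).congr_deriv ?_
    rw [sub_eq_neg_add 1 δ, Real.rpow_add_one hu.ne']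
    field_simp
  have hcont : ContinuousOn (fun u => u ^ (-σ) * Real.exp (b * ψ u)) (Ici 1) := fun u hu =>
    (hderiv u (zero_lt_one.trans_le hu)).continuousAt.continuousWithinAt
  refine sum_le_add_integral_of_antitoneOn_monotoneOn
    (g := fun u => u ^ (-σ) * Real.exp (b * ψ u)) (p := p) hT hcont
    (fun u hu => by positivity) ?_ ?_
  · refine antitoneOn_of_hasDerivWithinAt_nonpos (convex_Icc _ _)
      (hcont.mono Icc_subset_Ici_self)
      (fun u hu => (hderiv u ?_).hasDerivWithinAt) (fun u hu => ?_)
    · rw [interior_Icc] at hu; linarith [hu.1]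
    · rw [interior_Icc] at hu
      have : 0 < u := by linarith [hu.1]
      exact mul_nonpos_of_nonpos_of_nonneg (by linarith [h1 u hu.1 hu.2]) (by positivity)
  · refine monotoneOn_of_hasDerivWithinAt_nonneg (convex_Icc _ _)
      (hcont.mono fun x hx => hp.trans hx.1)
      (fun u hu => (hderiv u ?_).hasDerivWithinAt) (fun u hu => ?_)
    · rw [interior_Icc] at hu; linarith [hu.1]
    · rw [interior_Icc] at hu
      have : 0 < u := by linarith [hu.1]
      exact mul_nonneg (by linarith [h2 u hu.1 hu.2]) (by positivity)

-- The derivative of u^{-(σ-δ)}e^{bψ} is (b u^{-δ} - (σ-δ)/u) u^{-(σ-δ)}e^{bψ}. The hypothesis says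
-- that (σ-δ)/u is at most half of b u^{-δ}, so the integrand is at most 2/b times this derivative.
open Set in
lemma integral_rpow_mul_exp_le (hb : 0 < b)
    (hψ : ∀ u : ℝ, 0 < u → HasDerivAt ψ (u ^ (-δ)) u) {t T : ℝ} (ht : 1 ≤ t) (htT : t ≤ T)
    (h : ∀ u ∈ Icc t T, 2 * (σ - δ) / b ≤ u ^ (1 - δ)) :
    ∫ u in t..T, u ^ (-σ) * Real.exp (b * ψ u) ≤
      2 / b * (T ^ (-(σ - δ)) * Real.exp (b * ψ T) - t ^ (-(σ - δ)) * Real.exp (b * ψ t)) := by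
  have hpos : ∀ u ∈ uIcc t T, 0 < u := fun u hu => by
    rw [uIcc_of_le htT] at hu; linarith [hu.1]
  have hcψ : ContinuousOn ψ (uIcc t T) := fun u hu =>
    (hψ u (hpos u hu)).continuousAt.continuousWithinAt
  have hcr : ∀ q : ℝ, ContinuousOn (fun u : ℝ => u ^ q) (uIcc t T) := fun q u hu =>
    (Real.continuousAt_rpow_const u q (Or.inl (hpos u hu).ne')).continuousWithinAt
  have hce : ContinuousOn (fun u => Real.exp (b * ψ u)) (uIcc t T) :=
    (hcψ.const_smul b).rexp
  have hi : IntervalIntegrable (fun u => (b * u ^ (-δ) - (σ - δ) / u) *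
      (u ^ (-(σ - δ)) * Real.exp (b * ψ u))) volume t T := by
    refine ContinuousOn.intervalIntegrable ?_
    refine ((continuousOn_const.mul (hcr _)).sub (continuousOn_const.div continuousOn_id
      fun u hu => (hpos u hu).ne')).mul ((hcr _).mul hce)
  have hF := intervalIntegral.integral_eq_sub_of_hasDerivAt
    (fun u hu => hasDerivAt_rpow_mul_exp (b := b) hψ (σ - δ) (hpos u hu)) hi
  rw [← hF, ← intervalIntegral.integral_const_mul]
  refine intervalIntegral.integral_mono_on htT ((hcr _).mul hce).intervalIntegrable
    (hi.const_mul _) fun u hu => ?_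
  have hu0 : 0 < u := by linarith [hu.1]
  have h1 := h u hu
  have hE := Real.exp_pos (b * ψ u)
  have e1 : u ^ (-σ) = u ^ (-δ) * u ^ (-(σ - δ)) := by
    rw [← Real.rpow_add hu0]; ring_nf
  have e2 : u ^ (1 - δ) = u ^ (-δ) * u := by
    rw [sub_eq_neg_add 1 δ, Real.rpow_add_one hu0.ne']
  have h3 : u ^ (-δ) ≤ 2 / b * (b * u ^ (-δ) - (σ - δ) / u) := by
    rw [e2, div_le_iff₀ hb] at h1
    have h4 : (σ - δ) / u ≤ u ^ (-δ) * b / 2 := by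
      rw [div_le_iff₀ hu0]; linarith
    have h5 : 2 / b * (b * u ^ (-δ) - (σ - δ) / u) = 2 * u ^ (-δ) - 2 / b * ((σ - δ) / u) := by
      field_simp
    have h6 : 2 / b * ((σ - δ) / u) ≤ 2 / b * (u ^ (-δ) * b / 2) :=
      mul_le_mul_of_nonneg_left h4 (by positivity)
    have h7 : 2 / b * (u ^ (-δ) * b / 2) = u ^ (-δ) := by field_simp
    rw [h5]; linarith
  calc u ^ (-σ) * Real.exp (b * ψ u) = u ^ (-δ) * (u ^ (-(σ - δ)) * Real.exp (b * ψ u)) := by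
        rw [e1]; ring
    _ ≤ (2 / b * (b * u ^ (-δ) - (σ - δ) / u)) * (u ^ (-(σ - δ)) * Real.exp (b * ψ u)) :=
        mul_le_mul_of_nonneg_right h3 (by positivity)
    _ = _ := by ring

end Weights

lemma hasDerivAt_rpow_potential {δ : ℝ} (hδ : δ < 1) {u : ℝ} (hu : 0 < u) :
    HasDerivAt (fun u : ℝ => u ^ (1 - δ) / (1 - δ)) (u ^ (-δ)) u := by
  have h : 1 - δ ≠ 0 := by linarith
  refine ((Real.hasDerivAt_rpow_const (p := 1 - δ) (Or.inl hu.ne')).div_const _).congr_deriv ?_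
  rw [show 1 - δ - 1 = -δ by ring]
  field_simp

lemma hasDerivAt_log_potential {u : ℝ} (hu : 0 < u) :
    HasDerivAt Real.log (u ^ (-1 : ℝ)) u := by
  rw [Real.rpow_neg_one]; exact Real.hasDerivAt_log hu.ne'

lemma Aconst_nonneg_of_lt {b σ δ : ℝ} (hb : 0 < b) (hδ : δ < 1) :
    0 ≤ Aconst b σ δ := by
  have h : ∀ x : ℝ, 0 ≤ (2 : ℝ) ^ σ * max (1 + 2 / b) x := fun x =>
    mul_nonneg (by positivity) (le_max_of_le_left (by positivity))
  unfold Aconst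
  rw [if_neg hδ.ne]
  split_ifs
  · exact h _
  · exact h _
  · exact h _

lemma integral_rpow_neg_of_ne_one {σ τ : ℝ} (hσ : σ ≠ 1) (hτ : 1 ≤ τ) :
    ∫ u in (1 : ℝ)..τ, u ^ (-σ) = (τ ^ (1 - σ) - 1) / (1 - σ) := by
  rw [integral_rpow (Or.inr ⟨fun h => hσ (by linarith), fun h => by
    rw [Set.uIcc_of_le hτ] at h; linarith [h.1]⟩), Real.one_rpow]
  ring_nf

/-- The constant `D` in the definition of `A(b, σ, δ)`, `δ < 1`, is at least
`τ^{σ-δ} ∫₁^τ u^{-σ}` for `τ = (2(σ-δ)/b)^{1/(1-δ)}`. -/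
lemma Aconst_ge {b σ δ τ : ℝ} (hb : 0 < b) (hδ : δ < 1) (hτ : 1 ≤ τ)
    (hτe : τ = (2 * (σ - δ) / b) ^ (1 / (1 - δ))) (hx : 1 ≤ 2 * (σ - δ) / b) :
    ∃ M, 2 / b ≤ M ∧ τ ^ (σ - δ) * (∫ u in (1 : ℝ)..τ, u ^ (-σ)) ≤ M ∧
      2 ^ σ * (1 + M) ≤ Aconst b σ δ := by
  have h1δ : 0 < 1 - δ := by linarith
  have hτ0 : 0 < τ := by linarith
  have hx0 : 0 < 2 * (σ - δ) / b := by linarith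
  have hτp : τ ^ (1 - δ) = 2 * (σ - δ) / b := by
    rw [hτe, ← Real.rpow_mul hx0.le, one_div_mul_cancel h1δ.ne', Real.rpow_one]
  have hσδ : 0 < σ - δ := by
    by_contra hh
    have : 2 * (σ - δ) / b ≤ 0 := div_nonpos_of_nonpos_of_nonneg (by linarith) hb.le
    linarith
  have key : ∀ D, τ ^ (σ - δ) * (∫ u in (1 : ℝ)..τ, u ^ (-σ)) ≤ D →
      Aconst b σ δ = 2 ^ σ * max (1 + 2 / b) (1 + D) →
      ∃ M, 2 / b ≤ M ∧ τ ^ (σ - δ) * (∫ u in (1 : ℝ)..τ, u ^ (-σ)) ≤ M ∧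
      2 ^ σ * (1 + M) ≤ Aconst b σ δ := by
    intro D h1 h2
    refine ⟨max (2 / b) D, le_max_left _ _, h1.trans (le_max_right _ _), ?_⟩
    rw [h2, max_add_add_left]
  rcases lt_trichotomy 1 σ with hσ | hσ | hσ
  · refine key (1 / (σ - 1) * (2 * (σ - δ) / b) ^ ((σ - δ) / (1 - δ))) ?_ ?_
    · rw [integral_rpow_neg_of_ne_one hσ.ne' hτ]
      have e : (2 * (σ - δ) / b) ^ ((σ - δ) / (1 - δ)) = τ ^ (σ - δ) := by
        rw [hτe, ← Real.rpow_mul hx0.le]; congr 1; ring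
      rw [e, mul_comm]
      refine mul_le_mul_of_nonneg_right ?_ (by positivity)
      rw [← neg_div_neg_eq, div_le_div_iff₀ (by linarith) (by linarith)]
      have : 0 < τ ^ (1 - σ) := by positivity
      nlinarith
    · rw [Aconst, if_neg hδ.ne, if_pos hσ]
  · subst hσ
    refine key (2 / b * Real.log (2 * (1 - δ) / b)) ?_ ?_
    · have : ∫ u in (1 : ℝ)..τ, u ^ (-1 : ℝ) = Real.log τ := by
        simp_rw [Real.rpow_neg_one]
        rw [integral_inv_of_pos zero_lt_one hτ0, div_one]
      rw [this, ← hτp, Real.log_rpow hτ0, hτp]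
      refine le_of_eq ?_
      field_simp
    · rw [Aconst, if_neg hδ.ne, if_neg (lt_irrefl _), if_pos rfl]
  · refine key (2 * (σ - δ) / (b * (1 - σ))) ?_ ?_
    · rw [integral_rpow_neg_of_ne_one hσ.ne hτ]
      have h1σ : 0 < 1 - σ := by linarith
      have e : τ ^ (σ - δ) * τ ^ (1 - σ) = 2 * (σ - δ) / b := by
        rw [← Real.rpow_add hτ0, ← hτp]; congr 1; ring
      have e2 : 2 * (σ - δ) / (b * (1 - σ)) = (τ ^ (σ - δ) * τ ^ (1 - σ)) / (1 - σ) := by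
        rw [e]; field_simp
      rw [e2, ← mul_div_assoc]
      have : 0 < τ ^ (σ - δ) := by positivity
      gcongr
      linarith
    · rw [Aconst, if_neg hδ.ne, if_neg (by linarith), if_neg hσ.ne]

/-- The weighted sum bound in the subcritical case `δ < 1`. -/
theorem weightedSum_le_of_lt_one {b σ δ : ℝ} (hb : 0 < b) (hσ : 0 ≤ σ) (hδ0 : 0 ≤ δ)
    (hδ : δ < 1) {s₀ T : ℕ} (hs : 1 ≤ s₀) (hT : 1 ≤ T)
    (hnn : ∀ k, s₀ ≤ k → 0 ≤ 1 - b / (k : ℝ) ^ δ)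
    (hTτ : 2 * (σ - δ) / b ≤ (T : ℝ) ^ (1 - δ)) :
    weightedSum b σ δ s₀ T ≤ Aconst b σ δ * (T : ℝ) ^ (-(σ - δ)) := by
  have h1δ : 0 < 1 - δ := by linarith
  have hT1 : (1 : ℝ) ≤ T := by exact_mod_cast hT
  set ψ : ℝ → ℝ := fun u => u ^ (1 - δ) / (1 - δ) with hψdef
  have hψ : ∀ u : ℝ, 0 < u → HasDerivAt ψ (u ^ (-δ)) u := fun u hu =>
    hasDerivAt_rpow_potential hδ hu
  have hcont : ContinuousOn (fun u => u ^ (-σ) * Real.exp (b * ψ u)) (Set.Ici 1) := fun u hu => by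
    have hu0 : 0 < u := zero_lt_one.trans_le hu
    exact (hasDerivAt_rpow_mul_exp hψ σ hu0).continuousAt.continuousWithinAt
  have hint : ∀ {x y : ℝ}, 1 ≤ x → x ≤ y →
      IntervalIntegrable (fun u => u ^ (-σ) * Real.exp (b * ψ u)) volume x y := fun ha hab =>
    (hcont.mono (by rw [Set.uIcc_of_le hab]; exact fun x hx => ha.trans hx.1)).intervalIntegrable
  -- The turning point is where b u^{1-δ} = σ, moved to 1 if it lies below 1.
  have hsum := weightedSum_le_integral hb.le hσ hδ0 hψ hs hT hnn
    (p := max 1 ((σ / b) ^ (1 / (1 - δ)))) (le_max_left _ _)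
    (fun u hu1 hu => by
      have hu' : u < (σ / b) ^ (1 / (1 - δ)) := by
        rcases lt_max_iff.1 hu with h | h
        · linarith
        · exact h
      have := Real.rpow_le_rpow (by linarith) hu'.le h1δ.le
      rw [← Real.rpow_mul (by positivity), one_div_mul_cancel h1δ.ne', Real.rpow_one,
        le_div_iff₀ hb] at this
      linarith)
    (fun u hu _ => by
      have hu' := (max_lt_iff.1 hu).2
      have := Real.rpow_le_rpow (by positivity) hu'.le h1δ.le
      rw [← Real.rpow_mul (by positivity), one_div_mul_cancel h1δ.ne', Real.rpow_one,
        div_le_iff₀ hb] at this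
      linarith)
  set h : ℝ → ℝ := fun u => u ^ (-(σ - δ)) * Real.exp (b * ψ u) with hh
  have hgh : (T : ℝ) ^ (-σ) * Real.exp (b * ψ T) ≤ h T :=
    mul_le_mul_of_nonneg_right (Real.rpow_le_rpow_of_exponent_le hT1 (by linarith))
      (Real.exp_pos _).le
  have hhT : 0 < h T := by positivity
  have key : ∃ M, 2 ^ σ * (1 + M) ≤ Aconst b σ δ ∧
      ∫ u in (1 : ℝ)..T, u ^ (-σ) * Real.exp (b * ψ u) ≤ M * h T := by
    -- If the threshold is at most 1, the derivative comparison already works from u = 1. Otherwise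
    -- the integral is split at τ, the point where it starts to work.
    by_cases hx : 2 * (σ - δ) / b ≤ 1
    · refine ⟨2 / b, ?_, ?_⟩
      · have hg : ∀ x : ℝ, (2 : ℝ) ^ σ * (1 + 2 / b) ≤ 2 ^ σ * max (1 + 2 / b) x := fun x =>
          mul_le_mul_of_nonneg_left (le_max_left _ _) (by positivity)
        unfold Aconst
        rw [if_neg hδ.ne]
        split_ifs
        · exact hg _
        · exact hg _
        · exact hg _
      · refine (integral_rpow_mul_exp_le hb hψ le_rfl hT1 fun u hu =>
          hx.trans (Real.one_le_rpow hu.1 h1δ.le)).trans ?_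
        refine mul_le_mul_of_nonneg_left ?_ (by positivity)
        have : 0 < (1 : ℝ) ^ (-(σ - δ)) * Real.exp (b * ψ 1) := by positivity
        simp only [hh]; linarith
    · push Not at hx
      have hx0 : 0 ≤ 2 * (σ - δ) / b := by linarith
      set τ := (2 * (σ - δ) / b) ^ (1 / (1 - δ)) with hτ
      have hτ1 : 1 ≤ τ := Real.one_le_rpow hx.le (by positivity)
      have hτ0 : 0 < τ := by linarith
      have hτp : τ ^ (1 - δ) = 2 * (σ - δ) / b := by
        rw [hτ, ← Real.rpow_mul hx0, one_div_mul_cancel h1δ.ne', Real.rpow_one]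
      have hτT : τ ≤ T := by
        rw [← hτp] at hTτ
        exact (Real.rpow_le_rpow_iff hτ0.le (by positivity) h1δ).1 hTτ
      obtain ⟨M, hM1, hM2, hM3⟩ := Aconst_ge hb hδ hτ1 hτ hx.le
      refine ⟨M, hM3, ?_⟩
      rw [← intervalIntegral.integral_add_adjacent_intervals (hint le_rfl hτ1) (hint hτ1 hτT)]
      have hI2 := integral_rpow_mul_exp_le (σ := σ) hb hψ hτ1 hτT fun u hu => by
        rw [← hτp]; exact Real.rpow_le_rpow hτ0.le hu.1 h1δ.le
      have hI2nn : 0 ≤ ∫ u in τ..T, u ^ (-σ) * Real.exp (b * ψ u) :=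
        intervalIntegral.integral_nonneg hτT fun u hu => by
          have : 0 < u := by linarith [hu.1]
          positivity
      -- Below τ the exponential is replaced by its value at τ. What remains is the integral of
      -- u^{-σ}, which the constant D in `Aconst` accounts for.
      have hI1 : ∫ u in (1 : ℝ)..τ, u ^ (-σ) * Real.exp (b * ψ u) ≤ M * h τ := by
        have : ∫ u in (1 : ℝ)..τ, u ^ (-σ) * Real.exp (b * ψ u) ≤
            ∫ u in (1 : ℝ)..τ, u ^ (-σ) * Real.exp (b * ψ τ) := by
          refine intervalIntegral.integral_mono_on hτ1 (hint le_rfl hτ1) ?_ fun u hu => ?_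
          · refine ContinuousOn.intervalIntegrable ?_
            rw [Set.uIcc_of_le hτ1]
            exact ContinuousOn.mul (fun u hu => (Real.continuousAt_rpow_const u _
              (Or.inl (by linarith [hu.1] : (0:ℝ) < u).ne')).continuousWithinAt) continuousOn_const
          · have hu0 : 0 < u := by linarith [hu.1]
            have : ψ u ≤ ψ τ := div_le_div_of_nonneg_right
              (Real.rpow_le_rpow hu0.le hu.2 h1δ.le) h1δ.le
            gcongr
        refine this.trans ?_
        rw [intervalIntegral.integral_mul_const]
        have e : ∫ u in (1 : ℝ)..τ, u ^ (-σ) =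
            τ ^ (-(σ - δ)) * (τ ^ (σ - δ) * ∫ u in (1 : ℝ)..τ, u ^ (-σ)) := by
          rw [← mul_assoc, ← Real.rpow_add hτ0]; simp
        rw [e]
        calc _ ≤ τ ^ (-(σ - δ)) * M * Real.exp (b * ψ τ) := by gcongr
          _ = _ := by simp only [hh]; ring
      have hb2 : 0 < 2 / b := by positivity
      have hle : h τ ≤ h T := by
        have := hI2nn.trans hI2
        have := (mul_nonneg_iff_of_pos_left hb2).1 this
        simp only [hh]; linarith
      -- Because 2/b ≤ M, the boundary terms at τ cancel: M h(τ) + M (h(T) - h(τ)) = M h(T).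
      have : 2 / b * (h T - h τ) ≤ M * (h T - h τ) :=
        mul_le_mul_of_nonneg_right hM1 (by linarith)
      simp only [hh] at *
      linarith
  obtain ⟨M, hM1, hM2⟩ := key
  calc weightedSum b σ δ s₀ T ≤ 2 ^ σ * Real.exp (-(b * ψ T)) * (h T + M * h T) := by
        refine hsum.trans (mul_le_mul_of_nonneg_left ?_ (by positivity))
        linarith
    _ = 2 ^ σ * (1 + M) * (T : ℝ) ^ (-(σ - δ)) := by
        simp only [hh]
        rw [Real.exp_neg]
        field_simp
    _ ≤ _ := mul_le_mul_of_nonneg_right hM1 (by positivity)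

/-- The weighted sum bound in the critical case `δ = 1`. -/
theorem weightedSum_le_of_eq_one {b σ : ℝ} (hb : 0 < b) (hσ : 0 ≤ σ)
    {s₀ T : ℕ} (hs : 1 ≤ s₀) (hT : 1 ≤ T)
    (hnn : ∀ k, s₀ ≤ k → 0 ≤ 1 - b / (k : ℝ) ^ (1 : ℝ)) (hbσ : 0 < b - σ + 1) :
    weightedSum b σ 1 s₀ T ≤ Aconst b σ 1 * (T : ℝ) ^ (-(σ - 1)) := by
  have hT1 : (1 : ℝ) ≤ T := by exact_mod_cast hT
  have hT0 : (0 : ℝ) < T := by linarith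
  -- For δ = 1 the function is u^{b-σ}, monotone on the whole interval, so the turning point is one
  -- of the endpoints.
  have hsum : weightedSum b σ 1 s₀ T ≤ _ :=
    weightedSum_le_integral (ψ := Real.log) hb.le hσ zero_le_one
    (fun u hu => hasDerivAt_log_potential hu) hs hT hnn
    (p := if b ≤ σ then T else 1) (by split_ifs; exacts [hT1, le_rfl])
    (fun u hu1 hu => by
      split_ifs at hu with h
      · simpa using h
      · linarith)
    (fun u hu1 hu => by
      split_ifs at hu1 with h
      · linarith
      · push Not at h; simpa using h.le)
  have hexp : ∀ u : ℝ, 0 < u → Real.exp (b * Real.log u) = u ^ b := fun u hu => by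
    rw [Real.rpow_def_of_pos hu, mul_comm]
  have hint : ∫ u in (1 : ℝ)..T, u ^ (-σ) * Real.exp (b * Real.log u) ≤
      (T : ℝ) ^ (b - σ + 1) / (b - σ + 1) := by
    have e : ∫ u in (1 : ℝ)..T, u ^ (-σ) * Real.exp (b * Real.log u) =
        ∫ u in (1 : ℝ)..T, u ^ (b - σ) := by
      refine intervalIntegral.integral_congr fun u hu => ?_
      rw [Set.uIcc_of_le hT1] at hu
      have hu0 : 0 < u := by linarith [hu.1]
      rw [hexp u hu0, ← Real.rpow_add hu0]; ring_nf
    rw [e, integral_rpow (Or.inl (by linarith)), Real.one_rpow]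
    gcongr
    linarith
  have hlast : (T : ℝ) ^ (-σ) * Real.exp (b * Real.log T) ≤ (T : ℝ) ^ (b - σ + 1) := by
    rw [hexp _ hT0, ← Real.rpow_add hT0]
    exact Real.rpow_le_rpow_of_exponent_le hT1 (by linarith)
  refine hsum.trans ?_
  rw [Aconst, if_pos rfl, abs_of_pos (by linarith : 0 < b - σ + 1)]
  calc _ ≤ 2 ^ σ * Real.exp (-(b * Real.log T)) *
        ((T : ℝ) ^ (b - σ + 1) + (T : ℝ) ^ (b - σ + 1) / (b - σ + 1)) :=
        mul_le_mul_of_nonneg_left (by linarith) (by positivity)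
    _ = 2 ^ σ * (1 + 1 / (b - σ + 1)) * ((T : ℝ) ^ (-b) * (T : ℝ) ^ (b - σ + 1)) := by
        rw [Real.exp_neg, hexp _ hT0, Real.rpow_neg hT0.le]
        ring
    _ = _ := by
        rw [← Real.rpow_add hT0]; ring_nf

/-! ### Contraction of the dispersion under time-varying averaging -/

/-- The variance of a function on `Fin n` under the weights `r`. -/
def wVar {n : ℕ} (r x : Fin n → ℝ) : ℝ := ∑ i, r i * x i ^ 2 - (∑ i, r i * x i) ^ 2

section Averaging

variable {n : ℕ}

lemma wVar_sub_const {r : Fin n → ℝ} (hr : ∑ i, r i = 1) (x : Fin n → ℝ) (c : ℝ) :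
    wVar r (fun i => x i - c) = wVar r x := by
  have h1 : ∑ i, r i * (x i - c) = ∑ i, r i * x i - c := by
    simp_rw [mul_sub, Finset.sum_sub_distrib, ← Finset.sum_mul, hr, one_mul]
  have h2 : ∑ i, r i * (x i - c) ^ 2 = ∑ i, r i * x i ^ 2 - 2 * c * ∑ i, r i * x i + c ^ 2 := by
    have : ∀ i, r i * (x i - c) ^ 2 = r i * x i ^ 2 - 2 * c * (r i * x i) + r i * c ^ 2 :=
      fun i => by ring
    simp_rw [this, Finset.sum_add_distrib, Finset.sum_sub_distrib, ← Finset.mul_sum,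
      ← Finset.sum_mul, hr, one_mul]
  rw [wVar, wVar, h1, h2]; ring

/-- After shifting x by x i, the i-th term vanishes, and Cauchy–Schwarz on the other indices, of
total mass 1 - a i, bounds the squared mean by (1 - a i) times the second moment. The diagonal
weight is what survives. -/
lemma wVar_ge_of_row {a : Fin n → ℝ} (ha : ∀ j, 0 ≤ a j) (ha1 : ∑ j, a j = 1)
    (x : Fin n → ℝ) (i : Fin n) :
    a i * ∑ j, a j * (x j - x i) ^ 2 ≤ wVar a x := by
  rw [← wVar_sub_const ha1 x (x i), wVar]
  have h1 : ∑ j, a j * (x j - x i) = ∑ j ∈ Finset.univ.erase i, a j * (x j - x i) := by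
    rw [← Finset.add_sum_erase _ _ (Finset.mem_univ i)]; simp
  have h2 : ∑ j, a j * (x j - x i) ^ 2 = ∑ j ∈ Finset.univ.erase i, a j * (x j - x i) ^ 2 := by
    rw [← Finset.add_sum_erase _ _ (Finset.mem_univ i)]; simp
  have h3 : ∑ j ∈ Finset.univ.erase i, a j = 1 - a i := by
    rw [← ha1, ← Finset.add_sum_erase _ _ (Finset.mem_univ i)]; ring
  have h4 := Finset.sum_sq_le_sum_mul_sum_of_sq_le_mul (Finset.univ.erase i)
    (r := fun j => a j * (x j - x i)) (f := a) (g := fun j => a j * (x j - x i) ^ 2)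
    (fun j _ => ha j) (fun j _ => mul_nonneg (ha j) (sq_nonneg _)) (fun j _ => le_of_eq (by ring))
  rw [h1, h2]
  rw [h3] at h4
  linarith

/-- One averaging step decreases the variance. -/
lemma wVar_step {r : Fin n → ℝ} (hr : ∀ i, 0 ≤ r i) {A : Matrix (Fin n) (Fin n) ℝ}
    (hA : ∀ i j, 0 ≤ A i j) (hA1 : ∀ i, ∑ j, A i j = 1) (hrA : ∀ j, ∑ i, r i * A i j = r j)
    (x : Fin n → ℝ) :
    ∑ i, r i * (A i i * ∑ j, A i j * (x j - x i) ^ 2) ≤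
      wVar r x - wVar r (fun i => ∑ j, A i j * x j) := by
  have hswap : ∀ y : Fin n → ℝ, ∑ i, r i * ∑ j, A i j * y j = ∑ j, r j * y j := fun y => by
    simp_rw [Finset.mul_sum]
    rw [Finset.sum_comm]
    refine Finset.sum_congr rfl fun j _ => ?_
    rw [← hrA j, Finset.sum_mul]
    exact Finset.sum_congr rfl fun i _ => by ring
  -- Law of total variance: stationarity of r makes the decrease equal to the r-average of the
  -- variances under the rows of A.
  have h : wVar r x - wVar r (fun i => ∑ j, A i j * x j) = ∑ i, r i * wVar (A i) x := by
    simp only [wVar, mul_sub, Finset.sum_sub_distrib]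
    rw [hswap x, hswap (fun j => x j ^ 2)]; ring
  rw [h]
  exact Finset.sum_le_sum fun i _ =>
    mul_le_mul_of_nonneg_left (wVar_ge_of_row (hA i) (hA1 i) x i) (hr i)

/-- The variance is at most a quarter of the squared range. -/
lemma wVar_le_range_sq {r : Fin n → ℝ} (hr : ∀ i, 0 ≤ r i) (hr1 : ∑ i, r i = 1)
    (x : Fin n → ℝ) {m M : ℝ} (hm : ∀ i, m ≤ x i) (hM : ∀ i, x i ≤ M) :
    wVar r x ≤ (M - m) ^ 2 / 4 := by
  rw [← wVar_sub_const hr1 x ((m + M) / 2), wVar]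
  have : ∑ i, r i * (x i - (m + M) / 2) ^ 2 ≤ ∑ i, r i * ((M - m) ^ 2 / 4) :=
    Finset.sum_le_sum fun i _ => mul_le_mul_of_nonneg_left
      (by nlinarith [hm i, hM i]) (hr i)
  rw [← Finset.sum_mul, hr1, one_mul] at this
  nlinarith [sq_nonneg (∑ i, r i * (x i - (m + M) / 2))]

/-- If the edges used in the time window `[a, b]` cross the cut `S`, then up to the first crossing
time the values on either side of the cut stay within their initial bounds. -/
lemma exists_first_crossing {A : ℕ → Matrix (Fin n) (Fin n) ℝ} {x : ℕ → Fin n → ℝ} {a b : ℕ}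
    (hA : ∀ k ∈ Finset.Icc a b, ∀ i j, 0 ≤ A k i j)
    (hA1 : ∀ k ∈ Finset.Icc a b, ∀ i, ∑ j, A k i j = 1)
    (hx : ∀ k ∈ Finset.Icc a b, ∀ i, x (k + 1) i = ∑ j, A k i j * x k j)
    (S : Set (Fin n))
    (hS : ∃ k ∈ Finset.Icc a b, ∃ i j, 0 < A k i j ∧ i ∉ S ∧ j ∈ S) :
    ∃ k ∈ Finset.Icc a b, ∃ i j, 0 < A k i j ∧ (i ∈ S ∧ j ∉ S ∨ i ∉ S ∧ j ∈ S) ∧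
      (∀ w, (∀ l ∈ S, w ≤ x a l) → ∀ l ∈ S, w ≤ x k l) ∧
      (∀ w, (∀ l ∉ S, x a l ≤ w) → ∀ l ∉ S, x k l ≤ w) := by
  classical
  have hex : ∃ k, k ∈ Finset.Icc a b ∧ ∃ i j, 0 < A k i j ∧ (i ∈ S ∧ j ∉ S ∨ i ∉ S ∧ j ∈ S) := by
    obtain ⟨k, hk, i, j, h1, h2, h3⟩ := hS
    exact ⟨k, hk, i, j, h1, Or.inr ⟨h2, h3⟩⟩
  obtain ⟨hk, i, j, hij, hS'⟩ := Nat.find_spec hex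
  have hmin := fun m => Nat.find_min hex (m := m)
  set K := Nat.find hex
  refine ⟨K, hk, i, j, hij, hS', ?_⟩
  -- `K` is the first time an edge crosses the cut in either direction. Before it, rows in S average
  -- only over S and rows outside S only outside, so bounds on each side persist.
  have hzero : ∀ k, a ≤ k → k < K → ∀ i j, (i ∈ S ∧ j ∉ S ∨ i ∉ S ∧ j ∈ S) → A k i j = 0 := by
    intro k hak hkK i j h
    have hkm : k ∈ Finset.Icc a b := by
      rw [Finset.mem_Icc] at hk ⊢; omega
    by_contra hne
    exact hmin k hkK ⟨hkm, i, j, (hA k hkm i j).lt_of_ne' hne, h⟩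
  rw [Finset.mem_Icc] at hk
  have key : ∀ k, a ≤ k → k ≤ K → (∀ w, (∀ l ∈ S, w ≤ x a l) → ∀ l ∈ S, w ≤ x k l) ∧
      (∀ w, (∀ l ∉ S, x a l ≤ w) → ∀ l ∉ S, x k l ≤ w) := by
    intro k hak
    induction k, hak using Nat.le_induction with
    | base => exact fun _ => ⟨fun w h => h, fun w h => h⟩
    | succ k hak ih =>
      intro hkK
      have ih := ih (by omega)
      have hkm : k ∈ Finset.Icc a b := by rw [Finset.mem_Icc]; omega
      refine ⟨fun w hw l hl => ?_, fun w hw l hl => ?_⟩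
      · rw [hx k hkm, ← one_mul w, ← hA1 k hkm l, Finset.sum_mul]
        refine Finset.sum_le_sum fun j _ => ?_
        by_cases hj : j ∈ S
        · exact mul_le_mul_of_nonneg_left (ih.1 w hw j hj) (hA k hkm l j)
        · rw [hzero k hak (by omega) l j (Or.inl ⟨hl, hj⟩)]; simp
      · rw [hx k hkm, ← one_mul w, ← hA1 k hkm l, Finset.sum_mul]
        refine Finset.sum_le_sum fun j _ => ?_
        by_cases hj : j ∈ S
        · rw [hzero k hak (by omega) l j (Or.inr ⟨hl, hj⟩)]; simp
        · exact mul_le_mul_of_nonneg_left (ih.2 w hw j hj) (hA k hkm l j)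
  exact key K hk.1 le_rfl

/-- A few of the edges used in a connected time window span the range of the initial values. -/
lemma exists_spanning_edges {A : ℕ → Matrix (Fin n) (Fin n) ℝ} {x : ℕ → Fin n → ℝ} {a b : ℕ}
    (hA : ∀ k ∈ Finset.Icc a b, ∀ i j, 0 ≤ A k i j)
    (hA1 : ∀ k ∈ Finset.Icc a b, ∀ i, ∑ j, A k i j = 1)
    (hx : ∀ k ∈ Finset.Icc a b, ∀ i, x (k + 1) i = ∑ j, A k i j * x k j)
    (hconn : ∀ S : Set (Fin n), S.Nonempty → Sᶜ.Nonempty →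
      ∃ k ∈ Finset.Icc a b, ∃ i j, 0 < A k i j ∧ i ∉ S ∧ j ∈ S)
    (p q : Fin n) (hp : ∀ i, x a i ≤ x a p) :
    ∃ τ : Finset (ℕ × Fin n × Fin n), τ.card + 1 ≤ n ∧
      (∀ e ∈ τ, e.1 ∈ Finset.Icc a b ∧ 0 < A e.1 e.2.1 e.2.2 ∧ e.2.1 ≠ e.2.2) ∧
      x a p - x a q ≤ ∑ e ∈ τ, |x e.1 e.2.2 - x e.1 e.2.1| := by
  classical
  -- One cut {l | v < x a l} for each initial value v other than the maximum, hence at most n - 1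
  -- cuts.
  set V := (Finset.univ.image (x a)).erase (x a p) with hV
  -- The first edge crossing the cut at v joins a value still at most v to a value still at least
  -- the next larger initial value, so it spans the whole gap.
  have hcross : ∀ v ∈ V, ∃ e : ℕ × Fin n × Fin n, (e.1 ∈ Finset.Icc a b ∧
      0 < A e.1 e.2.1 e.2.2 ∧ e.2.1 ≠ e.2.2) ∧
      ∀ θ, v ≤ θ → (∀ l, v < x a l → θ ≤ x a l) →
        θ ∈ Set.uIcc (x e.1 e.2.1) (x e.1 e.2.2) := by
    intro v hv
    rw [hV, Finset.mem_erase, Finset.mem_image] at hv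
    obtain ⟨hvp, c, -, hc⟩ := hv
    have hvlt : v < x a p := lt_of_le_of_ne (hc ▸ hp c) hvp
    obtain ⟨k, hk, i, j, hij, hS, h1, h2⟩ := exists_first_crossing hA hA1 hx {l | v < x a l}
      (hconn _ ⟨p, hvlt⟩ ⟨c, by simp [hc]⟩)
    refine ⟨(k, i, j), ⟨hk, hij, ?_⟩, fun θ hvθ hθ => ?_⟩
    · intro hij'
      obtain rfl : i = j := hij'
      rcases hS with hS | hS
      · exact hS.2 hS.1
      · exact hS.1 hS.2
    · have hup : ∀ l, v < x a l → θ ≤ x k l := h1 θ hθ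
      have hdn : ∀ l, ¬ v < x a l → x k l ≤ θ := fun l hl =>
        (h2 v (fun l hl => not_lt.1 hl) l hl).trans hvθ
      rw [Set.mem_uIcc]
      rcases hS with hS | hS
      · exact Or.inr ⟨hdn j hS.2, hup i hS.1⟩
      · exact Or.inl ⟨hdn i hS.1, hup j hS.2⟩
  have : Nonempty (Fin n) := ⟨p⟩
  choose! φ hφ1 hφ2 using hcross
  refine ⟨V.image φ, ?_, ?_, ?_⟩
  · have h1 : V.card + 1 = (Finset.univ.image (x a)).card :=
      Finset.card_erase_add_one (Finset.mem_image_of_mem _ (Finset.mem_univ p))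
    have h2 : (Finset.univ.image (x a)).card ≤ n := by
      simpa using Finset.card_image_le (s := Finset.univ) (f := x a)
    have h3 : (V.image φ).card ≤ V.card := Finset.card_image_le
    omega
  · intro e he
    obtain ⟨v, hv, rfl⟩ := Finset.mem_image.1 he
    exact hφ1 v hv
  -- The intervals spanned by the edges cover the range of the initial values: θ lies in the gap
  -- above the largest initial value not exceeding θ. Subadditivity of length then gives the bound
  -- without sorting the values.
  · have hcov : Set.Ico (x a q) (x a p) ⊆
        ⋃ e ∈ V.image φ, Set.uIcc (x e.1 e.2.1) (x e.1 e.2.2) := by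
      intro θ hθ
      have hne : ((Finset.univ.image (x a)).filter (· ≤ θ)).Nonempty :=
        ⟨x a q, Finset.mem_filter.2 ⟨Finset.mem_image_of_mem _ (Finset.mem_univ q), hθ.1⟩⟩
      obtain ⟨v, hv, hvmax⟩ := Finset.exists_max_image _ id hne
      rw [Finset.mem_filter] at hv
      have hvV : v ∈ V := Finset.mem_erase.2 ⟨(hv.2.trans_lt hθ.2).ne, hv.1⟩
      refine Set.mem_biUnion (Finset.mem_image_of_mem φ hvV) (hφ2 v hvV θ hv.2 fun l hl => ?_)
      by_contra hlt
      push Not at hlt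
      exact absurd (hvmax (x a l) (Finset.mem_filter.2
        ⟨Finset.mem_image_of_mem _ (Finset.mem_univ l), hlt.le⟩)) (not_le.2 hl)
    have hvol := (measure_mono (μ := volume) hcov).trans (measure_biUnion_finset_le _ _)
    simp_rw [Real.volume_Ico, Real.volume_interval] at hvol
    rw [← ENNReal.ofReal_sum_of_nonneg (fun _ _ => abs_nonneg _),
      ENNReal.ofReal_le_ofReal_iff (Finset.sum_nonneg fun _ _ => abs_nonneg _)] at hvol
    exact hvol

/-- Over a connected time window the variance contracts. -/
theorem wVar_window {r : Fin n → ℝ} (hr : ∀ i, 0 ≤ r i) (hr1 : ∑ i, r i = 1)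
    {A : ℕ → Matrix (Fin n) (Fin n) ℝ} {x : ℕ → Fin n → ℝ} {a b : ℕ} (hab : a ≤ b)
    (hA : ∀ k ∈ Finset.Icc a b, ∀ i j, 0 ≤ A k i j)
    (hA1 : ∀ k ∈ Finset.Icc a b, ∀ i, ∑ j, A k i j = 1)
    (hrA : ∀ k ∈ Finset.Icc a b, ∀ j, ∑ i, r i * A k i j = r j)
    (hx : ∀ k ∈ Finset.Icc a b, ∀ i, x (k + 1) i = ∑ j, A k i j * x k j)
    (hconn : ∀ S : Set (Fin n), S.Nonempty → Sᶜ.Nonempty →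
      ∃ k ∈ Finset.Icc a b, ∃ i j, 0 < A k i j ∧ i ∉ S ∧ j ∈ S)
    {c : ℝ} (hc0 : 0 ≤ c)
    (hc : ∀ k ∈ Finset.Icc a b, ∀ i j, i ≠ j → 0 < A k i j → c ≤ r i * (A k i i * A k i j)) :
    4 * c * wVar r (x a) ≤ ((n : ℝ) - 1) * (wVar r (x a) - wVar r (x (b + 1))) := by
  have hn : Nonempty (Fin n) := by
    by_contra h
    rw [not_nonempty_iff] at h
    simp at hr1
  have hn1 : 1 ≤ n := Fin.pos_iff_nonempty.2 hn
  obtain ⟨p, hp⟩ := Finite.exists_max (x a)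
  obtain ⟨q, hq⟩ := Finite.exists_min (x a)
  obtain ⟨τ, hτ, hτ1, hτ2⟩ := exists_spanning_edges hA hA1 hx hconn p q hp
  -- Cauchy–Schwarz over at most n - 1 edges.
  have hrange : (x a p - x a q) ^ 2 ≤
      ((n : ℝ) - 1) * ∑ e ∈ τ, (x e.1 e.2.2 - x e.1 e.2.1) ^ 2 := by
    have h0 : 0 ≤ x a p - x a q := by linarith [hp q]
    have h1 := pow_le_pow_left₀ h0 hτ2 2
    have h2 := sq_sum_le_card_mul_sum_sq (s := τ) (f := fun e => |x e.1 e.2.2 - x e.1 e.2.1|)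
    simp only [sq_abs] at h2
    refine h1.trans (h2.trans (mul_le_mul_of_nonneg_right ?_
      (Finset.sum_nonneg fun _ _ => sq_nonneg _)))
    have : ((τ.card + 1 : ℕ) : ℝ) ≤ n := by exact_mod_cast hτ
    push_cast at this; linarith
  have htel : ∑ k ∈ Finset.Icc a b, (wVar r (x k) - wVar r (x (k + 1))) =
      wVar r (x a) - wVar r (x (b + 1)) := by
    have h := Finset.sum_Ico_sub (fun k => wVar r (x k)) (by omega : a ≤ b + 1)
    have h2 : Finset.Icc a b = Finset.Ico a (b + 1) := by ext; simp
    rw [h2, ← neg_inj, ← Finset.sum_neg_distrib]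
    simp only [neg_sub]
    rw [h]
  have hdec : c * ∑ e ∈ τ, (x e.1 e.2.2 - x e.1 e.2.1) ^ 2 ≤
      wVar r (x a) - wVar r (x (b + 1)) := by
    rw [← htel]
    have hterm : ∀ k ∈ Finset.Icc a b, ∑ i, ∑ j, r i * (A k i i * (A k i j *
        (x k j - x k i) ^ 2)) ≤ wVar r (x k) - wVar r (x (k + 1)) := by
      intro k hk
      have h := wVar_step hr (hA k hk) (hA1 k hk) (hrA k hk) (x k)
      have e : (fun i => ∑ j, A k i j * x k j) = x (k + 1) := funext fun i => (hx k hk i).symm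
      rw [e] at h
      simpa only [Finset.mul_sum] using h
    refine le_trans ?_ (Finset.sum_le_sum hterm)
    simp_rw [← Finset.sum_product']
    rw [Finset.mul_sum]
    -- The edges in τ are distinct triples (k, i, j), so each accounts for its own nonnegative term
    -- in the total decrease.
    have hsub : τ ⊆ Finset.Icc a b ×ˢ (Finset.univ : Finset (Fin n × Fin n)) := fun e he =>
      Finset.mem_product.2 ⟨(hτ1 e he).1, Finset.mem_univ _⟩
    refine le_trans (Finset.sum_le_sum fun e he => ?_)
      (Finset.sum_le_sum_of_subset_of_nonneg hsub fun e he _ => ?_)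
    · obtain ⟨h1, h2, h3⟩ := hτ1 e he
      have := hc e.1 h1 e.2.1 e.2.2 h3 h2
      have h4 := mul_le_mul_of_nonneg_right this (sq_nonneg (x e.1 e.2.2 - x e.1 e.2.1))
      refine h4.trans (le_of_eq ?_)
      ring
    · have hk := (Finset.mem_product.1 he).1
      exact mul_nonneg (hr _) (mul_nonneg (hA _ hk _ _) (mul_nonneg (hA _ hk _ _) (sq_nonneg _)))
  have hvar := wVar_le_range_sq hr hr1 (x a) hq hp
  have hn1' : (0 : ℝ) ≤ (n : ℝ) - 1 := by
    have : (1 : ℝ) ≤ n := by exact_mod_cast hn1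
    linarith
  calc 4 * c * wVar r (x a) ≤ c * (x a p - x a q) ^ 2 := by nlinarith
    _ ≤ c * (((n : ℝ) - 1) * ∑ e ∈ τ, (x e.1 e.2.2 - x e.1 e.2.1) ^ 2) :=
        mul_le_mul_of_nonneg_left hrange hc0
    _ = ((n : ℝ) - 1) * (c * ∑ e ∈ τ, (x e.1 e.2.2 - x e.1 e.2.1) ^ 2) := by ring
    _ ≤ _ := mul_le_mul_of_nonneg_left hdec hn1'

end Averaging

/-- From blockwise contraction to a product over single steps. -/
lemma le_prod_of_block_contraction {w θ : ℕ → ℝ} {B : ℕ} (hB : 1 ≤ B) {a : ℕ}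
    (hw : ∀ t, a ≤ t → 0 ≤ w t)
    (hmono : ∀ t, a ≤ t → w (t + 1 + 1) ≤ w (t + 1))
    (hθ : ∀ t, a ≤ t → θ (t + 1) ≤ θ t) (hθ0 : ∀ t, a ≤ t → 0 ≤ θ t)
    (hθ1 : ∀ t, a ≤ t → B * θ t < 1)
    (hblock : ∀ t, a ≤ t → w (t + B + 1) ≤ (1 - B * θ (t + B)) * w (t + 1)) :
    ∀ (m t : ℕ), a ≤ t →
      w (t + 1 + m) ≤ (1 - B * θ t)⁻¹ *
        (∏ k ∈ Finset.Ico (t + 1) (t + 1 + m), (1 - θ k)) * w (t + 1) := by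
  have hθanti : ∀ t, a ≤ t → ∀ k, t ≤ k → θ k ≤ θ t := fun t ht k hk => by
    induction k, hk using Nat.le_induction with
    | base => exact le_rfl
    | succ k hk ih => exact (hθ k (ht.trans hk)).trans ih
  have hB1 : (1 : ℝ) ≤ B := by exact_mod_cast hB
  have hθle : ∀ t, a ≤ t → 0 ≤ 1 - θ t := fun t ht => by
    nlinarith [hθ0 t ht, hθ1 t ht]
  -- Bernoulli: over at most B steps the product cannot fall below 1 - Bθ(t), so the prefactor makes
  -- the bound trivial within the first block.
  have hprod : ∀ t, a ≤ t → ∀ m, m ≤ B →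
      1 - B * θ t ≤ ∏ k ∈ Finset.Ico (t + 1) (t + 1 + m), (1 - θ k) := by
    intro t ht m hm
    have hm' : (m : ℝ) ≤ B := by exact_mod_cast hm
    have h1 : 1 - (m : ℝ) * θ t ≤ ∏ k ∈ Finset.Ico (t + 1) (t + 1 + m), (1 - θ k) := by
      clear hm hm'
      induction m with
      | zero => simp
      | succ m ih =>
        rw [← add_assoc, Finset.prod_Ico_succ_top (by omega)]
        have h2 := hθanti t ht (t + 1 + m) (by omega)
        have h3 := hθle (t + 1 + m) (by omega)
        have h4 := hθ0 (t + 1 + m) (by omega)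
        have h5 : (0 : ℝ) ≤ m * θ t := mul_nonneg (Nat.cast_nonneg m) (hθ0 t ht)
        have h6 := mul_le_mul_of_nonneg_right ih h3
        push_cast
        nlinarith
    nlinarith [hθ0 t ht]
  have hmono' : ∀ t, a ≤ t → ∀ m, w (t + 1 + m) ≤ w (t + 1) := fun t ht m => by
    induction m with
    | zero => exact le_rfl
    | succ m ih =>
      have := hmono (t + m) (by omega)
      rw [show t + m + 1 = t + 1 + m by ring] at this
      exact this.trans ih
  intro m
  induction m using Nat.strong_induction_on with
  | _ m ih =>
    intro t ht
    have hpos : 0 < 1 - B * θ t := by linarith [hθ1 t ht]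
    rcases le_or_gt m B with hm | hm
    · refine (hmono' t ht m).trans ?_
      refine le_mul_of_one_le_left (hw _ (by omega)) ?_
      rw [inv_mul_eq_div, le_div_iff₀ hpos, one_mul]
      exact hprod t ht m hm
    · obtain ⟨m', rfl⟩ := Nat.exists_eq_add_of_lt hm
      have h1 := ih (m' + 1) (by omega) (t + B) (by omega)
      have hpos' : 0 < 1 - B * θ (t + B) := by linarith [hθ1 (t + B) (by omega)]
      have hP : 0 ≤ ∏ k ∈ Finset.Ico (t + B + 1) (t + B + 1 + (m' + 1)), (1 - θ k) :=
        Finset.prod_nonneg fun k hk => hθle k (by rw [Finset.mem_Ico] at hk; omega)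
      -- The contraction 1 - Bθ(t+B) of the first block cancels the prefactor of the induction
      -- hypothesis at t + B, so the prefactor is paid once and not once per block.
      have h2 : w (t + B + 1 + (m' + 1)) ≤
          (∏ k ∈ Finset.Ico (t + B + 1) (t + B + 1 + (m' + 1)), (1 - θ k)) * w (t + 1) := by
        refine h1.trans ((mul_le_mul_of_nonneg_left (hblock t ht)
          (mul_nonneg (inv_nonneg.2 hpos'.le) hP)).trans (le_of_eq ?_))
        field_simp
      have h3 : ∏ k ∈ Finset.Ico (t + 1) (t + 1 + (B + m' + 1)), (1 - θ k) =
          (∏ k ∈ Finset.Ico (t + 1) (t + 1 + B), (1 - θ k)) *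
          ∏ k ∈ Finset.Ico (t + B + 1) (t + B + 1 + (m' + 1)), (1 - θ k) := by
        rw [show t + B + 1 = t + 1 + B by ring,
          show t + 1 + (B + m' + 1) = t + 1 + B + (m' + 1) by ring,
          Finset.prod_Ico_consecutive _ (by omega) (by omega)]
      rw [show t + 1 + (B + m' + 1) = t + B + 1 + (m' + 1) by ring] at h3 ⊢
      refine h2.trans (mul_le_mul_of_nonneg_right ?_ (hw _ (by omega)))
      rw [h3, ← mul_assoc]
      refine le_mul_of_one_le_left hP ?_
      rw [inv_mul_eq_div, le_div_iff₀ hpos, one_mul]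
      exact hprod t ht B le_rfl

/-! ### The averaged dynamics and its contraction -/

lemma exists_step_of_reflTransGen {α : Type*} {R : α → α → Prop} {a b : α} {S : Set α}
    (h : Relation.ReflTransGen R a b) (ha : a ∈ S) (hb : b ∉ S) :
    ∃ j i, R j i ∧ i ∉ S ∧ j ∈ S := by
  induction h with
  | refl => exact absurd ha hb
  | @tail c d _ hcd ih =>
    by_cases hc : c ∈ S
    · exact ⟨c, d, hcd, hb, hc⟩
    · exact ih hc

lemma div_rpow_pos {β₀ μ : ℝ} (hβ : 0 < β₀) {t : ℕ} (ht : 1 ≤ t) :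
    0 < β₀ / (t : ℝ) ^ μ := by
  have : (0 : ℝ) < t := by exact_mod_cast ht
  positivity

lemma div_rpow_anti {β₀ μ : ℝ} (hβ : 0 ≤ β₀) (hμ : 0 ≤ μ) {s t : ℕ} (hs : 1 ≤ s) (hst : s ≤ t) :
    β₀ / (t : ℝ) ^ μ ≤ β₀ / (s : ℝ) ^ μ := by
  have h1 : (0 : ℝ) < s := by exact_mod_cast hs
  have h2 : (s : ℝ) ≤ t := by exact_mod_cast hst
  gcongr

namespace Params.Valid

variable {n : ℕ} {p : Params n}

lemma beta_pos (hp : p.Valid) {t : ℕ} (ht : 1 ≤ t) : 0 < p.beta t :=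
  div_rpow_pos hp.β₀_pos ht

lemma alpha_pos (hp : p.Valid) {t : ℕ} (ht : 1 ≤ t) : 0 < p.alpha t :=
  div_rpow_pos hp.α₀_pos ht

lemma beta_anti (hp : p.Valid) {s t : ℕ} (hs : 1 ≤ s) (hst : s ≤ t) : p.beta t ≤ p.beta s :=
  div_rpow_anti hp.β₀_pos.le hp.μ_pos.le hs hst

lemma beta_le (hp : p.Valid) {t : ℕ} (ht : 1 ≤ t) : p.beta t ≤ p.β₀ := by
  simpa [Params.beta] using hp.beta_anti le_rfl ht

lemma beta_le_one (hp : p.Valid) {t : ℕ} (ht : 1 ≤ t) : p.beta t ≤ 1 :=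
  (hp.beta_le ht).trans hp.β₀_le

/-- β(1) = β₀ may equal 1 and leave no diagonal weight. The connectivity windows start at time 2 or
later, so β(2) < 1 is enough to keep the diagonal of the mixing matrices bounded below. -/
lemma beta_two_lt (hp : p.Valid) : p.beta 2 < 1 := by
  have h : (1 : ℝ) < 2 ^ p.μ := Real.one_lt_rpow (by norm_num) hp.μ_pos
  have := hp.β₀_le
  simp only [Params.beta, Nat.cast_ofNat]
  rw [div_lt_one (by positivity)]
  linarith

lemma nonempty (hp : p.Valid) : Nonempty (Fin n) := by
  by_contra h
  rw [not_nonempty_iff] at h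
  simpa using hp.r_sum

lemma iInf_r_pos (hp : p.Valid) : 0 < ⨅ i, p.r i := by
  have := hp.nonempty
  obtain ⟨i, hi⟩ := Finite.exists_min p.r
  exact (hp.r_pos i).trans_le (le_ciInf hi)

lemma iInf_r_le (i : Fin n) : ⨅ i, p.r i ≤ p.r i :=
  ciInf_le (Set.finite_range _).bddBelow i

lemma r_le_one (hp : p.Valid) (i : Fin n) : p.r i ≤ 1 := by
  rw [← hp.r_sum]
  exact Finset.single_le_sum (fun j _ => (hp.r_pos j).le) (Finset.mem_univ i)

lemma lam_eq (p : Params n) : p.lam =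
    p.η * (⨅ i, p.r i) / (2 * p.B * (n : ℝ) ^ 2) * min 1 (32 * (1 - p.beta 2)) := by
  rw [Params.lam, Params.beta, Real.rpow_neg (by norm_num), Nat.cast_ofNat,
    div_eq_mul_inv p.β₀]

lemma n_pos (hp : p.Valid) : (0 : ℝ) < n := by
  have := hp.nonempty
  exact_mod_cast Fin.pos_iff_nonempty.2 this

lemma B_pos' (hp : p.Valid) : (0 : ℝ) < p.B := by exact_mod_cast hp.B_pos

lemma lam_pos (hp : p.Valid) : 0 < p.lam := by
  rw [lam_eq]
  have h1 := hp.η_pos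
  have h2 := hp.iInf_r_pos
  have h3 := hp.B_pos'
  have h4 := hp.n_pos
  have h5 : 0 < min 1 (32 * (1 - p.beta 2)) :=
    lt_min one_pos (by linarith [hp.beta_two_lt])
  positivity

lemma B_mul_lam (hp : p.Valid) : p.B * p.lam =
    p.η * (⨅ i, p.r i) / (2 * (n : ℝ) ^ 2) * min 1 (32 * (1 - p.beta 2)) := by
  rw [lam_eq]
  have h3 := hp.B_pos'
  have h4 := hp.n_pos
  field_simp

end Params.Valid

/-- The mixing matrix `(1 - β(t)) I + β(t) W(t)`. -/
def mixMat {n : ℕ} (p : Params n) (W : ℕ → Matrix (Fin n) (Fin n) ℝ) (t : ℕ) :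
    Matrix (Fin n) (Fin n) ℝ :=
  (1 - p.beta t) • (1 : Matrix (Fin n) (Fin n) ℝ) + p.beta t • W t

/-- The transition matrix over the times `s, …, s + m - 1`. -/
def transMat {n : ℕ} (p : Params n) (W : ℕ → Matrix (Fin n) (Fin n) ℝ) (s : ℕ) :
    ℕ → Matrix (Fin n) (Fin n) ℝ
  | 0 => 1
  | m + 1 => mixMat p W (s + m) * transMat p W s m

/-- The action of a matrix on a configuration. -/
def act {n d : ℕ} (M : Matrix (Fin n) (Fin n) ℝ) (U : Config n d) : Config n d :=
  fun i => ∑ j, M i j • U j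

/-- The dispersion of a configuration about its weighted mean. -/
def disp {n d : ℕ} (r : Fin n → ℝ) (U : Config n d) : ℝ := rNormSq r (fun i => U i - rMean r U)

/-! ### Linear algebra of the weighted mean and the dispersion. -/

section Algebra

variable {n d : ℕ} {p : Params n} {W : ℕ → Matrix (Fin n) (Fin n) ℝ} {r : Fin n → ℝ}

lemma act_one (U : Config n d) : act 1 U = U := by
  funext i
  simp [act, Matrix.one_apply]

lemma act_mul (M N : Matrix (Fin n) (Fin n) ℝ) (U : Config n d) :
    act (M * N) U = act M (act N U) := by
  funext i
  simp only [act, Matrix.mul_apply, Finset.sum_smul, Finset.smul_sum, smul_smul]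
  rw [Finset.sum_comm]

lemma act_add (M : Matrix (Fin n) (Fin n) ℝ) (U V : Config n d) :
    act M (U + V) = act M U + act M V := by
  funext i
  simp [act, Finset.sum_add_distrib]

lemma act_smul (M : Matrix (Fin n) (Fin n) ℝ) (c : ℝ) (U : Config n d) :
    act M (c • U) = c • act M U := by
  funext i
  simp only [act, Pi.smul_apply, Finset.smul_sum]
  exact Finset.sum_congr rfl fun j _ => smul_comm _ _ _

lemma act_zero (M : Matrix (Fin n) (Fin n) ℝ) : act M (0 : Config n d) = 0 := by
  funext i
  simp [act]

lemma act_mixMat (t : ℕ) (U : Config n d) (i : Fin n) :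
    act (mixMat p W t) U i = (1 - p.beta t) • U i + p.beta t • ∑ j, W t i j • U j := by
  simp only [act, mixMat, Matrix.add_apply, Matrix.smul_apply, Matrix.one_apply, smul_eq_mul,
    add_smul, Finset.sum_add_distrib, Finset.smul_sum, smul_smul]
  simp

/-- Peels off the earliest step, as needed when input injected at successive times is propagated to
a fixed final time. -/
lemma transMat_succ_left (s m : ℕ) :
    transMat p W s (m + 1) = transMat p W (s + 1) m * mixMat p W s := by
  induction m with
  | zero => simp [transMat]
  | succ m ih =>
    rw [transMat, ih, transMat, Matrix.mul_assoc, show s + 1 + m = s + (m + 1) by ring]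

/-- Matrices act on each coordinate separately, so this transfers the scalar variance estimates to
configurations. -/
lemma disp_eq_sum_wVar (hr : ∑ i, r i = 1) (U : Config n d) :
    disp r U = ∑ c, wVar r (fun i => U i c) := by
  have h : ∀ c, rMean r U c = ∑ i, r i * U i c := fun c => by
    simp [rMean]
  have h2 : disp r U = ∑ c, ∑ i, r i * (U i c - rMean r U c) ^ 2 := by
    rw [disp, rNormSq, Finset.sum_comm]
    refine Finset.sum_congr rfl fun i _ => ?_
    rw [EuclideanSpace.norm_sq_eq, Finset.mul_sum]
    simp
  rw [h2]
  refine Finset.sum_congr rfl fun c => fun _ => ?_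
  rw [← wVar_sub_const hr _ (rMean r U c), wVar]
  have : ∑ i, r i * (U i c - rMean r U c) = 0 := by
    simp_rw [mul_sub, Finset.sum_sub_distrib, ← Finset.sum_mul, hr, h]; ring
  rw [this]; ring

lemma disp_nonneg (hr : ∀ i, 0 ≤ r i) (U : Config n d) : 0 ≤ disp r U := by
  rw [disp, rNormSq]
  exact Finset.sum_nonneg fun i _ => mul_nonneg (hr i) (sq_nonneg _)

/-- The parallel axis theorem. -/
lemma rNormSq_sub_const (hr : ∑ i, r i = 1) (U : Config n d) (x : EuclideanSpace ℝ (Fin d)) :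
    rNormSq r (fun i => U i - x) = disp r U + ‖rMean r U - x‖ ^ 2 := by
  have h1 : ∀ i, r i * ‖U i - x‖ ^ 2 = r i * ‖U i - rMean r U‖ ^ 2 +
      2 * inner ℝ (r i • U i - r i • rMean r U) (rMean r U - x) +
      r i * ‖rMean r U - x‖ ^ 2 := fun i => by
    rw [← sub_add_sub_cancel (U i) (rMean r U) x, norm_add_sq_real, ← smul_sub,
      real_inner_smul_left]
    ring
  have h2 : ∑ i, inner ℝ (r i • U i - r i • rMean r U) (rMean r U - x) = 0 := by
    rw [← sum_inner, Finset.sum_sub_distrib, ← Finset.sum_smul, hr, one_smul]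
    simp [rMean]
  rw [disp, rNormSq, rNormSq]
  simp_rw [h1, Finset.sum_add_distrib, ← Finset.mul_sum, h2, ← Finset.sum_mul, hr]
  ring

lemma disp_le_rNormSq (hr : ∑ i, r i = 1) (U : Config n d) : disp r U ≤ rNormSq r U := by
  have := rNormSq_sub_const hr U 0
  simp only [sub_zero] at this
  nlinarith [sq_nonneg ‖rMean r U‖]

/-- Jensen's inequality for the squared norm. -/
lemma norm_rMean_sq_le (hr0 : ∀ i, 0 ≤ r i) (hr : ∑ i, r i = 1) (U : Config n d) :
    ‖rMean r U‖ ^ 2 ≤ rNormSq r U := by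
  have := rNormSq_sub_const hr U 0
  simp only [sub_zero] at this
  have := disp_nonneg hr0 U
  linarith

end Algebra

/-! ### The mixing matrices and their contraction rate. -/

section Contraction

variable {n d : ℕ} {p : Params n} {W : ℕ → Matrix (Fin n) (Fin n) ℝ}

lemma mixMat_apply_of_ne (t : ℕ) {i j : Fin n} (h : i ≠ j) :
    mixMat p W t i j = p.beta t * W t i j := by
  simp [mixMat, h]

lemma mixMat_apply_self (t : ℕ) (i : Fin n) :
    mixMat p W t i i = 1 - p.beta t + p.beta t * W t i i := by
  simp [mixMat]

lemma mixMat_nonneg (hp : p.Valid) (hW : ConnectivityAssumption p W) {t : ℕ} (ht : 1 ≤ t)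
    (i j : Fin n) : 0 ≤ mixMat p W t i j := by
  have h := mul_nonneg (hp.beta_pos ht).le (hW.nonneg t ht i j)
  by_cases hij : i = j
  · subst hij
    rw [mixMat_apply_self]
    linarith [hp.beta_le_one ht]
  · rwa [mixMat_apply_of_ne t hij]

lemma mixMat_row_sum (hW : ConnectivityAssumption p W) {t : ℕ} (ht : 1 ≤ t) (i : Fin n) :
    ∑ j, mixMat p W t i j = 1 := by
  simp [mixMat, Finset.sum_add_distrib, ← Finset.mul_sum, hW.row_sum t ht i, Matrix.one_apply]

lemma mixMat_stationary (hW : ConnectivityAssumption p W) {t : ℕ} (ht : 1 ≤ t) (j : Fin n) :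
    ∑ i, p.r i * mixMat p W t i j = p.r j := by
  have h : ∀ i, p.r i * mixMat p W t i j = (1 - p.beta t) * (if i = j then p.r i else 0) +
      p.beta t * (p.r i * W t i j) := fun i => by
    simp only [mixMat, Matrix.add_apply, Matrix.smul_apply, Matrix.one_apply, smul_eq_mul]
    split_ifs <;> ring
  simp_rw [h, Finset.sum_add_distrib, ← Finset.mul_sum, hW.stationary t ht j]
  simp only [Finset.sum_ite_eq', Finset.mem_univ, if_true]
  ring

lemma rMean_act_mixMat (hW : ConnectivityAssumption p W) {t : ℕ} (ht : 1 ≤ t) (U : Config n d) :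
    rMean p.r (act (mixMat p W t) U) = rMean p.r U := by
  simp only [rMean, act, Finset.smul_sum, smul_smul]
  rw [Finset.sum_comm]
  refine Finset.sum_congr rfl fun j _ => ?_
  rw [← Finset.sum_smul, mixMat_stationary hW ht]

lemma eta_le_one (hp : p.Valid) (hW : ConnectivityAssumption p W) : p.η ≤ 1 := by
  obtain ⟨i⟩ := hp.nonempty
  obtain ⟨j, -, hj⟩ : ∃ j ∈ Finset.univ, 0 < W 1 i j := by
    refine Finset.exists_lt_of_sum_lt (f := fun _ => (0 : ℝ)) ?_
    rw [hW.row_sum 1 le_rfl i]; simp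
  refine (hW.lower 1 le_rfl i j hj).trans ?_
  rw [← hW.row_sum 1 le_rfl i]
  exact Finset.single_le_sum (fun j _ => hW.nonneg 1 le_rfl i j) (Finset.mem_univ j)

/-- Since η ≤ 1 and r_min ≤ 1, the product is at most 1/2. This makes κ positive and keeps all
factors 1 - λβ(k) positive. -/
lemma B_mul_lam_lt_one (hn : 2 ≤ n) (hp : p.Valid) (hW : ConnectivityAssumption p W) :
    p.B * p.lam < 1 := by
  rw [hp.B_mul_lam]
  obtain ⟨i⟩ := hp.nonempty
  have hn' : (2 : ℝ) ≤ n := by exact_mod_cast hn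
  have h1 : p.η * (⨅ i, p.r i) ≤ 1 :=
    mul_le_one₀ (eta_le_one hp hW) hp.iInf_r_pos.le
      ((Params.Valid.iInf_r_le i).trans (hp.r_le_one i))
  have h2 : p.η * (⨅ i, p.r i) / (2 * (n : ℝ) ^ 2) ≤ 1 / 2 := by
    rw [div_le_iff₀ (by positivity)]
    nlinarith
  have h3 : 0 ≤ p.η * (⨅ i, p.r i) / (2 * (n : ℝ) ^ 2) := by
    have := hp.η_pos
    have := hp.iInf_r_pos
    positivity
  have h4 : min 1 (32 * (1 - p.beta 2)) ≤ 1 := min_le_left _ _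
  nlinarith

lemma B_mul_lam_beta_lt_one (hn : 2 ≤ n) (hp : p.Valid) (hW : ConnectivityAssumption p W)
    {t : ℕ} (ht : 1 ≤ t) : p.B * (p.lam * p.beta t) < 1 := by
  have h1 := B_mul_lam_lt_one hn hp hW
  have h2 := hp.beta_le_one ht
  have h3 : 0 < p.B * p.lam := mul_pos hp.B_pos' hp.lam_pos
  nlinarith [hp.beta_pos ht]

lemma lam_beta_lt_one (hn : 2 ≤ n) (hp : p.Valid) (hW : ConnectivityAssumption p W)
    {t : ℕ} (ht : 1 ≤ t) : p.lam * p.beta t < 1 := by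
  have h1 := B_mul_lam_beta_lt_one hn hp hW ht
  have h2 : 0 < p.lam * p.beta t := mul_pos hp.lam_pos (hp.beta_pos ht)
  have h3 : (1 : ℝ) ≤ p.B := by exact_mod_cast hp.B_pos
  nlinarith

lemma kappa_pos (hn : 2 ≤ n) (hp : p.Valid) (hW : ConnectivityAssumption p W) :
    0 < p.kappa := by
  have h := B_mul_lam_beta_lt_one hn hp hW (t := 1) le_rfl
  rw [Params.kappa]
  simp only [Params.beta, Nat.cast_one, Real.one_rpow, div_one] at h
  exact inv_pos.2 (by linarith)

lemma connected_cut (hW : ConnectivityAssumption p W) (hp : p.Valid) {t : ℕ} (ht : 1 ≤ t)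
    (S : Set (Fin n)) (hS : S.Nonempty) (hS' : Sᶜ.Nonempty) :
    ∃ k ∈ Finset.Icc (t + 1) (t + p.B), ∃ i j, 0 < mixMat p W k i j ∧ i ∉ S ∧ j ∈ S := by
  obtain ⟨a, ha⟩ := hS
  obtain ⟨b, hb⟩ := hS'
  obtain ⟨j, i, ⟨k, hk, hw⟩, hi, hj⟩ := exists_step_of_reflTransGen (hW.connected t ht a b) ha hb
  refine ⟨k, hk, i, j, ?_, hi, hj⟩
  rw [Finset.mem_Icc] at hk
  have hij : i ≠ j := by rintro rfl; exact hi hj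
  rw [mixMat_apply_of_ne k hij]
  exact mul_pos (hp.beta_pos (by omega)) hw

/-- Contraction of the dispersion over one connectivity window. -/
theorem disp_window (hn : 2 ≤ n) (hp : p.Valid) (hW : ConnectivityAssumption p W)
    {U : ℕ → Config n d} {t : ℕ} (ht : 1 ≤ t)
    (hU : ∀ k ∈ Finset.Icc (t + 1) (t + p.B), U (k + 1) = act (mixMat p W k) (U k)) :
    disp p.r (U (t + p.B + 1)) ≤
      (1 - p.B * (p.lam * p.beta (t + p.B))) * disp p.r (U (t + 1)) := by
  have hn' : (2 : ℝ) ≤ n := by exact_mod_cast hn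
  rw [disp_eq_sum_wVar hp.r_sum, disp_eq_sum_wVar hp.r_sum, Finset.mul_sum]
  refine Finset.sum_le_sum fun c _ => ?_
  -- Lower bound for r i · A i i · A i j inside the window: the diagonal is at least 1 - β(2)
  -- because k ≥ 2, and an off-diagonal positive entry is at least β(t+B)η because β decreases.
  set C := (⨅ i, p.r i) * ((1 - p.beta 2) * (p.beta (t + p.B) * p.η)) with hC
  have hβ2 : 0 < 1 - p.beta 2 := by linarith [hp.beta_two_lt]
  have hβ := hp.beta_pos (show 1 ≤ t + p.B by omega)
  have hη := hp.η_pos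
  have hr := hp.iInf_r_pos
  have hC0 : 0 ≤ C := by positivity
  have hwin := wVar_window (r := p.r) (A := mixMat p W) (x := fun k i => U k i c)
    (a := t + 1) (b := t + p.B) (fun i => (hp.r_pos i).le) hp.r_sum
    (by have := hp.B_pos; omega)
    (fun k hk => mixMat_nonneg hp hW (by rw [Finset.mem_Icc] at hk; omega))
    (fun k hk => mixMat_row_sum hW (by rw [Finset.mem_Icc] at hk; omega))
    (fun k hk => mixMat_stationary hW (by rw [Finset.mem_Icc] at hk; omega))
    (fun k hk i => by simp [hU k hk, act])
    (connected_cut hW hp ht) hC0 (fun k hk i j hij hpos => by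
      rw [Finset.mem_Icc] at hk
      have hk1 : 1 ≤ k := by omega
      rw [mixMat_apply_of_ne k hij] at hpos ⊢
      have hw : 0 < W k i j := (mul_pos_iff_of_pos_left (hp.beta_pos hk1)).1 hpos
      have h1 : 1 - p.beta 2 ≤ mixMat p W k i i := by
        rw [mixMat_apply_self]
        have := hp.beta_anti (by norm_num) (by omega : 2 ≤ k)
        have := mul_nonneg (hp.beta_pos hk1).le (hW.nonneg k hk1 i i)
        linarith
      have h2 := hW.lower k hk1 i j hw
      have h3 := hp.beta_anti hk1 hk.2
      have h4 := Params.Valid.iInf_r_le (p := p) i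
      have h5 := (hp.beta_pos hk1).le
      have h6 := (hp.r_pos i).le
      have h7 : 0 ≤ mixMat p W k i i := by linarith
      rw [hC]
      gcongr)
  have hw0 : 0 ≤ wVar p.r (fun i => U (t + 1) i c) := by
    have hnn := wVar_ge_of_row (fun j => (hp.r_pos j).le) hp.r_sum (fun i => U (t + 1) i c)
      hp.nonempty.some
    refine le_trans (mul_nonneg (hp.r_pos _).le (Finset.sum_nonneg fun j _ =>
      mul_nonneg (hp.r_pos _).le (sq_nonneg _))) hnn
  -- The factor 32 in λ turns the constant into 16/n², and 16(n - 1) ≤ 4n² is (n - 2)² ≥ 0.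
  have hkey : ((n : ℝ) - 1) * (p.B * (p.lam * p.beta (t + p.B))) ≤ 4 * C := by
    have e : p.B * (p.lam * p.beta (t + p.B)) = (p.B * p.lam) * p.beta (t + p.B) := by ring
    rw [e, hp.B_mul_lam]
    have h1 : min 1 (32 * (1 - p.beta 2)) ≤ 32 * (1 - p.beta 2) := min_le_right _ _
    have h2 : ((n : ℝ) - 1) * (16 / (n : ℝ) ^ 2) ≤ 4 := by
      rw [mul_div_assoc', div_le_iff₀ (by positivity)]
      nlinarith [sq_nonneg ((n : ℝ) - 2)]
    have hn1 : (0 : ℝ) ≤ (n : ℝ) - 1 := by linarith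
    calc _ ≤ ((n : ℝ) - 1) * (p.η * (⨅ i, p.r i) / (2 * (n : ℝ) ^ 2) *
          (32 * (1 - p.beta 2)) * p.beta (t + p.B)) := by gcongr
      _ = ((n : ℝ) - 1) * (16 / (n : ℝ) ^ 2) * C := by rw [hC]; field_simp; ring
      _ ≤ 4 * C := mul_le_mul_of_nonneg_right h2 hC0
  have h3 := (mul_le_mul_of_nonneg_right hkey hw0).trans hwin
  rw [mul_assoc] at h3
  have h4 := le_of_mul_le_mul_left h3 (by linarith : (0 : ℝ) < (n : ℝ) - 1)
  linarith

lemma disp_act_mixMat_le (hp : p.Valid) (hW : ConnectivityAssumption p W) {t : ℕ} (ht : 1 ≤ t)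
    (U : Config n d) : disp p.r (act (mixMat p W t) U) ≤ disp p.r U := by
  rw [disp_eq_sum_wVar hp.r_sum, disp_eq_sum_wVar hp.r_sum]
  refine Finset.sum_le_sum fun c _ => ?_
  have h := wVar_step (fun i => (hp.r_pos i).le) (mixMat_nonneg hp hW ht) (mixMat_row_sum hW ht)
    (mixMat_stationary hW ht) (fun i => U i c)
  have h0 : 0 ≤ ∑ i, p.r i * (mixMat p W t i i * ∑ j, mixMat p W t i j * (U j c - U i c) ^ 2) :=
    Finset.sum_nonneg fun i _ => mul_nonneg (hp.r_pos i).le (mul_nonneg (mixMat_nonneg hp hW ht _ _)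
      (Finset.sum_nonneg fun j _ => mul_nonneg (mixMat_nonneg hp hW ht _ _) (sq_nonneg _)))
  have e : (fun i => act (mixMat p W t) U i c) = fun i => ∑ j, mixMat p W t i j * U j c := by
    funext i; simp [act]
  rw [e]
  linarith

/-- The dispersion decays like the product of the factors `1 - λ β(k)`. -/
theorem disp_transMat_le (hn : 2 ≤ n) (hp : p.Valid) (hW : ConnectivityAssumption p W)
    {s : ℕ} (hs : 1 ≤ s) (m : ℕ) (U : Config n d) :
    disp p.r (act (transMat p W (s + 1) m) U) ≤
      p.kappa * (∏ k ∈ Finset.Ico (s + 1) (s + 1 + m), (1 - p.lam * p.beta k)) * disp p.r U := by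
  set u : ℕ → Config n d := fun k => act (transMat p W (s + 1) (k - (s + 1))) U with hu
  have hstep : ∀ k, s + 1 ≤ k → u (k + 1) = act (mixMat p W k) (u k) := fun k hk => by
    simp only [hu]
    rw [show k + 1 - (s + 1) = (k - (s + 1)) + 1 by omega, transMat, act_mul,
      show s + 1 + (k - (s + 1)) = k by omega]
  have h := le_prod_of_block_contraction (w := fun k => disp p.r (u k))
    (θ := fun k => p.lam * p.beta k) hp.B_pos (a := s)
    (fun t _ => disp_nonneg (fun i => (hp.r_pos i).le) _)
    (fun t ht => by
      rw [hstep (t + 1) (by omega)]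
      exact disp_act_mixMat_le hp hW (by omega) _)
    (fun t ht => mul_le_mul_of_nonneg_left (hp.beta_anti (hs.trans ht) (by omega)) hp.lam_pos.le)
    (fun t ht => mul_nonneg hp.lam_pos.le (hp.beta_pos (hs.trans ht)).le)
    (fun t ht => B_mul_lam_beta_lt_one hn hp hW (hs.trans ht))
    (fun t ht => disp_window hn hp hW (hs.trans ht) fun k hk => hstep k (by
      rw [Finset.mem_Icc] at hk; omega)) m s le_rfl
  have e1 : u (s + 1 + m) = act (transMat p W (s + 1) m) U := by simp [hu]
  have e2 : u (s + 1) = U := by simp [hu, transMat, act_one]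
  simp only [e1, e2] at h
  refine h.trans ?_
  -- κ is the prefactor with β(s) replaced by its largest value β₀, hence uniform in the starting
  -- time.
  have hk : (1 - p.B * (p.lam * p.beta s))⁻¹ ≤ p.kappa := by
    rw [Params.kappa]
    have h1 := B_mul_lam_beta_lt_one hn hp hW (t := 1) le_rfl
    simp only [Params.beta, Nat.cast_one, Real.one_rpow, div_one] at h1
    refine inv_anti₀ (by linarith) ?_
    have h2 := mul_le_mul_of_nonneg_left (hp.beta_le hs)
      (mul_nonneg hp.B_pos'.le hp.lam_pos.le)
    linarith
  refine mul_le_mul_of_nonneg_right (mul_le_mul_of_nonneg_right hk ?_)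
    (disp_nonneg (fun i => (hp.r_pos i).le) _)
  refine Finset.prod_nonneg fun k hk => ?_
  rw [Finset.mem_Ico] at hk
  linarith [lam_beta_lt_one hn hp hW (show 1 ≤ k by omega)]

end Contraction

/-! ### Gradient steps for smooth strongly convex functions -/

section Gradient

variable {E : Type*} [NormedAddCommGroup E] [InnerProductSpace ℝ E] [CompleteSpace E]

/-- Along the segment from x to x + v, F minus its tangent parabola has nonnegative derivative by
monotonicity of g. The sign of c is free, so the upper bound follows by applying this to -F and -c.
-/
lemma quadratic_lower_bound {F : E → ℝ} {g : E → E} (hF : ∀ x, HasGradientAt F (g x) x) {c : ℝ}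
    (hg : ∀ x y, c * ‖x - y‖ ^ 2 ≤ inner ℝ (g x - g y) (x - y)) (x v : E) :
    F x + inner ℝ (g x) v + c / 2 * ‖v‖ ^ 2 ≤ F (x + v) := by
  set φ : ℝ → ℝ := fun t => F (x + t • v) - t * inner ℝ (g x) v - c / 2 * ‖v‖ ^ 2 * t ^ 2 with hφ
  have hd : ∀ t, HasDerivAt φ
      (inner ℝ (g (x + t • v) - g x) v - c * ‖v‖ ^ 2 * t) t := by
    intro t
    have h1 : HasDerivAt (fun t : ℝ => x + t • v) v t := by
      simpa using ((hasDerivAt_id t).smul_const v).const_add x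
    have h2 := (hF (x + t • v)).hasFDerivAt.comp_hasDerivAt t h1
    have h3 := (h2.sub ((hasDerivAt_id t).mul_const (inner ℝ (g x) v))).sub
      ((hasDerivAt_pow 2 t).const_mul (c / 2 * ‖v‖ ^ 2))
    refine h3.congr_deriv ?_
    rw [InnerProductSpace.toDual_apply_apply, inner_sub_left]
    norm_num
    ring
  have hmono : MonotoneOn φ (Set.Icc 0 1) := by
    refine monotoneOn_of_hasDerivWithinAt_nonneg (convex_Icc _ _)
      (fun t _ => (hd t).continuousAt.continuousWithinAt)
      (fun t _ => (hd t).hasDerivWithinAt) fun t ht => ?_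
    rw [interior_Icc] at ht
    have h := hg (x + t • v) x
    rw [add_sub_cancel_left, norm_smul, inner_smul_right, mul_pow, Real.norm_eq_abs, sq_abs] at h
    have h' : t * (c * ‖v‖ ^ 2 * t) ≤ t * inner ℝ (g (x + t • v) - g x) v := by linarith
    linarith [le_of_mul_le_mul_left h' ht.1]
  have h := hmono (Set.left_mem_Icc.2 zero_le_one) (Set.right_mem_Icc.2 zero_le_one) zero_le_one
  simp only [hφ, zero_smul, add_zero, one_smul] at h
  linarith

lemma quadratic_upper_bound {F : E → ℝ} {g : E → E} (hF : ∀ x, HasGradientAt F (g x) x) {c : ℝ}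
    (hg : ∀ x y, inner ℝ (g x - g y) (x - y) ≤ c * ‖x - y‖ ^ 2) (x v : E) :
    F (x + v) ≤ F x + inner ℝ (g x) v + c / 2 * ‖v‖ ^ 2 := by
  have hF' : ∀ x, HasGradientAt (fun x => -F x) (-g x) x := fun x => by
    have := (hF x).hasFDerivAt.neg
    rw [← map_neg] at this
    exact this
  have h := quadratic_lower_bound (F := fun x => -F x) (g := fun x => -g x) hF' (c := -c)
    (fun x y => by
      have := hg x y
      rw [← neg_sub' , inner_neg_left]
      linarith) x v
  simp only [inner_neg_left] at h
  linarith

/-- Coercivity of the gradient of an `L`-smooth and `m`-strongly convex function. -/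
theorem gradient_coercive {F : E → ℝ} {g : E → E} (hF : ∀ x, HasGradientAt F (g x) x) {m L : ℝ}
    (hm : ∀ x y, m * ‖x - y‖ ^ 2 ≤ inner ℝ (g x - g y) (x - y))
    (hL : ∀ x y, ‖g x - g y‖ ≤ L * ‖x - y‖) (x y : E) :
    ‖g x - g y‖ ^ 2 + m * L * ‖x - y‖ ^ 2 ≤ (m + L) * inner ℝ (g x - g y) (x - y) := by
  have hL' : ∀ x y, inner ℝ (g x - g y) (x - y) ≤ L * ‖x - y‖ ^ 2 := fun x y => by
    have h1 := real_inner_le_norm (g x - g y) (x - y)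
    have h2 := mul_le_mul_of_nonneg_right (hL x y) (norm_nonneg (x - y))
    nlinarith
  -- H is the gradient difference of F - (m/2)‖·‖², and this is its co-coercivity. The quadratic
  -- bounds are compared at the two points x - H/ℓ and y + H/ℓ and summed. Requiring ℓ > 0 allows
  -- for L = m.
  have key : ∀ ℓ : ℝ, 0 < ℓ → L - m ≤ ℓ → ‖(g x - g y) - m • (x - y)‖ ^ 2 ≤
      ℓ * inner ℝ ((g x - g y) - m • (x - y)) (x - y) := by
    intro ℓ hℓ hLm
    set H := (g x - g y) - m • (x - y) with hH
    set w := ℓ⁻¹ • H with hw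
    have a1 := quadratic_lower_bound hF hm y ((x - y) - w)
    have a2 := quadratic_upper_bound hF hL' x (-w)
    have b1 := quadratic_lower_bound hF hm x (w - (x - y))
    have b2 := quadratic_upper_bound hF hL' y w
    rw [show y + ((x - y) - w) = x + -w by abel] at a1
    rw [show x + (w - (x - y)) = y + w by abel] at b1
    rw [norm_sub_sq_real, inner_sub_right] at a1
    rw [norm_sub_sq_real, inner_sub_right, real_inner_comm (x - y) w] at b1
    rw [norm_neg, inner_neg_right] at a2
    have c1 : inner ℝ H w = inner ℝ (g x) w - inner ℝ (g y) w - m * inner ℝ (x - y) w := by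
      rw [hH, inner_sub_left, inner_sub_left, real_inner_smul_left]
    have c2 : inner ℝ H (x - y) = inner ℝ (g x) (x - y) - inner ℝ (g y) (x - y)
        - m * ‖x - y‖ ^ 2 := by
      rw [hH, inner_sub_left, inner_sub_left, real_inner_smul_left, real_inner_self_eq_norm_sq]
    have c3 : inner ℝ H w = ℓ⁻¹ * ‖H‖ ^ 2 := by
      rw [hw, real_inner_smul_right, real_inner_self_eq_norm_sq]
    have c4 : ‖w‖ ^ 2 = ℓ⁻¹ * (ℓ⁻¹ * ‖H‖ ^ 2) := by
      rw [hw, norm_smul, mul_pow, Real.norm_eq_abs, sq_abs]; ring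
    have c5 : ℓ * ‖w‖ ^ 2 = ℓ⁻¹ * ‖H‖ ^ 2 := by
      rw [c4]; field_simp
    have c6 : (L - m) * ‖w‖ ^ 2 ≤ ℓ * ‖w‖ ^ 2 := mul_le_mul_of_nonneg_right hLm (sq_nonneg _)
    have c7 : ℓ⁻¹ * ‖H‖ ^ 2 ≤ inner ℝ H (x - y) := by linarith
    rwa [inv_mul_eq_div, div_le_iff₀ hℓ, mul_comm] at c7
  -- The inequality m ≤ L is read off from a pair of distinct points, so equal points are treated
  -- apart.
  by_cases hxy : x = y
  · subst hxy; simp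
  have hv : 0 < ‖x - y‖ ^ 2 := by
    have : 0 < ‖x - y‖ := norm_pos_iff.2 (sub_ne_zero.2 hxy)
    positivity
  have hmL : 0 ≤ L - m := by
    have := (hm x y).trans (hL' x y)
    linarith [le_of_mul_le_mul_right this hv]
  -- Let ℓ decrease to L - m.
  have hlim : ‖(g x - g y) - m • (x - y)‖ ^ 2 ≤
      (L - m) * inner ℝ ((g x - g y) - m • (x - y)) (x - y) := by
    refine le_of_forall_pos_le_add fun ε hε => ?_
    set I := inner ℝ ((g x - g y) - m • (x - y)) (x - y)
    have hδ : 0 < ε / (|I| + 1) := by positivity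
    have h := key (L - m + ε / (|I| + 1)) (by linarith) (by linarith)
    have h2 : ε / (|I| + 1) * I ≤ ε := by
      rw [div_mul_eq_mul_div, div_le_iff₀ (by positivity)]
      nlinarith [le_abs_self I]
    linarith
  rw [norm_sub_sq_real, real_inner_smul_right, inner_sub_left (g x - g y) (m • (x - y)),
    real_inner_smul_left, norm_smul, mul_pow, Real.norm_eq_abs, sq_abs,
    real_inner_self_eq_norm_sq] at hlim
  linarith

/-- A gradient step contracts the distance to a critical point. -/
theorem gradient_step_contracts {F : E → ℝ} {g : E → E} (hF : ∀ x, HasGradientAt F (g x) x)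
    {m L : ℝ} (hm0 : 0 < m) (hL0 : 0 < L)
    (hm : ∀ x y, m * ‖x - y‖ ^ 2 ≤ inner ℝ (g x - g y) (x - y))
    (hL : ∀ x y, ‖g x - g y‖ ≤ L * ‖x - y‖) {y : E} (hy : g y = 0) {s : ℝ} (hs : 0 ≤ s)
    (hs2 : s * (m + L) ≤ 2) (x : E) :
    ‖x - s • g x - y‖ ^ 2 ≤ (1 - 2 * (m * L / (m + L) * s)) * ‖x - y‖ ^ 2 := by
  have h := gradient_coercive hF hm hL x y
  rw [hy, sub_zero] at h
  rw [show x - s • g x - y = (x - y) - s • g x by abel, norm_sub_sq_real, real_inner_smul_right,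
    real_inner_comm, norm_smul, mul_pow, Real.norm_eq_abs, sq_abs]
  have hmL : 0 < m + L := by linarith
  have h1 : (‖g x‖ ^ 2 + m * L * ‖x - y‖ ^ 2) / (m + L) ≤ inner ℝ (g x) (x - y) := by
    rw [div_le_iff₀ hmL]; linarith
  have h2 := mul_le_mul_of_nonneg_left h1 hs
  have h3 : s * ((‖g x‖ ^ 2 + m * L * ‖x - y‖ ^ 2) / (m + L)) =
      s / (m + L) * ‖g x‖ ^ 2 + m * L / (m + L) * s * ‖x - y‖ ^ 2 := by
    field_simp
  -- The step-size condition s(m + L) ≤ 2 lets the coercivity term absorb s²‖g x‖².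
  have h4 : s ^ 2 * ‖g x‖ ^ 2 ≤ 2 * (s / (m + L) * ‖g x‖ ^ 2) := by
    have : s ^ 2 ≤ 2 * (s / (m + L)) := by
      rw [mul_div_assoc', le_div_iff₀ hmL]; nlinarith
    nlinarith [sq_nonneg ‖g x‖]
  linarith

end Gradient

/-- Young's inequality trades k = (2 - ρ)c of the contraction 2c for the cross term. With q = 1 -
2c, the coefficient of ‖v‖² is 1 + q/k ≤ 1/k because k + q ≤ 1. The case q = 0 is separate since
Young's inequality here divides by q. -/
lemma norm_add_sq_le_of_contraction {E : Type*} [SeminormedAddCommGroup E] {u v : E}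
    {N c ρ : ℝ} (hc : 0 < c) (hc2 : 2 * c ≤ 1)
    (hρ0 : 0 ≤ ρ) (hρ : ρ < 2) (hu : ‖u‖ ^ 2 ≤ (1 - 2 * c) * N) (hN : 0 ≤ N) :
    ‖u + v‖ ^ 2 ≤ (1 - ρ * c) * N + ‖v‖ ^ 2 / ((2 - ρ) * c) := by
  have hk : 0 < (2 - ρ) * c := mul_pos (by linarith) hc
  set k := (2 - ρ) * c with hkdef
  have hk2 : k ≤ 2 * c := by rw [hkdef]; nlinarith
  have h1 : ‖u + v‖ ^ 2 ≤ (‖u‖ + ‖v‖) ^ 2 :=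
    pow_le_pow_left₀ (norm_nonneg _) (norm_add_le _ _) 2
  refine h1.trans ?_
  have e : 1 - ρ * c = (1 - 2 * c) + k := by rw [hkdef]; ring
  rw [e]
  rcases (show 0 ≤ 1 - 2 * c by linarith).eq_or_lt with h0 | h0
  · rw [← h0, zero_mul] at hu
    have hu0 : ‖u‖ = 0 := by nlinarith [norm_nonneg u]
    have : ‖v‖ ^ 2 ≤ ‖v‖ ^ 2 / k := by
      rw [le_div_iff₀ hk]; nlinarith [sq_nonneg ‖v‖]
    rw [hu0, ← h0]
    nlinarith
  · set q := 1 - 2 * c with hq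
    have h2 : ‖u‖ ^ 2 / q ≤ N := by rw [div_le_iff₀ h0]; linarith
    have h3 : 2 * (‖u‖ * ‖v‖) ≤ k * (‖u‖ ^ 2 / q) + q * (‖v‖ ^ 2 / k) := by
      have : k * (‖u‖ ^ 2 / q) + q * (‖v‖ ^ 2 / k) - 2 * (‖u‖ * ‖v‖) =
          (‖u‖ * k - ‖v‖ * q) ^ 2 / (q * k) := by field_simp; ring
      have h4 : 0 ≤ (‖u‖ * k - ‖v‖ * q) ^ 2 / (q * k) := by positivity
      linarith
    have h5 : ‖v‖ ^ 2 + q * (‖v‖ ^ 2 / k) ≤ ‖v‖ ^ 2 / k := by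
      have : ‖v‖ ^ 2 = k * (‖v‖ ^ 2 / k) := by field_simp
      have h6 : 0 ≤ ‖v‖ ^ 2 / k := by positivity
      nlinarith
    nlinarith [mul_le_mul_of_nonneg_left h2 hk.le]

/-! ### Linear recursions and telescoping products. -/

section Recursion

/-- Unrolling a linear recursive inequality. -/
lemma le_of_linear_recursion {q ρ s : ℕ → ℝ} {T₀ : ℕ}
    (hρ : ∀ t, T₀ ≤ t → 0 ≤ 1 - ρ t) (h : ∀ t, T₀ ≤ t → q (t + 1) ≤ (1 - ρ t) * q t + s t)
    {T : ℕ} (hT : T₀ ≤ T) :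
    q T ≤ (∏ k ∈ Finset.Ico T₀ T, (1 - ρ k)) * q T₀ +
      ∑ t ∈ Finset.Ico T₀ T, s t * ∏ k ∈ Finset.Ico (t + 1) T, (1 - ρ k) := by
  induction T, hT using Nat.le_induction with
  | base => simp
  | succ T hT ih =>
    have h1 : ∑ t ∈ Finset.Ico T₀ (T + 1), s t * ∏ k ∈ Finset.Ico (t + 1) (T + 1), (1 - ρ k) =
        (1 - ρ T) * ∑ t ∈ Finset.Ico T₀ T, s t * ∏ k ∈ Finset.Ico (t + 1) T, (1 - ρ k) + s T := by
      rw [Finset.sum_Ico_succ_top hT, Finset.Ico_self, Finset.prod_empty, mul_one, Finset.mul_sum]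
      congr 1
      refine Finset.sum_congr rfl fun t ht => ?_
      rw [Finset.mem_Ico] at ht
      rw [Finset.prod_Ico_succ_top (by omega)]
      ring
    rw [h1, Finset.prod_Ico_succ_top hT]
    have := mul_le_mul_of_nonneg_left ih (hρ T hT)
    linarith [h T hT]

/-- Each summand is the difference of the products starting at t + 1 and at t, so the sum
telescopes. -/
lemma sum_mul_prod_one_sub_le_one {ρ : ℕ → ℝ} {s₀ T : ℕ} (hρ : ∀ t, s₀ ≤ t → 0 ≤ 1 - ρ t)
    (hT : s₀ ≤ T) :
    ∑ t ∈ Finset.Ico s₀ T, ρ t * ∏ k ∈ Finset.Ico (t + 1) T, (1 - ρ k) ≤ 1 := by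
  have h : ∑ t ∈ Finset.Ico s₀ T, ρ t * ∏ k ∈ Finset.Ico (t + 1) T, (1 - ρ k) =
      ∑ t ∈ Finset.Ico s₀ T, ((fun s => ∏ k ∈ Finset.Ico s T, (1 - ρ k)) (t + 1) -
        (fun s => ∏ k ∈ Finset.Ico s T, (1 - ρ k)) t) := by
    refine Finset.sum_congr rfl fun t ht => ?_
    rw [Finset.mem_Ico] at ht
    simp only
    rw [Finset.prod_eq_prod_Ico_succ_bot ht.2]
    ring
  rw [h, Finset.sum_Ico_sub (fun s => ∏ k ∈ Finset.Ico s T, (1 - ρ k)) hT]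
  have : 0 ≤ ∏ k ∈ Finset.Ico s₀ T, (1 - ρ k) :=
    Finset.prod_nonneg fun k hk => hρ k (Finset.mem_Ico.1 hk).1
  simp only [Finset.Ico_self, Finset.prod_empty]
  linarith

end Recursion

/-! ### The averaged state as inexact gradient descent. -/

section AverageStep

variable {n d : ℕ} {p : Params n} {f : Fin n → EuclideanSpace ℝ (Fin d) → ℝ}

/-- The weighted mean of the local gradients at the rows of a configuration. -/
def meanGrad (r : Fin n → ℝ) (f : Fin n → EuclideanSpace ℝ (Fin d) → ℝ) (U : Config n d) :
    EuclideanSpace ℝ (Fin d) :=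
  rMean r (fun i => gradient (f i) (U i))

/-- One step of the noiseless averaged dynamics. -/
theorem mean_step_le (hp : p.Valid) (hdiff : ∀ i, Differentiable ℝ (f i))
    (hsmooth : ∀ i x y, ‖gradient (f i) x - gradient (f i) y‖ ≤ p.L * ‖x - y‖)
    (hstrong : ∀ i x y,
      p.m * ‖x - y‖ ^ 2 ≤ inner ℝ (gradient (f i) x - gradient (f i) y) (x - y))
    {xs : EuclideanSpace ℝ (Fin d)}
    (hxs : ∀ x, ∑ i, p.r i * f i xs ≤ ∑ i, p.r i * f i x) {s ρ : ℝ} (hs : 0 < s)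
    (hs2 : s * (p.m + p.L) ≤ 2) (hρ0 : 0 ≤ ρ) (hρ : ρ < 2) (U : Config n d) :
    ‖rMean p.r U - s • meanGrad p.r f U - xs‖ ^ 2 ≤
      (1 - ρ * (p.c₂ * s)) * ‖rMean p.r U - xs‖ ^ 2 +
        s * (p.L ^ 2 / ((2 - ρ) * p.c₂)) * disp p.r U := by
  set g : EuclideanSpace ℝ (Fin d) → EuclideanSpace ℝ (Fin d) :=
    fun x => ∑ i, p.r i • gradient (f i) x with hg
  have hF : ∀ x, HasGradientAt (fun x => ∑ i, p.r i * f i x) (g x) x := fun x => by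
    have h : HasFDerivAt (fun x => ∑ i, p.r i * f i x)
        (∑ i, p.r i • (InnerProductSpace.toDual ℝ (EuclideanSpace ℝ (Fin d)))
          (gradient (f i) x)) x :=
      HasFDerivAt.fun_sum fun i _ => ((hdiff i x).hasGradientAt.hasFDerivAt).const_mul (p.r i)
    rw [hasGradientAt_iff_hasFDerivAt]
    have e : (InnerProductSpace.toDual ℝ (EuclideanSpace ℝ (Fin d))) (g x) =
        ∑ i, p.r i • (InnerProductSpace.toDual ℝ (EuclideanSpace ℝ (Fin d)))
          (gradient (f i) x) := by
      simp [hg, map_sum]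
    rw [e]
    exact h
  have hgsub : ∀ x y, g x - g y = ∑ i, p.r i • (gradient (f i) x - gradient (f i) y) :=
    fun x y => by simp [hg, smul_sub, Finset.sum_sub_distrib]
  have hm : ∀ x y, p.m * ‖x - y‖ ^ 2 ≤ inner ℝ (g x - g y) (x - y) := fun x y => by
    rw [hgsub, sum_inner, ← one_mul (p.m * _), ← hp.r_sum, Finset.sum_mul]
    refine Finset.sum_le_sum fun i _ => ?_
    rw [real_inner_smul_left]
    exact mul_le_mul_of_nonneg_left (hstrong i x y) (hp.r_pos i).le
  have hL : ∀ x y, ‖g x - g y‖ ≤ p.L * ‖x - y‖ := fun x y => by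
    rw [hgsub, ← one_mul (p.L * _), ← hp.r_sum, Finset.sum_mul]
    refine (norm_sum_le _ _).trans (Finset.sum_le_sum fun i _ => ?_)
    rw [norm_smul, Real.norm_of_nonneg (hp.r_pos i).le]
    exact mul_le_mul_of_nonneg_left (hsmooth i x y) (hp.r_pos i).le
  have hcrit : g xs = 0 := by
    have hmin : IsLocalMin (fun x => ∑ i, p.r i * f i x) xs := Filter.Eventually.of_forall hxs
    have := hmin.hasFDerivAt_eq_zero (hF xs).hasFDerivAt
    simpa using this
  have hmL : 0 < p.m + p.L := by linarith [hp.m_pos, hp.L_pos]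
  have hc₂ : 0 < p.c₂ := div_pos (mul_pos hp.m_pos hp.L_pos) hmL
  have hstep := gradient_step_contracts hF hp.m_pos hp.L_pos hm hL hcrit hs.le hs2 (rMean p.r U)
  have hc2 : 2 * (p.c₂ * s) ≤ 1 := by
    have h1 : p.c₂ * s = p.m * p.L * s / (p.m + p.L) := by rw [Params.c₂]; ring
    rw [h1, mul_div_assoc', div_le_one hmL]
    have h2 : 4 * (p.m * p.L) ≤ (p.m + p.L) ^ 2 := by nlinarith [sq_nonneg (p.m - p.L)]
    nlinarith
  -- The perturbation is s times the gradient of f at the mean minus the mean of the local gradients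
  -- at the agents' own points.
  have h := norm_add_sq_le_of_contraction (u := rMean p.r U - s • g (rMean p.r U) - xs)
    (v := s • (g (rMean p.r U) - meanGrad p.r f U)) (mul_pos hc₂ hs) hc2 hρ0 hρ hstep
    (sq_nonneg _)
  rw [show rMean p.r U - s • g (rMean p.r U) - xs + s • (g (rMean p.r U) - meanGrad p.r f U) =
    rMean p.r U - s • meanGrad p.r f U - xs by rw [smul_sub]; abel] at h
  refine h.trans (add_le_add_right ?_ _)
  -- Jensen's inequality, then the Lipschitz bound row by row.
  have hdev : ‖g (rMean p.r U) - meanGrad p.r f U‖ ^ 2 ≤ p.L ^ 2 * disp p.r U := by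
    have e : g (rMean p.r U) - meanGrad p.r f U = rMean p.r
        (fun i => gradient (f i) (rMean p.r U) - gradient (f i) (U i)) := by
      simp [hg, meanGrad, rMean, smul_sub, Finset.sum_sub_distrib]
    rw [e]
    refine (norm_rMean_sq_le (fun i => (hp.r_pos i).le) hp.r_sum _).trans ?_
    rw [disp, rNormSq, rNormSq, Finset.mul_sum]
    refine Finset.sum_le_sum fun i _ => ?_
    have h1 := pow_le_pow_left₀ (norm_nonneg _) (hsmooth i (rMean p.r U) (U i)) 2
    rw [mul_pow, norm_sub_rev (rMean p.r U)] at h1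
    have := mul_le_mul_of_nonneg_left h1 (hp.r_pos i).le
    linarith
  rw [norm_smul, mul_pow, Real.norm_of_nonneg hs.le]
  have h2ρ : 0 < 2 - ρ := by linarith
  rw [div_le_iff₀ (by positivity)]
  have e : s * (p.L ^ 2 / ((2 - ρ) * p.c₂)) * disp p.r U * ((2 - ρ) * (p.c₂ * s)) =
      s ^ 2 * (p.L ^ 2 * disp p.r U) := by
    field_simp
  rw [e]
  exact mul_le_mul_of_nonneg_left hdev (sq_nonneg _)

end AverageStep

/-! ### Second moments along the iteration -/

section Measurability

variable {n d : ℕ} {Ω : Type*}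

lemma measurable_act {_ : MeasurableSpace Ω} (M : Matrix (Fin n) (Fin n) ℝ) {U : Ω → Config n d}
    (hU : Measurable U) : Measurable (fun ω => act M (U ω)) := by
  refine measurable_pi_iff.2 fun i => Finset.measurable_sum _ fun j _ => ?_
  exact ((measurable_pi_apply j).comp hU).const_smul (M i j)

lemma measurable_rMean {_ : MeasurableSpace Ω} (r : Fin n → ℝ) {U : Ω → Config n d}
    (hU : Measurable U) : Measurable (fun ω => rMean r (U ω)) :=
  Finset.measurable_sum _ fun j _ => ((measurable_pi_apply j).comp hU).const_smul (r j)

variable [MeasurableSpace Ω] {P : Measure Ω}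

/-- All rows of the random configuration are square integrable. -/
def SqInt (P : Measure Ω) (U : Ω → Config n d) : Prop := ∀ i, MemLp (fun ω => U ω i) 2 P

lemma SqInt.add {U V : Ω → Config n d} (hU : SqInt P U) (hV : SqInt P V) :
    SqInt P (fun ω => U ω + V ω) := fun i => (hU i).add (hV i)

lemma SqInt.smul {U : Ω → Config n d} (c : ℝ) (hU : SqInt P U) :
    SqInt P (fun ω => c • U ω) := fun i => (hU i).const_smul c

lemma SqInt.act {U : Ω → Config n d} (M : Matrix (Fin n) (Fin n) ℝ) (hU : SqInt P U) :
    SqInt P (fun ω => act M (U ω)) := fun i =>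
  memLp_finsetSum _ fun j _ => (hU j).const_smul (M i j)

lemma SqInt.rMean {U : Ω → Config n d} (r : Fin n → ℝ) (hU : SqInt P U) :
    MemLp (fun ω => rMean r (U ω)) 2 P :=
  memLp_finsetSum _ fun j _ => (hU j).const_smul (r j)

lemma SqInt.dev {U : Ω → Config n d} (r : Fin n → ℝ) (hU : SqInt P U) :
    SqInt P (fun ω i => U ω i - _root_.rMean r (U ω)) := fun i => (hU i).sub (hU.rMean r)

lemma SqInt.integrable_rNormSq {U : Ω → Config n d} (r : Fin n → ℝ) (hU : SqInt P U) :
    Integrable (fun ω => rNormSq r (U ω)) P :=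
  integrable_finsetSum _ fun i _ => ((hU i).integrable_norm_pow two_ne_zero).const_mul (r i)

lemma SqInt.integrable_disp {U : Ω → Config n d} (r : Fin n → ℝ) (hU : SqInt P U) :
    Integrable (fun ω => disp r (U ω)) P :=
  (hU.dev r).integrable_rNormSq r

omit [MeasurableSpace Ω] in
lemma integrable_inner_of_memLp {E : Type*} [NormedAddCommGroup E] [InnerProductSpace ℝ E]
    {_ : MeasurableSpace Ω} {P : Measure Ω} {u v : Ω → E} (hu : MemLp u 2 P) (hv : MemLp v 2 P) :
    Integrable (fun ω => (inner ℝ (u ω) (v ω) : ℝ)) P := by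
  refine ((hu.integrable_norm_pow two_ne_zero).add
    (hv.integrable_norm_pow two_ne_zero)).mono' (hu.1.inner hv.1)
      (Filter.Eventually.of_forall fun ω => ?_)
  simp only [Pi.add_apply]
  have := norm_inner_le_norm (𝕜 := ℝ) (u ω) (v ω)
  nlinarith [sq_nonneg (‖u ω‖ - ‖v ω‖), norm_nonneg (u ω), norm_nonneg (v ω)]

end Measurability

/-! ### The dispersion as a squared seminorm. -/

section DispAlgebra

variable {n d : ℕ} {r : Fin n → ℝ}

lemma rMean_add (r : Fin n → ℝ) (U V : Config n d) : rMean r (U + V) = rMean r U + rMean r V := by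
  simp [rMean, Finset.sum_add_distrib]

lemma rMean_smul (r : Fin n → ℝ) (c : ℝ) (U : Config n d) : rMean r (c • U) = c • rMean r U := by
  simp only [rMean, Finset.smul_sum, Pi.smul_apply]
  exact Finset.sum_congr rfl fun i _ => smul_comm _ _ _

lemma disp_smul (r : Fin n → ℝ) (c : ℝ) (U : Config n d) : disp r (c • U) = c ^ 2 * disp r U := by
  simp only [disp, rNormSq, rMean_smul, Pi.smul_apply, ← smul_sub, norm_smul, mul_pow,
    Real.norm_eq_abs, sq_abs, Finset.mul_sum]
  exact Finset.sum_congr rfl fun i _ => by ring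

/-- The centred U has zero r-mean, so V need not be centred in the cross term. The cross term is
thus linear in V, and conditional centring of the noise applies to it directly. -/
lemma disp_add (hr : ∑ i, r i = 1) (U V : Config n d) :
    disp r (U + V) = disp r U + disp r V + 2 * ∑ i, r i * inner ℝ (U i - rMean r U) (V i) := by
  have h0 : ∑ i, r i * inner ℝ (U i - rMean r U) (rMean r V) = 0 := by
    have : ∀ i, r i * inner ℝ (U i - rMean r U) (rMean r V) =
        inner ℝ (r i • U i - r i • rMean r U) (rMean r V) := fun i => by
      rw [← smul_sub, real_inner_smul_left]
    simp_rw [this]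
    rw [← sum_inner, Finset.sum_sub_distrib, ← Finset.sum_smul, hr, one_smul]
    simp [rMean]
  have h1 : ∀ i, r i * ‖(U + V) i - rMean r (U + V)‖ ^ 2 =
      r i * ‖U i - rMean r U‖ ^ 2 + r i * ‖V i - rMean r V‖ ^ 2 +
      2 * (r i * inner ℝ (U i - rMean r U) (V i)) -
      2 * (r i * inner ℝ (U i - rMean r U) (rMean r V)) := fun i => by
    rw [rMean_add, Pi.add_apply, show U i + V i - (rMean r U + rMean r V) =
      (U i - rMean r U) + (V i - rMean r V) by abel, norm_add_sq_real,
      inner_sub_right (U i - rMean r U) (V i)]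
    ring
  rw [disp, rNormSq]
  simp_rw [h1, Finset.sum_sub_distrib, Finset.sum_add_distrib, ← Finset.mul_sum, h0]
  rw [disp, rNormSq, disp, rNormSq]
  ring

/-- Rescaling row i by √(r i) turns this into the triangle inequality in ℓ². -/
lemma sqrt_rNormSq_add_le (hr : ∀ i, 0 ≤ r i) (U V : Config n d) :
    √(rNormSq r (U + V)) ≤ √(rNormSq r U) + √(rNormSq r V) := by
  have h : ∀ U : Config n d, √(rNormSq r U) =
      ‖WithLp.toLp 2 (fun i => √(r i) • U i)‖ := fun U => by
    rw [PiLp.norm_eq_of_L2, rNormSq]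
    congr 1
    refine Finset.sum_congr rfl fun i _ => ?_
    simp [norm_smul, mul_pow, Real.sq_sqrt (hr i)]
  rw [h, h, h]
  have e : WithLp.toLp 2 (fun i => √(r i) • (U + V) i) =
      WithLp.toLp 2 (fun i => √(r i) • U i) + WithLp.toLp 2 (fun i => √(r i) • V i) := by
    ext i : 1
    simp [smul_add]
  rw [e]
  exact norm_add_le _ _

lemma sqrt_disp_add_le (hr : ∀ i, 0 ≤ r i) (U V : Config n d) :
    √(disp r (U + V)) ≤ √(disp r U) + √(disp r V) := by
  have e : (fun i => (U + V) i - rMean r (U + V)) =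
      (fun i => U i - rMean r U) + fun i => V i - rMean r V := by
    funext i
    simp only [rMean_add, Pi.add_apply]
    abel
  rw [disp, e]
  exact sqrt_rNormSq_add_le hr _ _

lemma disp_add_le (hr : ∀ i, 0 ≤ r i) (U V : Config n d) :
    disp r (U + V) ≤ 2 * disp r U + 2 * disp r V := by
  have h1 := pow_le_pow_left₀ (Real.sqrt_nonneg _) (sqrt_disp_add_le hr U V) 2
  rw [Real.sq_sqrt (disp_nonneg hr _)] at h1
  have h2 := Real.sq_sqrt (disp_nonneg hr U)
  have h3 := Real.sq_sqrt (disp_nonneg hr V)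
  nlinarith [sq_nonneg (√(disp r U) - √(disp r V))]

end DispAlgebra

/-! ### Adaptedness, orthogonality of the noise, and splitting of the state. -/

section Dynamics

variable {n d : ℕ} {Ω : Type*} {p : Params n}
  {f : Fin n → EuclideanSpace ℝ (Fin d) → ℝ} {W : ℕ → Matrix (Fin n) (Fin n) ℝ}
  {e X : ℕ → Ω → Config n d}

/-- The configuration of the local gradients. -/
def gradConfig (f : Fin n → EuclideanSpace ℝ (Fin d) → ℝ) (U : Config n d) : Config n d :=
  fun i => gradient (f i) (U i)

lemma continuous_gradient_of_smooth {L : ℝ} {f : EuclideanSpace ℝ (Fin d) → ℝ}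
    (hf : ∀ x y, ‖gradient f x - gradient f y‖ ≤ L * ‖x - y‖) : Continuous (gradient f) :=
  (LipschitzWith.of_dist_le_mul (K := L.toNNReal) fun x y => by
    rw [dist_eq_norm, dist_eq_norm]
    exact (hf x y).trans (mul_le_mul_of_nonneg_right (Real.le_coe_toNNReal L)
      (norm_nonneg _))).continuous

lemma measurable_gradConfig {_ : MeasurableSpace Ω} {L : ℝ}
    (hf : ∀ i x y, ‖gradient (f i) x - gradient (f i) y‖ ≤ L * ‖x - y‖) {U : Ω → Config n d}
    (hU : Measurable U) : Measurable (fun ω => gradConfig f (U ω)) :=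
  measurable_pi_iff.2 fun i =>
    (continuous_gradient_of_smooth (hf i)).measurable.comp ((measurable_pi_apply i).comp hU)

lemma IsDimix.step_eq (hX : IsDimix p f W e X) {t : ℕ} (ht : 1 ≤ t) (ω : Ω) :
    X (t + 1) ω = act (mixMat p W t) (X t ω) + p.beta t • e t ω -
      (p.alpha t * p.beta t) • gradConfig f (X t ω) := by
  funext i
  simp only [Pi.add_apply, Pi.sub_apply, Pi.smul_apply]
  rw [hX.step t ht ω i, act_mixMat, smul_add, gradConfig]
  abel

/-- The filtration is generated by the states alone. Solving the update for the noise shows that e s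
is known once X s and X (s + 1) are. -/
lemma IsDimix.noise_eq (hp : p.Valid) (hX : IsDimix p f W e X) {t : ℕ} (ht : 1 ≤ t) (ω : Ω) :
    e t ω = (p.beta t)⁻¹ • (X (t + 1) ω - act (mixMat p W t) (X t ω) +
      (p.alpha t * p.beta t) • gradConfig f (X t ω)) := by
  rw [hX.step_eq ht]
  have h : act (mixMat p W t) (X t ω) + p.beta t • e t ω -
      (p.alpha t * p.beta t) • gradConfig f (X t ω) - act (mixMat p W t) (X t ω) +
      (p.alpha t * p.beta t) • gradConfig f (X t ω) = p.beta t • e t ω := by abel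
  rw [h, inv_smul_smul₀ (hp.beta_pos ht).ne']

lemma measurable_pastSigma {s t : ℕ} (hs : 1 ≤ s) (hst : s ≤ t) :
    Measurable[pastSigma X t] (X s) := by
  have h : MeasurableSpace.comap (X s) inferInstance ≤ pastSigma X t :=
    le_iSup₂_of_le s ⟨hs, hst⟩ le_rfl
  exact measurable_iff_comap_le.2 h

lemma measurable_noise_pastSigma (hp : p.Valid) (hX : IsDimix p f W e X)
    (hf : ∀ i x y, ‖gradient (f i) x - gradient (f i) y‖ ≤ p.L * ‖x - y‖)
    {s t : ℕ} (hs : 1 ≤ s) (hst : s < t) :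
    Measurable[pastSigma X t] (e s) := by
  have h1 := measurable_pastSigma (X := X) hs hst.le
  have h2 := measurable_pastSigma (X := X) (s := s + 1) (t := t) (by omega) hst
  rw [show e s = _ from funext (hX.noise_eq hp hs)]
  exact ((h2.sub (measurable_act _ h1)).add
    ((measurable_gradConfig hf h1).const_smul (p.alpha s * p.beta s))).const_smul (p.beta s)⁻¹

variable [MeasurableSpace Ω] {P : Measure Ω} [IsProbabilityMeasure P]

omit [IsProbabilityMeasure P] in
lemma measurable_state (hX : IsDimix p f W e X) (hnoise : NoiseAssumption P p.γ e X)
    (hf : ∀ i x y, ‖gradient (f i) x - gradient (f i) y‖ ≤ p.L * ‖x - y‖)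
    {t : ℕ} (ht : 1 ≤ t) : Measurable (X t) := by
  induction t, ht using Nat.le_induction with
  | base =>
    rw [show X 1 = fun _ => 0 from funext hX.init]
    exact measurable_const
  | succ t ht ih =>
    rw [show X (t + 1) = _ from funext (hX.step_eq ht)]
    exact ((measurable_act _ ih).add ((hnoise.meas t ht).const_smul (p.beta t))).sub
      ((measurable_gradConfig hf ih).const_smul (p.alpha t * p.beta t))

omit [IsProbabilityMeasure P] in
lemma pastSigma_le (hX : IsDimix p f W e X) (hnoise : NoiseAssumption P p.γ e X)
    (hf : ∀ i x y, ‖gradient (f i) x - gradient (f i) y‖ ≤ p.L * ‖x - y‖) (t : ℕ) :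
    pastSigma X t ≤ (inferInstance : MeasurableSpace Ω) :=
  iSup₂_le fun _ hs => measurable_iff_comap_le.1 (measurable_state hX hnoise hf hs.1)

omit [IsProbabilityMeasure P] in
lemma sqInt_noise (hnoise : NoiseAssumption P p.γ e X) {t : ℕ} (ht : 1 ≤ t) :
    SqInt P (e t) := fun i =>
  (memLp_two_iff_integrable_sq_norm
    ((measurable_pi_apply i).comp (hnoise.meas t ht)).aestronglyMeasurable).2
      (hnoise.sq_int t ht i)

lemma memLp_gradient_comp {L : ℝ} {f : EuclideanSpace ℝ (Fin d) → ℝ}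
    (hf : ∀ x y, ‖gradient f x - gradient f y‖ ≤ L * ‖x - y‖) {u : Ω → EuclideanSpace ℝ (Fin d)}
    (hu : MemLp u 2 P) : MemLp (fun ω => gradient f (u ω)) 2 P := by
  have h0 : MemLp (fun _ : Ω => ‖gradient f 0‖) 2 P := memLp_const _
  have h1 : MemLp (fun ω => ‖gradient f 0‖ + L * ‖u ω‖) 2 P := h0.add (hu.norm.const_mul L)
  refine h1.mono' ((continuous_gradient_of_smooth hf).comp_aestronglyMeasurable hu.1)
    (Filter.Eventually.of_forall fun ω => ?_)
  have h2 := hf (u ω) 0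
  rw [sub_zero] at h2
  have h3 := norm_add_le (gradient f (u ω) - gradient f 0) (gradient f 0)
  rw [sub_add_cancel] at h3
  linarith

lemma sqInt_gradConfig {L : ℝ}
    (hf : ∀ i x y, ‖gradient (f i) x - gradient (f i) y‖ ≤ L * ‖x - y‖) {U : Ω → Config n d}
    (hU : SqInt P U) : SqInt P (fun ω => gradConfig f (U ω)) := fun i =>
  memLp_gradient_comp (hf i) (hU i)

lemma sqInt_state (hX : IsDimix p f W e X) (hnoise : NoiseAssumption P p.γ e X)
    (hf : ∀ i x y, ‖gradient (f i) x - gradient (f i) y‖ ≤ p.L * ‖x - y‖)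
    {t : ℕ} (ht : 1 ≤ t) : SqInt P (X t) := by
  induction t, ht using Nat.le_induction with
  | base =>
    rw [show X 1 = fun _ => 0 from funext hX.init]
    intro i
    exact memLp_const (0 : EuclideanSpace ℝ (Fin d))
  | succ t ht ih =>
    rw [show X (t + 1) = _ from funext (hX.step_eq ht)]
    intro i
    exact (((ih.act _) i).add (((sqInt_noise hnoise ht) i).const_smul (p.beta t))).sub
      (((sqInt_gradConfig hf ih) i).const_smul
        (p.alpha t * p.beta t))

/-- The noise is orthogonal to everything measurable with respect to the past. -/
lemma integral_inner_noise_eq_zero (hX : IsDimix p f W e X) (hnoise : NoiseAssumption P p.γ e X)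
    (hf : ∀ i x y, ‖gradient (f i) x - gradient (f i) y‖ ≤ p.L * ‖x - y‖)
    {t : ℕ} (ht : 1 ≤ t) {Z : Ω → EuclideanSpace ℝ (Fin d)}
    (hZm : Measurable[pastSigma X t] Z) (hZ : MemLp Z 2 P) (i : Fin n) :
    ∫ ω, inner ℝ (Z ω) (e t ω i) ∂P = 0 := by
  have he := sqInt_noise hnoise ht i
  have hi : Integrable (fun ω => inner ℝ (Z ω) (e t ω i)) P := integrable_inner_of_memLp hZ he
  have h := condExp_bilin_of_stronglyMeasurable_left (m := pastSigma X t) (μ := P)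
    (innerSL ℝ) (f := Z) (g := fun ω => e t ω i) hZm.stronglyMeasurable hi
    (he.integrable one_le_two)
  rw [← integral_condExp (pastSigma_le hX hnoise hf t)]
  refine integral_eq_zero_of_ae ?_
  filter_upwards [h, hnoise.condMean t ht i] with ω h1 h2
  refine h1.trans ?_
  rw [h2]
  simp

lemma integral_noise_sq_le (hX : IsDimix p f W e X) (hnoise : NoiseAssumption P p.γ e X)
    (hf : ∀ i x y, ‖gradient (f i) x - gradient (f i) y‖ ≤ p.L * ‖x - y‖)
    {t : ℕ} (ht : 1 ≤ t) (i : Fin n) : ∫ ω, ‖e t ω i‖ ^ 2 ∂P ≤ p.γ := by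
  rw [← integral_condExp (pastSigma_le hX hnoise hf t)]
  refine (integral_mono_ae integrable_condExp (integrable_const p.γ)
    (hnoise.condVar t ht i)).trans (le_of_eq ?_)
  simp

lemma integral_rNormSq_noise_le (hp : p.Valid) (hX : IsDimix p f W e X)
    (hnoise : NoiseAssumption P p.γ e X)
    (hf : ∀ i x y, ‖gradient (f i) x - gradient (f i) y‖ ≤ p.L * ‖x - y‖)
    {t : ℕ} (ht : 1 ≤ t) : ∫ ω, rNormSq p.r (e t ω) ∂P ≤ p.γ := by
  simp only [rNormSq]
  rw [integral_finsetSum _ fun i _ =>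
    ((sqInt_noise hnoise ht i).integrable_norm_pow two_ne_zero).const_mul (p.r i)]
  have h : ∀ i, ∫ ω, p.r i * ‖e t ω i‖ ^ 2 ∂P ≤ p.r i * p.γ := fun i => by
    rw [integral_const_mul]
    exact mul_le_mul_of_nonneg_left (integral_noise_sq_le hX hnoise hf ht i) (hp.r_pos i).le
  refine (Finset.sum_le_sum fun i _ => h i).trans ?_
  rw [← Finset.sum_mul, hp.r_sum, one_mul]

/-- The part of the state at time `k + 1` that is due to the noise. -/
def noisePart (p : Params n) (W : ℕ → Matrix (Fin n) (Fin n) ℝ) (e : ℕ → Ω → Config n d) :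
    ℕ → Ω → Config n d
  | 0 => fun _ => 0
  | k + 1 => fun ω => act (mixMat p W (k + 1)) (noisePart p W e k ω) + p.beta (k + 1) • e (k + 1) ω

/-- The part of the state at time `k + 1` that is due to the gradients. -/
def driftPart (p : Params n) (f : Fin n → EuclideanSpace ℝ (Fin d) → ℝ)
    (W : ℕ → Matrix (Fin n) (Fin n) ℝ) (X : ℕ → Ω → Config n d) : ℕ → Ω → Config n d
  | 0 => fun _ => 0
  | k + 1 => fun ω => act (mixMat p W (k + 1)) (driftPart p f W X k ω) +
      (-(p.alpha (k + 1) * p.beta (k + 1))) • gradConfig f (X (k + 1) ω)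

omit [MeasurableSpace Ω] in
-- The update is linear once the gradients along the actual trajectory are regarded as given inputs,
-- so superposition applies.
lemma state_eq_noisePart_add_driftPart (hX : IsDimix p f W e X) (k : ℕ) (ω : Ω) :
    X (k + 1) ω = noisePart p W e k ω + driftPart p f W X k ω := by
  induction k with
  | zero => simp [noisePart, driftPart, hX.init]
  | succ k ih =>
    simp only [noisePart, driftPart]
    rw [hX.step_eq (by omega), neg_smul]
    nth_rewrite 1 [ih]
    rw [act_add]
    abel

omit [IsProbabilityMeasure P] in
lemma sqInt_noisePart (hnoise : NoiseAssumption P p.γ e X) (k : ℕ) :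
    SqInt P (noisePart p W e k) := by
  induction k with
  | zero => exact fun i => MemLp.zero
  | succ k ih => exact (ih.act _).add ((sqInt_noise hnoise (by omega)).smul _)

omit [MeasurableSpace Ω] in
lemma measurable_noisePart (hp : p.Valid) (hX : IsDimix p f W e X)
    (hf : ∀ i x y, ‖gradient (f i) x - gradient (f i) y‖ ≤ p.L * ‖x - y‖) {k t : ℕ} (hkt : k < t) :
    Measurable[pastSigma X t] (noisePart p W e k) := by
  induction k with
  | zero => exact measurable_const
  | succ k ih =>
    exact (measurable_act _ (ih (by omega))).add
      ((measurable_noise_pastSigma hp hX hf (by omega) hkt).const_smul (p.beta (k + 1)))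

/-- The noise contribution to the expected dispersion. -/
theorem integral_disp_noisePart_le (hn : 2 ≤ n) (hp : p.Valid) (hW : ConnectivityAssumption p W)
    (hX : IsDimix p f W e X) (hnoise : NoiseAssumption P p.γ e X)
    (hf : ∀ i x y, ‖gradient (f i) x - gradient (f i) y‖ ≤ p.L * ‖x - y‖) {K k : ℕ} (hk : k ≤ K) :
    ∫ ω, disp p.r (act (transMat p W (k + 1) (K - k)) (noisePart p W e k ω)) ∂P ≤
      p.kappa * p.γ * ∑ s ∈ Finset.Ico 1 (k + 1), p.beta s ^ 2 *
        ∏ l ∈ Finset.Ico (s + 1) (K + 1), (1 - p.lam * p.beta l) := by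
  -- The final time K + 1 is fixed and k counts the noise terms already injected, so the older noise
  -- Z, propagated to the end, is known before the new noise arrives.
  induction k with
  | zero =>
    simp [noisePart, act_zero, disp, rNormSq, rMean]
  | succ k ih =>
    have ih := ih (by omega)
    set Φ := transMat p W (k + 1 + 1) (K - (k + 1)) with hΦ
    have hΦ' : transMat p W (k + 1) (K - k) = Φ * mixMat p W (k + 1) := by
      rw [show K - k = (K - (k + 1)) + 1 by omega, transMat_succ_left]
    set Z : Ω → Config n d := fun ω =>
      act (transMat p W (k + 1) (K - k)) (noisePart p W e k ω) with hZ
    have hsplit : ∀ ω, act Φ (noisePart p W e (k + 1) ω) =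
        Z ω + p.beta (k + 1) • act Φ (e (k + 1) ω) := fun ω => by
      simp only [noisePart, hZ]
      rw [act_add, act_smul, hΦ', act_mul]
    have hZ2 : SqInt P Z := (sqInt_noisePart hnoise k).act _
    have he2 : SqInt P (e (k + 1)) := sqInt_noise hnoise (by omega)
    have hZm : Measurable[pastSigma X (k + 1)] Z :=
      measurable_act _ (measurable_noisePart hp hX hf (by omega))
    have hcross : ∀ i, ∫ ω, inner ℝ (Z ω i - rMean p.r (Z ω))
        ((p.beta (k + 1) • act Φ (e (k + 1) ω)) i) ∂P = 0 := fun i => by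
      simp only [Pi.smul_apply, act, real_inner_smul_right, inner_sum]
      rw [integral_const_mul, integral_finsetSum]
      · refine mul_eq_zero_of_right _ (Finset.sum_eq_zero fun j _ => ?_)
        have h0 : ∫ ω, inner ℝ (Z ω i - rMean p.r (Z ω)) (e (k + 1) ω j) ∂P = 0 :=
          integral_inner_noise_eq_zero hX hnoise hf (by omega)
            (((measurable_pi_apply i).comp hZm).sub (measurable_rMean _ hZm)) (hZ2.dev p.r i) j
        rw [integral_const_mul, h0, mul_zero]
      · exact fun j _ => (integrable_inner_of_memLp (hZ2.dev p.r i) (he2 j)).const_mul _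
    have hI1 : Integrable (fun ω => disp p.r (Z ω)) P := hZ2.integrable_disp _
    have hI2 : Integrable (fun ω => disp p.r (p.beta (k + 1) • act Φ (e (k + 1) ω))) P :=
      ((he2.act Φ).smul _).integrable_disp _
    have hI3 : ∀ i, Integrable (fun ω => p.r i * inner ℝ (Z ω i - rMean p.r (Z ω))
        ((p.beta (k + 1) • act Φ (e (k + 1) ω)) i)) P := fun i =>
      (integrable_inner_of_memLp (hZ2.dev p.r i) (((he2.act Φ).smul _) i)).const_mul _
    have hsum : ∫ ω, disp p.r (act Φ (noisePart p W e (k + 1) ω)) ∂P =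
        ∫ ω, disp p.r (Z ω) ∂P +
          ∫ ω, disp p.r (p.beta (k + 1) • act Φ (e (k + 1) ω)) ∂P := by
      simp_rw [hsplit, disp_add hp.r_sum]
      have hI12 : Integrable (fun ω => disp p.r (Z ω) +
          disp p.r (p.beta (k + 1) • act Φ (e (k + 1) ω))) P := hI1.add hI2
      rw [integral_add hI12 ((integrable_finsetSum _ fun i _ => hI3 i).const_mul 2),
        integral_add hI1 hI2, integral_const_mul, integral_finsetSum _ fun i _ => hI3 i]
      simp_rw [integral_const_mul, hcross]
      simp
    have hprod : 0 ≤ ∏ l ∈ Finset.Ico (k + 1 + 1) (K + 1), (1 - p.lam * p.beta l) :=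
      Finset.prod_nonneg fun l hl => by
        rw [Finset.mem_Ico] at hl
        linarith [lam_beta_lt_one hn hp hW (show 1 ≤ l by omega)]
    have hnew : ∫ ω, disp p.r (p.beta (k + 1) • act Φ (e (k + 1) ω)) ∂P ≤
        p.kappa * p.γ * (p.beta (k + 1) ^ 2 *
          ∏ l ∈ Finset.Ico (k + 1 + 1) (K + 1), (1 - p.lam * p.beta l)) := by
      simp_rw [disp_smul]
      rw [integral_const_mul]
      have hκ := kappa_pos hn hp hW
      have h1 : ∫ ω, disp p.r (act Φ (e (k + 1) ω)) ∂P ≤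
          p.kappa * (∏ l ∈ Finset.Ico (k + 1 + 1) (K + 1), (1 - p.lam * p.beta l)) *
            ∫ ω, rNormSq p.r (e (k + 1) ω) ∂P := by
        rw [← integral_const_mul]
        refine integral_mono ((he2.act Φ).integrable_disp _)
          ((he2.integrable_rNormSq _).const_mul _) fun ω => ?_
        have h2 := disp_transMat_le hn hp hW (s := k + 1) (by omega) (K - (k + 1)) (e (k + 1) ω)
        rw [show k + 1 + 1 + (K - (k + 1)) = K + 1 by omega] at h2
        exact h2.trans (mul_le_mul_of_nonneg_left (disp_le_rNormSq hp.r_sum _)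
          (mul_nonneg hκ.le hprod))
      have h3 := integral_rNormSq_noise_le hp hX hnoise hf (show 1 ≤ k + 1 by omega)
      calc _ ≤ p.beta (k + 1) ^ 2 * (p.kappa *
            (∏ l ∈ Finset.Ico (k + 1 + 1) (K + 1), (1 - p.lam * p.beta l)) * p.γ) := by
            refine mul_le_mul_of_nonneg_left (h1.trans ?_) (sq_nonneg _)
            exact mul_le_mul_of_nonneg_left h3 (mul_nonneg hκ.le hprod)
        _ = _ := by ring
    rw [hsum, Finset.sum_Ico_succ_top (by omega), mul_add]
    exact add_le_add ih hnew

omit [MeasurableSpace Ω] in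
/-- The gradient contribution to the dispersion. -/
theorem sqrt_disp_driftPart_le (hn : 2 ≤ n) (hp : p.Valid) (hW : ConnectivityAssumption p W)
    {ω : Ω} (hb : ∀ t, 1 ≤ t → ∀ i, ‖gradient (f i) (X t ω i)‖ ^ 2 ≤ p.K) {K k : ℕ}
    (hk : k ≤ K) :
    √(disp p.r (act (transMat p W (k + 1) (K - k)) (driftPart p f W X k ω))) ≤
      √(p.kappa * p.K) * ∑ s ∈ Finset.Ico 1 (k + 1), p.alpha s * p.beta s *
        ∏ l ∈ Finset.Ico (s + 1) (K + 1), (1 - p.lam / 2 * p.beta l) := by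
  have hκ := kappa_pos hn hp hW
  induction k with
  | zero => simp [driftPart, act_zero, disp, rNormSq, rMean]
  | succ k ih =>
    have ih := ih (by omega)
    set Φ := transMat p W (k + 1 + 1) (K - (k + 1)) with hΦ
    have hΦ' : transMat p W (k + 1) (K - k) = Φ * mixMat p W (k + 1) := by
      rw [show K - k = (K - (k + 1)) + 1 by omega, transMat_succ_left]
    set G := gradConfig f (X (k + 1) ω) with hG
    have hab : 0 ≤ p.alpha (k + 1) * p.beta (k + 1) :=
      (mul_pos (hp.alpha_pos (by omega)) (hp.beta_pos (by omega))).le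
    have hP : 0 ≤ ∏ l ∈ Finset.Ico (k + 1 + 1) (K + 1), (1 - p.lam / 2 * p.beta l) :=
      Finset.prod_nonneg fun l hl => by
        rw [Finset.mem_Ico] at hl
        linarith [lam_beta_lt_one hn hp hW (show 1 ≤ l by omega)]
    -- Taking square roots of the contraction factors costs half the rate, through 1 - x ≤ (1 -
    -- x/2)².
    have hPP : ∏ l ∈ Finset.Ico (k + 1 + 1) (K + 1), (1 - p.lam * p.beta l) ≤
        (∏ l ∈ Finset.Ico (k + 1 + 1) (K + 1), (1 - p.lam / 2 * p.beta l)) ^ 2 := by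
      rw [← Finset.prod_pow]
      refine Finset.prod_le_prod (fun l hl => ?_) fun l hl => ?_
      · rw [Finset.mem_Ico] at hl
        linarith [lam_beta_lt_one hn hp hW (show 1 ≤ l by omega)]
      · nlinarith [sq_nonneg (p.lam / 2 * p.beta l)]
    have hGK : disp p.r G ≤ p.K := by
      refine (disp_le_rNormSq hp.r_sum _).trans ?_
      rw [rNormSq, ← one_mul p.K, ← hp.r_sum, Finset.sum_mul]
      exact Finset.sum_le_sum fun i _ =>
        mul_le_mul_of_nonneg_left (hb (k + 1) (by omega) i) (hp.r_pos i).le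
    have hΦG : √(disp p.r (act Φ G)) ≤ √(p.kappa * p.K) *
        ∏ l ∈ Finset.Ico (k + 1 + 1) (K + 1), (1 - p.lam / 2 * p.beta l) := by
      refine Real.sqrt_le_iff.2 ⟨mul_nonneg (Real.sqrt_nonneg _) hP, ?_⟩
      rw [mul_pow, Real.sq_sqrt (mul_nonneg hκ.le hp.K_pos.le)]
      have h2 := disp_transMat_le hn hp hW (s := k + 1) (by omega) (K - (k + 1)) G
      rw [show k + 1 + 1 + (K - (k + 1)) = K + 1 by omega] at h2
      refine h2.trans ?_
      calc _ ≤ p.kappa * (∏ l ∈ Finset.Ico (k + 1 + 1) (K + 1), (1 - p.lam / 2 * p.beta l)) ^ 2 *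
            p.K := by
            refine mul_le_mul (mul_le_mul_of_nonneg_left hPP hκ.le) hGK
              (disp_nonneg (fun i => (hp.r_pos i).le) _) ?_
            exact mul_nonneg hκ.le (sq_nonneg _)
        _ = _ := by ring
    have hnew : √(disp p.r ((-(p.alpha (k + 1) * p.beta (k + 1))) • act Φ G)) =
        p.alpha (k + 1) * p.beta (k + 1) * √(disp p.r (act Φ G)) := by
      rw [disp_smul, neg_sq, Real.sqrt_mul (sq_nonneg _), Real.sqrt_sq hab]
    have hsplit : act Φ (driftPart p f W X (k + 1) ω) =
        act (transMat p W (k + 1) (K - k)) (driftPart p f W X k ω) +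
        (-(p.alpha (k + 1) * p.beta (k + 1))) • act Φ G := by
      rw [driftPart, act_add, act_smul, hΦ', act_mul]
    rw [hsplit, Finset.sum_Ico_succ_top (by omega), mul_add]
    refine (sqrt_disp_add_le (fun i => (hp.r_pos i).le) _ _).trans (add_le_add ih ?_)
    rw [hnew]
    calc _ ≤ p.alpha (k + 1) * p.beta (k + 1) * (√(p.kappa * p.K) *
          ∏ l ∈ Finset.Ico (k + 1 + 1) (K + 1), (1 - p.lam / 2 * p.beta l)) :=
          mul_le_mul_of_nonneg_left hΦG hab
      _ = _ := by ring

end Dynamics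

/-! ### The two error bounds -/

/-- Turns the thresholds T₁, T₂, T₃, T₄ into the power inequalities used in the weighted-sum bounds
and the step-size condition. -/
lemma le_rpow_of_ceil_le {x q : ℝ} (hx : 0 ≤ x) (hq : 0 < q) {T : ℕ} (hT : ⌈x ^ (1 / q)⌉₊ ≤ T) :
    x ≤ (T : ℝ) ^ q := by
  have h := Real.rpow_le_rpow (Real.rpow_nonneg hx _) (Nat.ceil_le.1 hT) hq.le
  rwa [← Real.rpow_mul hx, one_div_mul_cancel hq.ne', Real.rpow_one] at h

namespace Params.Valid

variable {n : ℕ} {p : Params n}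

lemma one_le_T₀ (hp : p.Valid) : 1 ≤ p.T₀ := by
  refine le_trans ?_ (le_max_left _ _)
  have h1 := hp.lam_pos
  have h2 := hp.β₀_pos
  have h3 := hp.μ_pos
  exact Nat.one_le_ceil_iff.2 (by positivity)

lemma _root_.Params.alpha_mul_beta (p : Params n) {t : ℕ} (ht : 1 ≤ t) :
    p.alpha t * p.beta t = p.α₀ * p.β₀ / (t : ℝ) ^ (p.μ + p.ν) := by
  have : (0 : ℝ) < t := by exact_mod_cast ht
  rw [Params.alpha, Params.beta, Real.rpow_add this, div_mul_div_comm, mul_comm ((t : ℝ) ^ p.ν)]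

lemma alpha_mul_beta_le (hp : p.Valid) {t : ℕ} (ht : p.T₀ ≤ t) :
    p.alpha t * p.beta t * (p.m + p.L) ≤ 2 := by
  have ht1 := hp.one_le_T₀.trans ht
  have ht0 : (0 : ℝ) < t := by exact_mod_cast ht1
  have hα := hp.α₀_pos
  have hβ := hp.β₀_pos
  have hm := hp.m_pos
  have hL := hp.L_pos
  have h3 : p.T₃ ≤ t := (le_max_right _ _).trans ((le_max_right _ _).trans ht)
  have h := le_rpow_of_ceil_le (by positivity) (add_pos hp.μ_pos hp.ν_pos) h3
  rw [p.alpha_mul_beta ht1, div_mul_eq_mul_div, div_le_iff₀ (by positivity)]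
  linarith

lemma c₂_pos (hp : p.Valid) : 0 < p.c₂ :=
  div_pos (mul_pos hp.m_pos hp.L_pos) (add_pos hp.m_pos hp.L_pos)

/-- From 4mL ≤ (m + L)², that is 4c₂ ≤ m + L, and αβ(m + L) ≤ 2. -/
lemma two_mul_c₂_mul_le (hp : p.Valid) {t : ℕ} (ht : p.T₀ ≤ t) :
    2 * (p.c₂ * (p.alpha t * p.beta t)) ≤ 1 := by
  have h := hp.alpha_mul_beta_le ht
  have hmL : 0 < p.m + p.L := add_pos hp.m_pos hp.L_pos
  have h1 : p.c₂ * (p.m + p.L) = p.m * p.L := by rw [Params.c₂]; field_simp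
  have h2 : 4 * p.c₂ ≤ p.m + p.L := by
    have : 4 * (p.c₂ * (p.m + p.L)) ≤ (p.m + p.L) * (p.m + p.L) := by
      rw [h1]; nlinarith [sq_nonneg (p.m - p.L)]
    rw [← mul_assoc] at this
    exact le_of_mul_le_mul_right this hmL
  have h3 : 0 ≤ p.alpha t * p.beta t :=
    (mul_pos (hp.alpha_pos (hp.one_le_T₀.trans ht)) (hp.beta_pos (hp.one_le_T₀.trans ht))).le
  nlinarith

end Params.Valid

section Bounds

variable {n d : ℕ} {Ω : Type*} [MeasurableSpace Ω] {P : Measure Ω} [IsProbabilityMeasure P]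
  {p : Params n} {f : Fin n → EuclideanSpace ℝ (Fin d) → ℝ}
  {W : ℕ → Matrix (Fin n) (Fin n) ℝ} {e X : ℕ → Ω → Config n d}

/-- The expected dispersion in terms of weighted sums. -/
theorem integral_disp_state_le (hn : 2 ≤ n) (hp : p.Valid) (hW : ConnectivityAssumption p W)
    (hX : IsDimix p f W e X) (hnoise : NoiseAssumption P p.γ e X)
    (hf : FunctionAssumption P p f X) {T : ℕ} (hT : 1 ≤ T) :
    ∫ ω, disp p.r (X T ω) ∂P ≤
      2 * p.γ * p.kappa * p.β₀ ^ 2 * weightedSum (p.lam * p.β₀) (2 * p.μ) p.μ 1 T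
        + 4 * p.K * p.kappa * p.α₀ ^ 2 * p.β₀ / p.lam *
          weightedSum (p.lam * p.β₀ / 2) (2 * p.ν + p.μ) p.μ 1 T := by
  obtain ⟨K, rfl⟩ : ∃ K, T = K + 1 := ⟨T - 1, by omega⟩
  have hr := fun i => (hp.r_pos i).le
  have hlam := hp.lam_pos
  have hκ := kappa_pos hn hp hW
  have hN : SqInt P (noisePart p W e K) := sqInt_noisePart hnoise K
  have hb : ∀ᵐ ω ∂P, ∀ t, 1 ≤ t → ∀ i, ‖gradient (f i) (X t ω i)‖ ^ 2 ≤ p.K := by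
    refine ae_all_iff.2 fun t => ?_
    by_cases ht : 1 ≤ t
    · filter_upwards [ae_all_iff.2 fun i => hf.bounded t ht i] with ω hω _ using hω
    · exact Filter.Eventually.of_forall fun ω h => absurd h ht
  set A := weightedSum (p.lam * p.β₀) (2 * p.μ) p.μ 1 (K + 1) with hA
  set D := weightedSum (p.lam * p.β₀ / 2) (2 * p.ν + p.μ) p.μ 1 (K + 1) with hD
  have hpos : ∀ s ∈ Finset.Ico 1 (K + 1), (0 : ℝ) < s := fun s hs => by
    rw [Finset.mem_Ico] at hs
    exact_mod_cast hs.1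
  have hAeq : ∑ s ∈ Finset.Ico 1 (K + 1), p.beta s ^ 2 *
      ∏ l ∈ Finset.Ico (s + 1) (K + 1), (1 - p.lam * p.beta l) = p.β₀ ^ 2 * A := by
    rw [hA, weightedSum, Finset.mul_sum]
    refine Finset.sum_congr rfl fun s hs => ?_
    simp only [Params.beta, mul_div_assoc, div_pow]
    rw [two_mul, Real.rpow_add (hpos s hs)]
    ring
  have hDeq : ∑ s ∈ Finset.Ico 1 (K + 1), p.alpha s ^ 2 * p.beta s *
      ∏ l ∈ Finset.Ico (s + 1) (K + 1), (1 - p.lam / 2 * p.beta l) = p.α₀ ^ 2 * p.β₀ * D := by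
    rw [hD, weightedSum, Finset.mul_sum]
    refine Finset.sum_congr rfl fun s hs => ?_
    have h1 : ∀ l : ℕ, p.lam / 2 * p.beta l = p.lam * p.β₀ / 2 / (l : ℝ) ^ p.μ := fun l => by
      rw [Params.beta]; ring
    simp only [h1]
    rw [Params.alpha, Params.beta, Real.rpow_add (hpos s hs), two_mul, Real.rpow_add (hpos s hs)]
    ring
  have hnoiseBound : ∫ ω, disp p.r (noisePart p W e K ω) ∂P ≤ p.kappa * p.γ * (p.β₀ ^ 2 * A) := by
    have h := integral_disp_noisePart_le hn hp hW hX hnoise hf.smooth (le_refl K)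
    simp only [Nat.sub_self, transMat, act_one] at h
    rwa [hAeq] at h
  have hdrift : ∀ᵐ ω ∂P, disp p.r (driftPart p f W X K ω) ≤
      2 * p.kappa * p.K / p.lam * (p.α₀ ^ 2 * p.β₀ * D) := by
    filter_upwards [hb] with ω hω
    have h := sqrt_disp_driftPart_le hn hp hW hω (le_refl K)
    simp only [Nat.sub_self, transMat, act_one] at h
    have h2 := pow_le_pow_left₀ (Real.sqrt_nonneg _) h 2
    rw [Real.sq_sqrt (disp_nonneg hr _), mul_pow,
      Real.sq_sqrt (mul_nonneg hκ.le hp.K_pos.le)] at h2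
    have hprod : ∀ s ∈ Finset.Ico 1 (K + 1),
        0 ≤ ∏ l ∈ Finset.Ico (s + 1) (K + 1), (1 - p.lam / 2 * p.beta l) := fun s hs =>
      Finset.prod_nonneg fun l hl => by
        rw [Finset.mem_Ico] at hl
        have := lam_beta_lt_one hn hp hW (show 1 ≤ l by omega)
        linarith
    have hβ : ∀ s ∈ Finset.Ico 1 (K + 1), 0 ≤ p.beta s := fun s hs =>
      (hp.beta_pos (Finset.mem_Ico.1 hs).1).le
    -- Cauchy–Schwarz with weights w = β∏: (∑ αw)² ≤ (∑ α²w)(∑ w). The last factor telescopes to at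
    -- most 2/λ.
    have hcs := Finset.sum_sq_le_sum_mul_sum_of_sq_le_mul (Finset.Ico 1 (K + 1))
      (r := fun s => p.alpha s * p.beta s *
        ∏ l ∈ Finset.Ico (s + 1) (K + 1), (1 - p.lam / 2 * p.beta l))
      (f := fun s => p.alpha s ^ 2 * p.beta s *
        ∏ l ∈ Finset.Ico (s + 1) (K + 1), (1 - p.lam / 2 * p.beta l))
      (g := fun s => p.beta s *
        ∏ l ∈ Finset.Ico (s + 1) (K + 1), (1 - p.lam / 2 * p.beta l))
      (fun s hs => mul_nonneg (mul_nonneg (sq_nonneg _) (hβ s hs)) (hprod s hs))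
      (fun s hs => mul_nonneg (hβ s hs) (hprod s hs)) (fun s _ => le_of_eq (by ring))
    rw [hDeq] at hcs
    have hD0 : 0 ≤ p.α₀ ^ 2 * p.β₀ * D := by
      rw [← hDeq]
      exact Finset.sum_nonneg fun s hs =>
        mul_nonneg (mul_nonneg (sq_nonneg _) (hβ s hs)) (hprod s hs)
    have htel : ∑ s ∈ Finset.Ico 1 (K + 1), p.beta s *
        ∏ l ∈ Finset.Ico (s + 1) (K + 1), (1 - p.lam / 2 * p.beta l) ≤ 2 / p.lam := by
      have h3 := sum_mul_prod_one_sub_le_one (ρ := fun s => p.lam / 2 * p.beta s) (s₀ := 1)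
        (T := K + 1) (fun t ht => by linarith [lam_beta_lt_one hn hp hW ht]) (by omega)
      simp_rw [mul_assoc (p.lam / 2)] at h3
      rw [← Finset.mul_sum] at h3
      rw [le_div_iff₀ hlam]
      linarith
    refine h2.trans ((mul_le_mul_of_nonneg_left (hcs.trans (mul_le_mul_of_nonneg_left htel hD0))
      (mul_nonneg hκ.le hp.K_pos.le)).trans (le_of_eq ?_))
    field_simp
  have hall : ∀ᵐ ω ∂P, disp p.r (X (K + 1) ω) ≤ 2 * disp p.r (noisePart p W e K ω) +
      2 * (2 * p.kappa * p.K / p.lam * (p.α₀ ^ 2 * p.β₀ * D)) := by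
    filter_upwards [hdrift] with ω hω
    rw [state_eq_noisePart_add_driftPart hX K ω]
    linarith [disp_add_le hr (noisePart p W e K ω) (driftPart p f W X K ω)]
  have hint := ((hN.integrable_disp p.r).const_mul 2)
  have h := integral_mono_ae ((sqInt_state hX hnoise hf.smooth hT).integrable_disp p.r)
    (hint.add (integrable_const _)) hall
  refine h.trans ?_
  simp only [Pi.add_apply]
  rw [integral_add hint (integrable_const _), integral_const_mul, integral_const, probReal_univ,
    one_smul]
  have e1 : 2 * p.γ * p.kappa * p.β₀ ^ 2 * A = 2 * (p.kappa * p.γ * (p.β₀ ^ 2 * A)) := by ring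
  have e2 : 4 * p.K * p.kappa * p.α₀ ^ 2 * p.β₀ / p.lam * D =
      2 * (2 * p.kappa * p.K / p.lam * (p.α₀ ^ 2 * p.β₀ * D)) := by ring
  rw [e1, e2]
  linarith

omit [MeasurableSpace Ω] in
lemma ξ₁_nonneg (hn : 2 ≤ n) (hp : p.Valid) (hW : ConnectivityAssumption p W) : 0 ≤ p.ξ₁ := by
  have h1 := hp.lam_pos
  have h2 := hp.β₀_pos
  have h3 := kappa_pos hn hp hW
  have h4 := hp.γ_pos
  have h5 := hp.K_pos
  have h6 := Aconst_nonneg_of_lt (b := p.lam * p.β₀) (σ := 2 * p.μ) (by positivity) hp.μ_lt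
  have h7 := Aconst_nonneg_of_lt (b := p.lam * p.β₀ / 2) (σ := 2 * p.ν + p.μ) (by positivity)
    hp.μ_lt
  rw [Params.ξ₁]
  positivity

/-- The expected dispersion decays like `T^{-min(μ, 2ν)}`. -/
theorem integral_disp_state_le_rpow (hn : 2 ≤ n) (hp : p.Valid) (hW : ConnectivityAssumption p W)
    (hX : IsDimix p f W e X) (hnoise : NoiseAssumption P p.γ e X)
    (hf : FunctionAssumption P p f X) {T : ℕ} (hT : p.T₀ ≤ T) :
    ∫ ω, disp p.r (X T ω) ∂P ≤ p.ξ₁ * (T : ℝ) ^ (-min p.μ (2 * p.ν)) := by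
  have hT1 := hp.one_le_T₀.trans hT
  have hT1' : (1 : ℝ) ≤ T := by exact_mod_cast hT1
  have hlam := hp.lam_pos
  have hβ := hp.β₀_pos
  have hμ := hp.μ_pos
  have hν := hp.ν_pos
  have hκ := kappa_pos hn hp hW
  have hγ := hp.γ_pos
  have hK := hp.K_pos
  have h1μ : 0 < 1 - p.μ := by linarith [hp.μ_lt]
  have hT₁ : 2 * p.μ / (p.lam * p.β₀) ≤ (T : ℝ) ^ (1 - p.μ) :=
    le_rpow_of_ceil_le (by positivity) h1μ ((le_max_left _ _).trans hT)
  have hT₂ : 8 * p.ν / (p.lam * p.β₀) ≤ (T : ℝ) ^ (1 - p.μ) :=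
    le_rpow_of_ceil_le (by positivity) h1μ
      ((le_max_left _ _).trans ((le_max_right _ _).trans hT))
  have hlt : ∀ k : ℕ, 1 ≤ k → p.lam * p.β₀ / (k : ℝ) ^ p.μ < 1 := fun k hk => by
    have := lam_beta_lt_one hn hp hW hk
    rwa [Params.beta, ← mul_div_assoc] at this
  have hA := weightedSum_le_of_lt_one (b := p.lam * p.β₀) (σ := 2 * p.μ) (δ := p.μ) (s₀ := 1)
    (T := T) (by positivity) (by positivity) hμ.le hp.μ_lt le_rfl hT1
    (fun k hk => by linarith [hlt k hk]) (by
      refine le_trans (le_of_eq ?_) hT₁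
      ring)
  have hD := weightedSum_le_of_lt_one (b := p.lam * p.β₀ / 2) (σ := 2 * p.ν + p.μ) (δ := p.μ)
    (s₀ := 1) (T := T) (by positivity) (by positivity) hμ.le hp.μ_lt le_rfl hT1
    (fun k hk => by
      have h1 := hlt k hk
      rw [div_right_comm]
      linarith [div_nonneg (mul_pos hlam hβ).le (Real.rpow_nonneg (Nat.cast_nonneg k) p.μ)])
    (by
      refine le_trans (le_of_eq ?_) hT₂
      field_simp
      ring)
  have hA0 := Aconst_nonneg_of_lt (b := p.lam * p.β₀) (σ := 2 * p.μ) (by positivity) hp.μ_lt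
  have hD0 := Aconst_nonneg_of_lt (b := p.lam * p.β₀ / 2) (σ := 2 * p.ν + p.μ) (by positivity)
    hp.μ_lt
  set R := (T : ℝ) ^ (-min p.μ (2 * p.ν)) with hR
  have hR0 : 0 ≤ R := by positivity
  -- The constants in `ξ₁` are twice those of `integral_disp_state_le`, so a factor 2 is given away
  -- here.
  have hA' : weightedSum (p.lam * p.β₀) (2 * p.μ) p.μ 1 T ≤
      2 * (Aconst (p.lam * p.β₀) (2 * p.μ) p.μ * R) := by
    have h1 := mul_le_mul_of_nonneg_left (Real.rpow_le_rpow_of_exponent_le hT1'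
      (by linarith [min_le_left p.μ (2 * p.ν)] :
        -(2 * p.μ - p.μ) ≤ -min p.μ (2 * p.ν))) hA0
    linarith [mul_nonneg hA0 hR0]
  have hD' : weightedSum (p.lam * p.β₀ / 2) (2 * p.ν + p.μ) p.μ 1 T ≤
      2 * (Aconst (p.lam * p.β₀ / 2) (2 * p.ν + p.μ) p.μ * R) := by
    have h1 := mul_le_mul_of_nonneg_left (Real.rpow_le_rpow_of_exponent_le hT1'
      (by linarith [min_le_right p.μ (2 * p.ν)] :
        -(2 * p.ν + p.μ - p.μ) ≤ -min p.μ (2 * p.ν))) hD0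
    linarith [mul_nonneg hD0 hR0]
  refine (integral_disp_state_le hn hp hW hX hnoise hf hT1).trans ?_
  refine (add_le_add (mul_le_mul_of_nonneg_left hA' (by positivity))
    (mul_le_mul_of_nonneg_left hD' (by positivity))).trans (le_of_eq ?_)
  rw [Params.ξ₁]
  ring

/-- One step of the recursion for the gap of the averaged state. -/
theorem meanGap_succ_le (hn : 2 ≤ n) (hp : p.Valid) (hW : ConnectivityAssumption p W)
    (hX : IsDimix p f W e X) (hnoise : NoiseAssumption P p.γ e X)
    (hf : FunctionAssumption P p f X) {xs : EuclideanSpace ℝ (Fin d)}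
    (hxs : ∀ x, ∑ i, p.r i * f i xs ≤ ∑ i, p.r i * f i x) {ρ : ℝ} (hρ0 : 0 ≤ ρ) (hρ : ρ < 2)
    {t : ℕ} (ht : p.T₀ ≤ t) :
    meanGap P p X xs (t + 1) ≤
      (1 - ρ * (p.c₂ * (p.α₀ * p.β₀)) / (t : ℝ) ^ (p.μ + p.ν)) * meanGap P p X xs t +
        (p.α₀ * p.β₀ * (p.L ^ 2 / ((2 - ρ) * p.c₂)) * p.ξ₁ + p.γ * p.β₀ ^ 2) *
          (1 / (t : ℝ) ^ p.σ₀) := by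
  have ht1 := hp.one_le_T₀.trans ht
  have ht1' : (1 : ℝ) ≤ t := by exact_mod_cast ht1
  have ht0 : (0 : ℝ) < t := by linarith
  have hα := hp.α₀_pos
  have hβ := hp.β₀_pos
  have hc := hp.c₂_pos
  have hs := mul_pos (hp.alpha_pos ht1) (hp.beta_pos ht1)
  have h2ρ : 0 < 2 - ρ := by linarith
  have hX2 := sqInt_state hX hnoise hf.smooth ht1
  have he2 := sqInt_noise hnoise ht1
  set s := p.alpha t * p.beta t with hsdef
  set u : Ω → EuclideanSpace ℝ (Fin d) := fun ω =>
    rMean p.r (X t ω) - s • meanGrad p.r f (X t ω) - xs with hu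
  set v : Ω → EuclideanSpace ℝ (Fin d) := fun ω => p.beta t • rMean p.r (e t ω) with hv
  have hG2 : SqInt P (fun ω => gradConfig f (X t ω)) := sqInt_gradConfig hf.smooth hX2
  have hu2 : MemLp u 2 P :=
    ((hX2.rMean p.r).sub ((hG2.rMean p.r).const_smul s)).sub (memLp_const xs)
  have hv2 : MemLp v 2 P := (he2.rMean p.r).const_smul (p.beta t)
  have hum : Measurable[pastSigma X t] u := by
    have h1 := measurable_pastSigma (X := X) ht1 le_rfl
    exact ((measurable_rMean p.r h1).sub
      ((measurable_rMean p.r (measurable_gradConfig hf.smooth h1)).const_smul s)).sub_const xs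
  have hsplit : ∀ ω, rMean p.r (X (t + 1) ω) - xs = u ω + v ω := fun ω => by
    have hm : rMean p.r (gradConfig f (X t ω)) = meanGrad p.r f (X t ω) := rfl
    rw [hX.step_eq ht1, sub_eq_add_neg _ (_ • gradConfig _ _), ← neg_smul, rMean_add, rMean_add,
      rMean_smul, rMean_smul, rMean_act_mixMat hW ht1, hm, neg_smul, hu, hv]
    simp only
    abel
  have hcross : ∫ ω, inner ℝ (u ω) (v ω) ∂P = 0 := by
    simp only [hv, real_inner_smul_right, rMean, inner_sum]
    rw [integral_const_mul, integral_finsetSum]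
    · refine mul_eq_zero_of_right _ (Finset.sum_eq_zero fun i _ => ?_)
      rw [integral_const_mul, integral_inner_noise_eq_zero hX hnoise hf.smooth ht1 hum hu2 i,
        mul_zero]
    · exact fun i _ => (integrable_inner_of_memLp hu2 (he2 i)).const_mul _
  have hIu := hu2.integrable_norm_pow two_ne_zero
  have hIv := hv2.integrable_norm_pow two_ne_zero
  have hIuv := integrable_inner_of_memLp hu2 hv2
  have hexp : meanGap P p X xs (t + 1) = ∫ ω, ‖u ω‖ ^ 2 ∂P + ∫ ω, ‖v ω‖ ^ 2 ∂P := by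
    rw [meanGap]
    simp_rw [hsplit, norm_add_sq_real]
    have hI : Integrable (fun ω => ‖u ω‖ ^ 2 + 2 * inner ℝ (u ω) (v ω)) P :=
      hIu.add (hIuv.const_mul 2)
    rw [integral_add hI hIv, integral_add hIu (hIuv.const_mul 2), integral_const_mul, hcross]
    ring
  have hvle : ∫ ω, ‖v ω‖ ^ 2 ∂P ≤ p.beta t ^ 2 * p.γ := by
    have h1 : ∫ ω, ‖v ω‖ ^ 2 ∂P ≤ ∫ ω, p.beta t ^ 2 * rNormSq p.r (e t ω) ∂P := by
      refine integral_mono hIv ((he2.integrable_rNormSq p.r).const_mul _) fun ω => ?_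
      simp only [hv, norm_smul, mul_pow, Real.norm_eq_abs, sq_abs]
      exact mul_le_mul_of_nonneg_left (norm_rMean_sq_le (fun i => (hp.r_pos i).le) hp.r_sum _)
        (sq_nonneg _)
    rw [integral_const_mul] at h1
    exact h1.trans (mul_le_mul_of_nonneg_left
      (integral_rNormSq_noise_le hp hX hnoise hf.smooth ht1) (sq_nonneg _))
  set M := p.L ^ 2 / ((2 - ρ) * p.c₂) with hM
  have hM0 : 0 ≤ M := by positivity
  have hIgap : Integrable (fun ω => ‖rMean p.r (X t ω) - xs‖ ^ 2) P :=
    ((hX2.rMean p.r).sub (memLp_const xs)).integrable_norm_pow two_ne_zero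
  have hule : ∫ ω, ‖u ω‖ ^ 2 ∂P ≤
      (1 - ρ * (p.c₂ * s)) * meanGap P p X xs t + s * M * ∫ ω, disp p.r (X t ω) ∂P := by
    rw [meanGap, ← integral_const_mul, ← integral_const_mul,
      ← integral_add (hIgap.const_mul _) ((hX2.integrable_disp p.r).const_mul _)]
    exact integral_mono hIu ((hIgap.const_mul _).add ((hX2.integrable_disp p.r).const_mul _))
      fun ω => mean_step_le hp hf.diff hf.smooth hf.strong hxs hs (hp.alpha_mul_beta_le ht)
        hρ0 hρ (X t ω)
  have hdisp := integral_disp_state_le_rpow hn hp hW hX hnoise hf ht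
  have hξ := ξ₁_nonneg hn hp hW
  have hs' : s = p.α₀ * p.β₀ / (t : ℝ) ^ (p.μ + p.ν) := p.alpha_mul_beta ht1
  -- The dispersion enters with exponent μ + ν + min(μ, 2ν) and the noise with 2μ. Both are at least
  -- σ₀.
  have hd1 : s * M * ∫ ω, disp p.r (X t ω) ∂P ≤
      p.α₀ * p.β₀ * M * p.ξ₁ * (1 / (t : ℝ) ^ p.σ₀) := by
    refine (mul_le_mul_of_nonneg_left hdisp (mul_nonneg hs.le hM0)).trans ?_
    have e1 : s * M * (p.ξ₁ * (t : ℝ) ^ (-min p.μ (2 * p.ν))) =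
        p.α₀ * p.β₀ * M * p.ξ₁ * (t : ℝ) ^ (-(p.μ + p.ν) + -min p.μ (2 * p.ν)) := by
      rw [hs', Real.rpow_add ht0 (-(p.μ + p.ν)), Real.rpow_neg ht0.le (p.μ + p.ν)]
      ring
    rw [e1, one_div, ← Real.rpow_neg ht0.le]
    refine mul_le_mul_of_nonneg_left (Real.rpow_le_rpow_of_exponent_le ht1' ?_) (by positivity)
    have h1 : p.σ₀ ≤ 2 * p.μ := min_le_left _ _
    have h2 : p.σ₀ ≤ 3 * p.ν + p.μ := min_le_right _ _
    have h3 := hp.ν_pos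
    rcases min_choice p.μ (2 * p.ν) with h | h <;> rw [h] <;> linarith
  have hd2 : p.beta t ^ 2 * p.γ ≤ p.γ * p.β₀ ^ 2 * (1 / (t : ℝ) ^ p.σ₀) := by
    have hγ := hp.γ_pos
    have e1 : p.beta t ^ 2 * p.γ = p.γ * p.β₀ ^ 2 * (1 / (t : ℝ) ^ (2 * p.μ)) := by
      rw [Params.beta, div_pow, two_mul, Real.rpow_add ht0]; ring
    rw [e1]
    have h1 : p.σ₀ ≤ 2 * p.μ := min_le_left _ _
    gcongr
  have e2 : ρ * (p.c₂ * s) = ρ * (p.c₂ * (p.α₀ * p.β₀)) / (t : ℝ) ^ (p.μ + p.ν) := by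
    rw [hs']; ring
  rw [hexp, ← e2, add_mul]
  linarith

/-- The gap of the averaged state in terms of a weighted sum. -/
theorem meanGap_le (hn : 2 ≤ n) (hp : p.Valid) (hW : ConnectivityAssumption p W)
    (hX : IsDimix p f W e X) (hnoise : NoiseAssumption P p.γ e X)
    (hf : FunctionAssumption P p f X) {xs : EuclideanSpace ℝ (Fin d)}
    (hxs : ∀ x, ∑ i, p.r i * f i xs ≤ ∑ i, p.r i * f i x) {ρ : ℝ} (hρ0 : 0 ≤ ρ) (hρ : ρ < 2)
    {T : ℕ} (hT : p.T₀ ≤ T) {ψ : ℝ → ℝ}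
    (hψ : ∀ u : ℝ, 0 < u → HasDerivAt ψ (u ^ (-(p.μ + p.ν))) u) :
    meanGap P p X xs T ≤
      Real.exp (ρ * (p.c₂ * (p.α₀ * p.β₀)) * (ψ p.T₀ - ψ T)) * meanGap P p X xs p.T₀ +
        (p.α₀ * p.β₀ * (p.L ^ 2 / ((2 - ρ) * p.c₂)) * p.ξ₁ + p.γ * p.β₀ ^ 2) *
          weightedSum (ρ * (p.c₂ * (p.α₀ * p.β₀))) p.σ₀ (p.μ + p.ν) p.T₀ T := by
  have ha : 0 < p.c₂ * (p.α₀ * p.β₀) := mul_pos hp.c₂_pos (mul_pos hp.α₀_pos hp.β₀_pos)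
  have hnn : ∀ k, p.T₀ ≤ k →
      0 ≤ 1 - ρ * (p.c₂ * (p.α₀ * p.β₀)) / (k : ℝ) ^ (p.μ + p.ν) := fun k hk => by
    have h := hp.two_mul_c₂_mul_le hk
    rw [p.alpha_mul_beta (hp.one_le_T₀.trans hk)] at h
    have h0 : 0 ≤ p.c₂ * (p.α₀ * p.β₀ / (k : ℝ) ^ (p.μ + p.ν)) :=
      mul_nonneg hp.c₂_pos.le (div_nonneg (mul_pos hp.α₀_pos hp.β₀_pos).le
        (Real.rpow_nonneg (Nat.cast_nonneg k) _))
    have e : ρ * (p.c₂ * (p.α₀ * p.β₀)) / (k : ℝ) ^ (p.μ + p.ν) =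
        ρ * (p.c₂ * (p.α₀ * p.β₀ / (k : ℝ) ^ (p.μ + p.ν))) := by ring
    rw [e]
    nlinarith
  have h := le_of_linear_recursion hnn
    (fun t ht => meanGap_succ_le hn hp hW hX hnoise hf hxs hρ0 hρ ht) hT
  refine h.trans (add_le_add ?_ (le_of_eq ?_))
  · exact mul_le_mul_of_nonneg_right (prod_one_sub_le_exp (mul_nonneg hρ0 ha.le)
      (add_pos hp.μ_pos hp.ν_pos).le hψ hp.one_le_T₀ hT hnn)
      (integral_nonneg fun ω => sq_nonneg _)
  · rw [weightedSum, Finset.mul_sum]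
    exact Finset.sum_congr rfl fun s _ => by ring

lemma integral_sqDist_eq (hp : p.Valid)
    (hX : IsDimix p f W e X) (hnoise : NoiseAssumption P p.γ e X)
    (hf : FunctionAssumption P p f X) (xs : EuclideanSpace ℝ (Fin d)) {t : ℕ} (ht : 1 ≤ t) :
    Integrable (sqDist p X xs t) P ∧
      ∫ ω, sqDist p X xs t ω ∂P = ∫ ω, disp p.r (X t ω) ∂P + meanGap P p X xs t := by
  have hX2 := sqInt_state hX hnoise hf.smooth ht
  have h1 := hX2.integrable_disp p.r
  have h2 : Integrable (fun ω => ‖rMean p.r (X t ω) - xs‖ ^ 2) P :=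
    ((hX2.rMean p.r).sub (memLp_const xs)).integrable_norm_pow two_ne_zero
  have e1 : sqDist p X xs t = fun ω => disp p.r (X t ω) + ‖rMean p.r (X t ω) - xs‖ ^ 2 :=
    funext fun ω => rNormSq_sub_const hp.r_sum _ _
  rw [e1]
  exact ⟨h1.add h2, integral_add h1 h2⟩

end Bounds

/-! ### The convergence rates -/

section Rates

variable {n : ℕ} {p : Params n}

lemma Params.ξ₃_eq (hp : p.Valid) : p.ξ₃ = p.c₂ * (p.α₀ * p.β₀) / (1 - p.μ - p.ν) := by
  have hmL : p.m + p.L ≠ 0 := (add_pos hp.m_pos hp.L_pos).ne'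
  rw [Params.ξ₃, Params.c₂]
  by_cases h : 1 - p.μ - p.ν = 0
  · simp [h]
  · field_simp

lemma Params.c₂_mul_eq (p : Params n) :
    p.α₀ * p.β₀ * p.m * p.L / (p.m + p.L) = p.c₂ * (p.α₀ * p.β₀) := by
  rw [Params.c₂]; ring

lemma Params.σ₀_sub (p : Params n) : p.σ₀ - (p.μ + p.ν) = min (p.μ - p.ν) (2 * p.ν) := by
  rw [Params.σ₀, ← min_sub_sub_right]
  congr 1 <;> ring

lemma Params.σ₀_nonneg (hp : p.Valid) : 0 ≤ p.σ₀ := by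
  have h1 := hp.μ_pos
  have h2 := hp.ν_pos
  exact le_min (by linarith) (by linarith)

lemma Params.rate_pos (hp : p.Valid) : 0 < p.c₂ * (p.α₀ * p.β₀) :=
  mul_pos hp.c₂_pos (mul_pos hp.α₀_pos hp.β₀_pos)

lemma Params.one_sub_rate_nonneg (hp : p.Valid) {ρ : ℝ} (hρ0 : 0 ≤ ρ) (hρ : ρ ≤ 2) {k : ℕ}
    (hk : p.T₀ ≤ k) : 0 ≤ 1 - ρ * (p.c₂ * (p.α₀ * p.β₀)) / (k : ℝ) ^ (p.μ + p.ν) := by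
  have h := hp.two_mul_c₂_mul_le hk
  rw [p.alpha_mul_beta (hp.one_le_T₀.trans hk)] at h
  have h0 : 0 ≤ p.c₂ * (p.α₀ * p.β₀ / (k : ℝ) ^ (p.μ + p.ν)) :=
    mul_nonneg hp.c₂_pos.le (div_nonneg (mul_pos hp.α₀_pos hp.β₀_pos).le
      (Real.rpow_nonneg (Nat.cast_nonneg k) _))
  have e : ρ * (p.c₂ * (p.α₀ * p.β₀)) / (k : ℝ) ^ (p.μ + p.ν) =
      ρ * (p.c₂ * (p.α₀ * p.β₀ / (k : ℝ) ^ (p.μ + p.ν))) := by ring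
  rw [e]
  nlinarith

/-- Here L²/c₂ = L(m + L)/m; the additional mL and the doubled noise term in `ξ₄` are slack. -/
lemma Params.forcing_le (hp : p.Valid) (hξ : 0 ≤ p.ξ₁) :
    p.α₀ * p.β₀ * (p.L ^ 2 / ((2 - 1) * p.c₂)) * p.ξ₁ + p.γ * p.β₀ ^ 2 ≤
      p.α₀ * p.β₀ * p.L * (p.m * p.L + p.m + p.L) * p.ξ₁ / p.m + 2 * p.γ * p.β₀ ^ 2 := by
  have hα := hp.α₀_pos
  have hβ := hp.β₀_pos
  have hm := hp.m_pos
  have hL := hp.L_pos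
  have e : p.α₀ * p.β₀ * (p.L ^ 2 / ((2 - 1) * p.c₂)) * p.ξ₁ =
      p.α₀ * p.β₀ * p.L * (p.m + p.L) * p.ξ₁ / p.m := by
    rw [Params.c₂]; field_simp; ring
  have h1 : p.α₀ * p.β₀ * p.L * (p.m + p.L) * p.ξ₁ / p.m ≤
      p.α₀ * p.β₀ * p.L * (p.m * p.L + p.m + p.L) * p.ξ₁ / p.m := by
    gcongr
    nlinarith [mul_pos hm hL]
  rw [e]
  nlinarith [mul_pos hp.γ_pos (pow_pos hβ 2)]

lemma Params.forcing_crit_le (hp : p.Valid) (hξ : 0 ≤ p.ξ₁) :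
    p.α₀ * p.β₀ * (p.L ^ 2 / ((2 - 3 / 2) * p.c₂)) * p.ξ₁ + p.γ * p.β₀ ^ 2 ≤
      p.α₀ * p.β₀ * p.L * (p.m * p.L + 2 * (p.m + p.L)) * p.ξ₁ / p.m + 2 * p.γ * p.β₀ ^ 2 := by
  have hα := hp.α₀_pos
  have hβ := hp.β₀_pos
  have hm := hp.m_pos
  have hL := hp.L_pos
  have e : p.α₀ * p.β₀ * (p.L ^ 2 / ((2 - 3 / 2) * p.c₂)) * p.ξ₁ =
      p.α₀ * p.β₀ * p.L * (2 * (p.m + p.L)) * p.ξ₁ / p.m := by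
    rw [Params.c₂]; field_simp; ring
  have h1 : p.α₀ * p.β₀ * p.L * (2 * (p.m + p.L)) * p.ξ₁ / p.m ≤
      p.α₀ * p.β₀ * p.L * (p.m * p.L + 2 * (p.m + p.L)) * p.ξ₁ / p.m := by
    gcongr
    nlinarith [mul_pos hm hL]
  rw [e]
  nlinarith [mul_pos hp.γ_pos (pow_pos hβ 2)]

lemma weightedSum_nonneg {b σ δ : ℝ} {s₀ T : ℕ}
    (h : ∀ k, s₀ ≤ k → 0 ≤ 1 - b / (k : ℝ) ^ δ) : 0 ≤ weightedSum b σ δ s₀ T :=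
  Finset.sum_nonneg fun s hs => mul_nonneg (by positivity) (Finset.prod_nonneg fun k hk =>
    h k (by rw [Finset.mem_Ico] at hs hk; omega))

lemma mul_le_mul_mul {x c w A R : ℝ} (h1 : x ≤ c) (h2 : w ≤ A * R) (hw : 0 ≤ w) (hc : 0 ≤ c) :
    x * w ≤ c * A * R :=
  (mul_le_mul h1 h2 hw hc).trans_eq (mul_assoc _ _ _).symm

lemma Params.forcing_nonneg (hp : p.Valid) (hξ : 0 ≤ p.ξ₁) :
    0 ≤ p.α₀ * p.β₀ * p.L * (p.m * p.L + p.m + p.L) * p.ξ₁ / p.m + 2 * p.γ * p.β₀ ^ 2 := by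
  have := hp.α₀_pos
  have := hp.β₀_pos
  have := hp.m_pos
  have := hp.L_pos
  have := hp.γ_pos
  positivity

lemma Params.forcing_crit_nonneg (hp : p.Valid) (hξ : 0 ≤ p.ξ₁) :
    0 ≤ p.α₀ * p.β₀ * p.L * (p.m * p.L + 2 * (p.m + p.L)) * p.ξ₁ / p.m
      + 2 * p.γ * p.β₀ ^ 2 := by
  have := hp.α₀_pos
  have := hp.β₀_pos
  have := hp.m_pos
  have := hp.L_pos
  have := hp.γ_pos
  positivity

/-- The exponential is (S/T)^{ρa}, which is at most (S/T)^a since S ≤ T and ρ ≥ 1. One form of the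
initial term thus serves both ρ = 1 and ρ = 3/2. -/
lemma exp_log_sub_mul_le {a ρ q Q S T : ℝ} (ha : 0 < a) (hρ : 1 ≤ ρ) (hS : 0 < S) (hS1 : 1 ≤ T)
    (hST : S ≤ T) (hq : q ≤ a) (hQ : 0 ≤ Q) :
    Real.exp (ρ * a * (Real.log S - Real.log T)) * Q ≤ 2 * S ^ a * Q * T ^ (-q) := by
  have hT0 : 0 < T := by linarith
  have hlog : Real.log S - Real.log T ≤ 0 := by linarith [Real.log_le_log hS hST]
  have h1 : Real.exp (ρ * a * (Real.log S - Real.log T)) ≤ S ^ a * T ^ (-a) := by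
    rw [Real.rpow_def_of_pos hS, Real.rpow_def_of_pos hT0, ← Real.exp_add]
    refine Real.exp_le_exp.2 ?_
    have := mul_nonneg (mul_nonneg (sub_nonneg.2 hρ) ha.le) (neg_nonneg.2 hlog)
    nlinarith
  have h2 : T ^ (-a) ≤ T ^ (-q) := Real.rpow_le_rpow_of_exponent_le hS1 (by linarith)
  have h3 : 0 ≤ S ^ a * Q := by positivity
  have h4 := mul_le_mul_of_nonneg_right h1 hQ
  have h5 := mul_le_mul_of_nonneg_left h2 h3
  have h6 : 0 ≤ S ^ a * Q * T ^ (-q) := by positivity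
  linarith

end Rates

section RateTheorems

variable {n d : ℕ} {Ω : Type*} [MeasurableSpace Ω] {P : Measure Ω} [IsProbabilityMeasure P]
  {p : Params n} {f : Fin n → EuclideanSpace ℝ (Fin d) → ℝ}
  {W : ℕ → Matrix (Fin n) (Fin n) ℝ} {e X : ℕ → Ω → Config n d}

theorem meanGap_le_of_lt_one (hn : 2 ≤ n) (hp : p.Valid) (hW : ConnectivityAssumption p W)
    (hX : IsDimix p f W e X) (hnoise : NoiseAssumption P p.γ e X)
    (hf : FunctionAssumption P p f X) {xs : EuclideanSpace ℝ (Fin d)}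
    (hxs : ∀ x, ∑ i, p.r i * f i xs ≤ ∑ i, p.r i * f i x) (hμν : p.μ + p.ν < 1)
    {T : ℕ} (hT : p.T₀ ≤ T) (hT4 : p.T₄ ≤ T) :
    meanGap P p X xs T ≤
      p.ξ₂ (meanGap P p X xs p.T₀) * Real.exp (-p.ξ₃ * (T : ℝ) ^ (1 - p.μ - p.ν))
        + p.ξ₄ * (T : ℝ) ^ (-min (p.μ - p.ν) (2 * p.ν)) := by
  have hξ := ξ₁_nonneg hn hp hW
  have h1μν : 0 < 1 - p.μ - p.ν := by linarith
  have hT1 : 1 ≤ T := hp.one_le_T₀.trans hT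
  have hQ₀ : 0 ≤ meanGap P p X xs p.T₀ := integral_nonneg fun ω => sq_nonneg _
  refine (meanGap_le hn hp hW hX hnoise hf hxs (ρ := 1) (by norm_num) (by norm_num)
    hT (fun u hu => hasDerivAt_rpow_potential hμν hu)).trans (add_le_add ?_ ?_)
  · have e : Real.exp (1 * (p.c₂ * (p.α₀ * p.β₀)) *
        ((p.T₀ : ℝ) ^ (1 - (p.μ + p.ν)) / (1 - (p.μ + p.ν)) -
          (T : ℝ) ^ (1 - (p.μ + p.ν)) / (1 - (p.μ + p.ν)))) =
        Real.exp (p.ξ₃ * (p.T₀ : ℝ) ^ (1 - p.μ - p.ν)) *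
          Real.exp (-p.ξ₃ * (T : ℝ) ^ (1 - p.μ - p.ν)) := by
      rw [← Real.exp_add, Params.ξ₃_eq hp, sub_add_eq_sub_sub]
      congr 1
      ring
    rw [e, Params.ξ₂]
    have : 0 ≤ Real.exp (p.ξ₃ * (p.T₀ : ℝ) ^ (1 - p.μ - p.ν)) *
          Real.exp (-p.ξ₃ * (T : ℝ) ^ (1 - p.μ - p.ν)) * meanGap P p X xs p.T₀ := by positivity
    linarith
  · have hnn := fun k (hk : p.T₀ ≤ k) =>
      Params.one_sub_rate_nonneg hp (ρ := 1) (by norm_num) (by norm_num) hk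
    rw [one_mul] at hnn ⊢
    have hw := weightedSum_le_of_lt_one (σ := p.σ₀) (δ := p.μ + p.ν) (Params.rate_pos hp)
      (Params.σ₀_nonneg hp) (add_pos hp.μ_pos hp.ν_pos).le hμν hp.one_le_T₀ hT1 hnn (by
        -- If μ < ν the required lower bound on T is negative; the maximum with 0 in T₄ keeps the
        -- base of the power nonnegative.
        have h := le_rpow_of_ceil_le (le_max_left _ _) h1μν hT4
        rw [p.σ₀_sub, sub_add_eq_sub_sub]
        refine le_trans ?_ ((le_max_right _ _).trans h)
        rw [mul_assoc p.c₂])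
    rw [p.σ₀_sub] at hw
    rw [Params.ξ₄, p.c₂_mul_eq]
    exact mul_le_mul_mul (Params.forcing_le hp hξ) hw (weightedSum_nonneg hnn)
      (Params.forcing_nonneg hp hξ)

theorem meanGap_le_of_eq_one (hn : 2 ≤ n) (hp : p.Valid) (hW : ConnectivityAssumption p W)
    (hX : IsDimix p f W e X) (hnoise : NoiseAssumption P p.γ e X)
    (hf : FunctionAssumption P p f X) {xs : EuclideanSpace ℝ (Fin d)}
    (hxs : ∀ x, ∑ i, p.r i * f i xs ≤ ∑ i, p.r i * f i x) (hμν : p.μ + p.ν = 1)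
    (hcond : (p.m + p.L) / (p.m * p.L) * min (2 * p.μ - 1) (2 * p.ν) ≤ p.α₀ * p.β₀)
    {T : ℕ} (hT : p.T₀ ≤ T) :
    meanGap P p X xs T ≤
      p.ξ₅ (meanGap P p X xs p.T₀) * (T : ℝ) ^ (-min (p.μ - p.ν) (2 * p.ν)) := by
  have hξ := ξ₁_nonneg hn hp hW
  have hm := hp.m_pos
  have hL := hp.L_pos
  have hc := hp.c₂_pos
  have ha := Params.rate_pos hp
  have hT₀ := hp.one_le_T₀
  have hT₀' : (0 : ℝ) < p.T₀ := by exact_mod_cast hT₀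
  have hT1 : 1 ≤ T := hT₀.trans hT
  have hT1' : (1 : ℝ) ≤ T := by exact_mod_cast hT1
  have hT' : (p.T₀ : ℝ) ≤ T := by exact_mod_cast hT
  have hQ₀ : 0 ≤ meanGap P p X xs p.T₀ := integral_nonneg fun ω => sq_nonneg _
  have hmin : min (2 * p.μ - 1) (2 * p.ν) = min (p.μ - p.ν) (2 * p.ν) := by
    congr 1; linarith
  have hσ₀ := p.σ₀_sub
  rw [hμν] at hσ₀
  have hψ : ∀ u : ℝ, 0 < u → HasDerivAt Real.log (u ^ (-(p.μ + p.ν))) u := fun u hu => by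
    rw [hμν]; exact hasDerivAt_log_potential hu
  have hscale : (p.m + p.L) / (p.m * p.L) * min (2 * p.μ - 1) (2 * p.ν) =
      min (p.μ - p.ν) (2 * p.ν) / p.c₂ := by
    rw [hmin, Params.c₂]; field_simp
  rw [hscale] at hcond
  have hale : min (p.μ - p.ν) (2 * p.ν) ≤ p.c₂ * (p.α₀ * p.β₀) := by
    rw [div_le_iff₀ hc] at hcond
    linarith
  rw [Params.ξ₅, p.c₂_mul_eq, hscale, add_mul]
  split_ifs with hcrit
  · have hac : p.c₂ * (p.α₀ * p.β₀) = p.σ₀ - 1 := by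
      rw [eq_div_iff hc.ne'] at hcrit
      rw [hσ₀, ← hcrit]; ring
    -- With ρ = 1 the denominator b - σ₀ + 1 would vanish. With ρ = 3/2 it equals a/2 > 0, at the
    -- price of a larger forcing constant.
    refine (meanGap_le hn hp hW hX hnoise hf hxs (ρ := 3 / 2) (by norm_num) (by norm_num)
      hT hψ).trans (add_le_add
        (exp_log_sub_mul_le ha (by norm_num) hT₀' hT1' hT' hale hQ₀) ?_)
    have hnn := fun k (hk : p.T₀ ≤ k) =>
      Params.one_sub_rate_nonneg hp (ρ := 3 / 2) (by norm_num) (by norm_num) hk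
    rw [hμν] at hnn ⊢
    have hw := weightedSum_le_of_eq_one (σ := p.σ₀) (by positivity) (Params.σ₀_nonneg hp) hT₀ hT1
      hnn (by linarith)
    rw [hσ₀] at hw
    rw [Params.ξ₄crit, p.c₂_mul_eq]
    exact mul_le_mul_mul (Params.forcing_crit_le hp hξ) hw (weightedSum_nonneg hnn)
      (Params.forcing_crit_nonneg hp hξ)
  · have hlt : min (p.μ - p.ν) (2 * p.ν) < p.c₂ * (p.α₀ * p.β₀) := by
      refine lt_of_le_of_ne hale fun h => hcrit ?_
      rw [eq_div_iff hc.ne', h]; ring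
    refine (meanGap_le hn hp hW hX hnoise hf hxs (ρ := 1) (by norm_num) (by norm_num)
      hT hψ).trans (add_le_add (exp_log_sub_mul_le ha le_rfl hT₀' hT1' hT' hale hQ₀) ?_)
    have hnn := fun k (hk : p.T₀ ≤ k) =>
      Params.one_sub_rate_nonneg hp (ρ := 1) (by norm_num) (by norm_num) hk
    rw [hμν, one_mul] at hnn
    rw [Params.ξ₄, p.c₂_mul_eq, hμν, one_mul]
    have hw := weightedSum_le_of_eq_one (σ := p.σ₀) ha (Params.σ₀_nonneg hp) hT₀ hT1
      hnn (by linarith)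
    rw [hσ₀] at hw
    exact mul_le_mul_mul (Params.forcing_le hp hξ) hw (weightedSum_nonneg hnn)
      (Params.forcing_nonneg hp hξ)

end RateTheorems

end

/-! ### Assembly of the three regimes. -/

theorem theorem1 {n d : ℕ} (hn : 2 ≤ n) {Ω : Type*} [MeasurableSpace Ω]
    (P : Measure Ω) [IsProbabilityMeasure P]
    (p : Params n) (hp : p.Valid)
    (f : Fin n → EuclideanSpace ℝ (Fin d) → ℝ)
    (W : ℕ → Matrix (Fin n) (Fin n) ℝ)
    (e X : ℕ → Ω → Config n d)
    (hX : IsDimix p f W e X)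
    (hnoise : NoiseAssumption P p.γ e X)
    (hW : ConnectivityAssumption p W)
    (hf : FunctionAssumption P p f X)
    (xs : EuclideanSpace ℝ (Fin d))
    (hxs : ∀ x, ∑ i, p.r i * f i xs ≤ ∑ i, p.r i * f i x) :
    (∀ t, 1 ≤ t → Integrable (sqDist p X xs t) P) ∧
    (p.μ + p.ν < 1 →
      ∀ T : ℕ, max p.T₁ (max p.T₂ (max p.T₃ p.T₄)) ≤ T →
        ∫ ω, sqDist p X xs T ω ∂P ≤
          p.ξ₁ * (T : ℝ) ^ (-min p.μ (2 * p.ν))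
            + p.ξ₂ (meanGap P p X xs p.T₀) * Real.exp (-p.ξ₃ * (T : ℝ) ^ (1 - p.μ - p.ν))
            + p.ξ₄ * (T : ℝ) ^ (-min (p.μ - p.ν) (2 * p.ν))) ∧
    (p.μ + p.ν = 1 →
      (p.m + p.L) / (p.m * p.L) * min (2 * p.μ - 1) (2 * p.ν) ≤ p.α₀ * p.β₀ →
      ∀ T : ℕ, max p.T₁ (max p.T₂ p.T₃) ≤ T →
        ∫ ω, sqDist p X xs T ω ∂P ≤
          p.ξ₁ * (T : ℝ) ^ (-min p.μ (2 * p.ν))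
            + p.ξ₅ (meanGap P p X xs p.T₀) * (T : ℝ) ^ (-min (p.μ - p.ν) (2 * p.ν))) ∧
    (p.μ = 3 / 4 → p.ν = 1 / 4 →
      (p.m + p.L) / (p.m * p.L) * (1 / 2) ≤ p.α₀ * p.β₀ →
      ∀ T : ℕ, max p.T₁ (max p.T₂ p.T₃) ≤ T →
        ∫ ω, sqDist p X xs T ω ∂P ≤
          (p.ξ₁ + p.ξ₅ (meanGap P p X xs p.T₀)) * (T : ℝ) ^ (-(1 / 2) : ℝ)) := by
  have hdisp : ∀ {T : ℕ}, p.T₀ ≤ T →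
      ∫ ω, sqDist p X xs T ω ∂P ≤
        p.ξ₁ * (T : ℝ) ^ (-min p.μ (2 * p.ν)) + meanGap P p X xs T := fun hT => by
    rw [(integral_sqDist_eq hp hX hnoise hf xs (hp.one_le_T₀.trans hT)).2]
    exact add_le_add_left (integral_disp_state_le_rpow hn hp hW hX hnoise hf hT) _
  have hcritical := fun (hμν : p.μ + p.ν = 1)
      (hcond : (p.m + p.L) / (p.m * p.L) * min (2 * p.μ - 1) (2 * p.ν) ≤ p.α₀ * p.β₀)
      (T : ℕ) (hT : max p.T₁ (max p.T₂ p.T₃) ≤ T) =>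
    (hdisp hT).trans (add_le_add_right
      (meanGap_le_of_eq_one hn hp hW hX hnoise hf hxs hμν hcond hT) _)
  refine ⟨fun t ht => (integral_sqDist_eq hp hX hnoise hf xs ht).1, ?_, hcritical, ?_⟩
  · intro hμν T hT
    simp only [max_le_iff] at hT
    have hT₀ : p.T₀ ≤ T := max_le hT.1 (max_le hT.2.1 hT.2.2.1)
    rw [add_assoc]
    exact (hdisp hT₀).trans (add_le_add_right
      (meanGap_le_of_lt_one hn hp hW hX hnoise hf hxs hμν hT₀ hT.2.2.2) _)
  -- For these exponents min(μ, 2ν) and min(μ - ν, 2ν) both equal 1/2, so the two terms merge.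
  · intro hμ hν hcond T hT
    have h := hcritical (by rw [hμ, hν]; norm_num)
      (by rw [hμ, hν]; norm_num at hcond ⊢; linarith) T hT
    rw [hμ, hν] at h
    norm_num at h ⊢
    linarith
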